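/- For $N\ge 3$ let $$\mathcal S_N=\Big\{\vec v=(v_1,\dots,v_N)\in(\mathbb R^3)^N:\ \frac1N\sum_{j=1}^N|v_j|^2=1,\ \ \frac1N\sum_{j=1}^N v_j=0\Big\},$$ which is a Euclidean sphere of radius $\sqrt N$ in the $(3N-3)$-dimensional space $\{\sum_j v_j=0\}$, and let $\sigma_N$ be the uniform (rotation invariant) probability measure on it. For $1\le k\le N$ let $P_k$ be the orthogonal projection of $L^2(\mathcal S_N,\sigma_N)$ onto the closed subspace of square integrable functions that depend on $\vec v$ through $v_k$ alone (that is, $P_kf$ is the conditional expectation of $f$ given $v_k$). For $\alpha\in[0,2]$ the generator of the conjugate Kac process is $$\widehat L_{N,\alpha}f=-\frac1N\sum_{k=1}^N\left[\frac{N^2-(1+|v_k|^2)N}{(N-1)^2}\right]^{\alpha/2}\big[f-P_kf\big],$$ where for $\alpha=0$ the weight $[\,\cdot\,]^{0}$ is $1$; its Dirichlet form is $\mathcal D_{N,\alpha}(f,f)=-\langle f,\widehat L_{N,\alpha}f\rangle_{L^2(\sigma_N)}$, and its spectral gap is $$\widehat\Delta_{N,\alpha}=\inf\big\{\mathcal D_{N,\alpha}(f,f):\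 f\in L^2(\mathcal S_N,\sigma_N),\ \langle f,1\rangle=0,\ \|f\|_2^2=1\big\}.$$ Let $P^{(0)}=\frac1N\sum_{k=1}^N P_k$, so that $\widehat L_{N,0}f=-(f-P^{(0)}f)$. **Lemma.** For all $N\ge 3$, $$\widehat\Delta_{N,0}=1-\frac{3N-1}{3(N-1)^2},$$ and the second largest eigenvalue $\mu^{(0)}$ of $P^{(0)}$ is $$\mu^{(0)}=\frac{3N-1}{3(N-1)^2}$$ (that is: $P^{(0)}$ has a largest eigenvalue, this eigenvalue is simple, and $\mu^{(0)}$ is the largest among the other eigenvalues). In particular $\widehat\Delta_{N,0}=1-\frac1N+\mathcal O\!\left(\frac1{N^2}\right)$ as $N\to\infty$. -/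

import Mathlib

open MeasureTheory

noncomputable section

namespace KacModel

/-- `N`-tuples of vectors of `ℝ³`, with the Euclidean norm `‖v‖² = ∑ j, ‖v j‖²`. -/
abbrev Conf (N : ℕ) : Type := PiLp 2 (fun _ : Fin N => EuclideanSpace ℝ (Fin 3))

/-- The state space `𝒮_N`: energy per particle `1` and total momentum `0`. -/
def stateSpace (N : ℕ) : Set (Conf N) :=
  {v | (1 / (N : ℝ)) * ∑ j, ‖v j‖ ^ 2 = 1 ∧ (1 / (N : ℝ)) • ∑ j, v j = 0}

/-- The linear space of `N`-tuples with total momentum `0`. -/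
def zeroMomentum (N : ℕ) : Submodule ℝ (Conf N) where
  carrier := {v | ∑ j, v j = 0}
  zero_mem' := by simp
  add_mem' := by
    intro a b ha hb
    simp only [Set.mem_ofPred_eq, PiLp.add_apply, Finset.sum_add_distrib] at *
    rw [ha, hb, add_zero]
  smul_mem' := by
    intro c a ha
    simp only [Set.mem_ofPred_eq, PiLp.smul_apply, ← Finset.smul_sum] at *
    rw [ha, smul_zero]

/-- Lebesgue measure on the Euclidean space of zero-momentum configurations (normalized so that
the unit cube over an orthonormal basis has measure one). -/
def lebesgueZeroMomentum (N : ℕ) : Measure (zeroMomentum N) :=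
  (stdOrthonormalBasis ℝ (zeroMomentum N)).toBasis.addHaar

/-- `u ↦ √N u` maps the unit sphere of the zero-momentum space to `𝒮_N`; for `N ≥ 1` it is a
bijection onto `𝒮_N`, so that `𝒮_N` is a Euclidean sphere of radius `√N`. -/
def scaleMap (N : ℕ) (u : Metric.sphere (0 : zeroMomentum N) 1) : stateSpace N :=
  ⟨Real.sqrt N • (u.1 : Conf N), by
    have hu : ‖(u.1 : Conf N)‖ = 1 := by
      have h := mem_sphere_zero_iff_norm.mp u.2
      exact h
    have hz : ∑ j, (u.1 : Conf N) j = 0 := u.1.2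
    have hN : (N : ℝ) ≠ 0 := by
      rintro h
      have h0 : N = 0 := by exact_mod_cast h
      subst h0
      have : (u.1 : Conf 0) = 0 := Subsingleton.elim _ _
      rw [this, norm_zero] at hu
      exact zero_ne_one hu
    have hs : ∑ j, ‖(u.1 : Conf N) j‖ ^ 2 = 1 := by
      rw [← PiLp.norm_sq_eq_of_L2, hu, one_pow]
    refine ⟨?_, ?_⟩
    · simp only [PiLp.smul_apply, norm_smul, mul_pow, ← Finset.mul_sum, hs]
      rw [Real.norm_eq_abs, sq_abs, Real.sq_sqrt (Nat.cast_nonneg N)]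
      field_simp
    · simp only [PiLp.smul_apply, ← Finset.smul_sum, hz, smul_zero]⟩

/-- The uniform probability measure `σ_N` on `𝒮_N`: the normalized rotation-invariant surface
measure of the unit sphere in the zero-momentum space, carried to `𝒮_N` by scaling. -/
def sigma (N : ℕ) : Measure (stateSpace N) :=
  Measure.map (scaleMap N)
    (((lebesgueZeroMomentum N).toSphere Set.univ)⁻¹ • (lebesgueZeroMomentum N).toSphere)

/-- The real Hilbert space `L²(𝒮_N, σ_N)`. -/
abbrev L2 (N : ℕ) : Type := Lp ℝ 2 (sigma N)

/-- The velocity `v_k` as a function on `𝒮_N`. -/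
def velocity {N : ℕ} (k : Fin N) (v : stateSpace N) : EuclideanSpace ℝ (Fin 3) := v.1 k

lemma measurable_velocity {N : ℕ} (k : Fin N) : Measurable (velocity k) := by
  have : Continuous (velocity k) := by
    unfold velocity
    fun_prop
  exact this.measurable

/-- `P_k`: the orthogonal projection of `L²(𝒮_N)` onto the closed subspace of the square integrable
functions that depend on `v` through `v_k` alone, i.e. (up to null sets) are measurable with respect
to the sigma-algebra generated by `v_k`. Equivalently, the conditional expectation given `v_k`. -/
def condProj (N : ℕ) (k : Fin N) : L2 N →L[ℝ] L2 N :=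
  (lpMeas ℝ ℝ (MeasurableSpace.comap (velocity k) inferInstance) 2 (sigma N)).subtypeL ∘L
    condExpL2 ℝ ℝ (measurable_velocity k).comap_le

/-- The weight `w_N(v) = (N² - (1 + |v|²) N) / (N - 1)²`. -/
def weight (N : ℕ) (v : EuclideanSpace ℝ (Fin 3)) : ℝ :=
  ((N : ℝ) ^ 2 - (1 + ‖v‖ ^ 2) * N) / ((N : ℝ) - 1) ^ 2

/-- The generator of the conjugate Kac process:
`- (1/N) ∑ k, w_N(v_k) ^ (α/2) (f - P_k f)`. -/
def conjGenerator (N : ℕ) (α : ℝ) (f : L2 N) (v : stateSpace N) : ℝ :=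
  -((1 / (N : ℝ)) * ∑ k : Fin N, weight N (velocity k v) ^ (α / 2) * (f v - condProj N k f v))

/-- The Dirichlet form `𝒟_{N,α}(f,f) = -⟨f, L̂_{N,α} f⟩`. -/
def conjDirichlet (N : ℕ) (α : ℝ) (f : L2 N) : ℝ :=
  -∫ v, f v * conjGenerator N α f v ∂(sigma N)

/-- The spectral gap `Δ̂_{N,α}` of the conjugate Kac process. -/
def conjGap (N : ℕ) (α : ℝ) : ℝ :=
  sInf {d : ℝ | ∃ f : L2 N, ∫ v, f v ∂(sigma N) = 0 ∧ ‖f‖ ^ 2 = 1 ∧ d = conjDirichlet N α f}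

/-- The operator `P⁽⁰⁾ = (1/N) ∑ k, P_k` (for `α = 0` the weights `w_N(v_k) ^ (α/2)` are `1`). -/
def conjP0 (N : ℕ) : L2 N →L[ℝ] L2 N :=
  (1 / (N : ℝ)) • ∑ k : Fin N, condProj N k

/-- `μ` is the second largest eigenvalue of `T`: there is a largest eigenvalue, it is simple, and
`μ` is the largest of the other eigenvalues. (As the top eigenvalue is simple, it does not matter
whether eigenvalues are counted with multiplicity.) -/
def IsSecondLargestEigenvalue {E : Type*} [AddCommGroup E] [Module ℝ E] (T : Module.End ℝ E)
    (μ : ℝ) : Prop :=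
  ∃ top : ℝ, IsGreatest {x : ℝ | T.HasEigenvalue x} top ∧
    Module.finrank ℝ (T.eigenspace top) = 1 ∧
    IsGreatest {x : ℝ | T.HasEigenvalue x ∧ x ≠ top} μ

end KacModel

end

/-! The rescaled velocities `v_k / √(N - 1)` are the components of a uniform unit vector in
dimension `3N - 3` along orthonormal triples `partVec k`, and two different triples have cross Gram
matrix `t I` with `t = -1 / (N - 1)`. Hence inner products between functions of `v_k` and of `v_l`,
`k ≠ l`, are all given by one symmetric correlation operator `K`: `⟨f(v_k), g(v_l)⟩ = ⟨f, K g⟩`.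

On polynomials `K` is explicit (`corrOp`, `sphereInt_polyFun_mul`): a component along the second
triple is `t` times the one along the first plus an orthogonal part, whose conditional moments
follow from integration by parts on the sphere. `K` does not raise degrees, and its leading part in
each degree is a polynomial in `|x|² Δ`. Its eigenvalues are therefore the numbers `corrEig m t n l`
with `m = 3N - 6`, attached to `|x|^{2n} Y_l` (`exists_corrEig_of_eigenvector`).

The analytic core is `corrEig_le_topCorr`: apart from the constants, no eigenvalue exceeds `κ =
topCorr (N - 1)`, the value at `n = l = 1`. For `N = 3` this rests on a differential equation in the
angle together with a recursion; for `N ≥ 4` the low degrees are computed, and in high degree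
`corrEig m` is an average of eigenvalues of the case `m = 3`, which are bounded by `1`.

Splitting a family of mean-zero functions into its average and the deviations, and using `K ≥ -1 /
(N - 1)` on the deviations, yields `‖∑ f_k(v_k)‖² ≤ (1 + (N - 1) κ) ∑ ‖f_k‖²` (`norm_sum_sq_le`, by
density of polynomials). With `f_k = P_k f` and Cauchy–Schwarz this bounds `P⁽⁰⁾` off the constants
by `μ`, where `N μ = 1 + (N - 1) κ`. The bound is attained by the first component of `∑ |v_k|² v_k`:
applied to `|x|² x₀`, `K` also produces a multiple of `x₀`, which sums to zero by momentum
conservation (`exists_eigenvector_conjP0`). -/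

noncomputable section

namespace KacModel

/-! ### Integration by parts on the unit sphere, derived from Gaussian integrals -/

section SphereIntegral

open Metric Set Module

variable {E : Type*} [NormedAddCommGroup E] [InnerProductSpace ℝ E] [FiniteDimensional ℝ E]
  [MeasurableSpace E] [BorelSpace E] (μ : Measure E) [μ.IsAddHaarMeasure]

/-- The radial Gaussian moment `∫₀^∞ r ^ p exp (-r²) dr`. -/
def gaussMoment (p : ℕ) : ℝ := ∫ r in Ioi (0 : ℝ), r ^ p * Real.exp (-r ^ 2)

lemma gaussMoment_eq_gamma (p : ℕ) : gaussMoment p = 1 / 2 * Real.Gamma (((p : ℝ) + 1) / 2) := by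
  have h := integral_rpow_mul_exp_neg_rpow (p := 2) (q := p) (by norm_num)
    (by have := Nat.cast_nonneg (α := ℝ) p; linarith)
  simpa [gaussMoment] using h

lemma gaussMoment_pos (p : ℕ) : 0 < gaussMoment p := by
  rw [gaussMoment_eq_gamma]
  have := Real.Gamma_pos_of_pos (s := ((p : ℝ) + 1) / 2) (by positivity)
  positivity

lemma gaussMoment_add_two (p : ℕ) : gaussMoment (p + 2) = ((p : ℝ) + 1) / 2 * gaussMoment p := by
  rw [gaussMoment_eq_gamma, gaussMoment_eq_gamma]
  have h := Real.Gamma_add_one (s := ((p : ℝ) + 1) / 2) (by positivity)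
  have : (((p + 2 : ℕ) : ℝ) + 1) / 2 = ((p : ℝ) + 1) / 2 + 1 := by push_cast; ring
  rw [this, h]
  ring

/-- In polar coordinates the Gaussian integral of a homogeneous function is a radial moment times
its integral over the unit sphere. -/
lemma integral_homogeneous_mul_gauss [Nontrivial E] {F : E → ℝ} {k : ℕ}
    (hF : ∀ (r : ℝ) (x : E), F (r • x) = r ^ k * F x) :
    ∫ x, F x * Real.exp (-‖x‖ ^ 2) ∂μ =
      gaussMoment (finrank ℝ E - 1 + k) * ∫ ω, F (ω : sphere (0 : E) 1) ∂μ.toSphere := by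
  calc
    _ = ∫ x : ({(0)}ᶜ : Set E), F x.1 * Real.exp (-‖x.1‖ ^ 2) ∂(μ.comap (↑)) := by
      rw [integral_subtype_comap (measurableSet_singleton _).compl
        fun x ↦ F x * Real.exp (-‖x‖ ^ 2), restrict_compl_singleton]
    _ = ∫ x : sphere (0 : E) 1 × Ioi (0 : ℝ), F x.1 * (x.2.1 ^ k * Real.exp (-x.2.1 ^ 2))
          ∂μ.toSphere.prod (.volumeIoiPow (finrank ℝ E - 1)) := by
      rw [← μ.measurePreserving_homeomorphUnitSphereProd.integral_comp
        (Homeomorph.measurableEmbedding _)]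
      refine integral_congr_ae (Filter.Eventually.of_forall fun x => ?_)
      have hx : ‖x.1‖ ≠ 0 := norm_ne_zero_iff.mpr x.2
      have : F x.1 = ‖x.1‖ ^ k * F (‖x.1‖⁻¹ • x.1) := by
        rw [← hF, smul_smul, mul_inv_cancel₀ hx, one_smul]
      simp only [homeomorphUnitSphereProd_apply_snd_coe, homeomorphUnitSphereProd_apply_fst_coe]
      rw [this]
      ring
    _ = (∫ ω : sphere (0 : E) 1, F ω ∂μ.toSphere) *
          ∫ r : Ioi (0 : ℝ), r.1 ^ k * Real.exp (-r.1 ^ 2) ∂.volumeIoiPow (finrank ℝ E - 1) :=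
      integral_prod_mul (fun ω : sphere (0 : E) 1 => F ω)
        (fun r : Ioi (0 : ℝ) => r.1 ^ k * Real.exp (-r.1 ^ 2))
    _ = _ := by
      rw [mul_comm, gaussMoment]
      congr 1
      simp only [Measure.volumeIoiPow, ENNReal.ofReal]
      rw [integral_withDensity_eq_integral_smul,
        integral_subtype_comap measurableSet_Ioi fun a ↦
          Real.toNNReal (a ^ (finrank ℝ E - 1)) • (a ^ k * Real.exp (-a ^ 2)),
        setIntegral_congr_fun measurableSet_Ioi fun x hx ↦ ?_]
      · rw [NNReal.smul_def, Real.coe_toNNReal _ (pow_nonneg (le_of_lt hx) _), smul_eq_mul]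
        ring
      · exact (measurable_subtype_coe.pow_const _).real_toNNReal

lemma integrable_pow_mul_gauss [Nontrivial E] (k : ℕ) :
    Integrable (fun x : E => ‖x‖ ^ k * Real.exp (-‖x‖ ^ 2)) μ := by
  refine (integrable_fun_norm_addHaar μ (f := fun r => r ^ k * Real.exp (-r ^ 2))).mpr ?_
  have h := integrableOn_rpow_mul_exp_neg_mul_sq (b := 1) one_pos
    (s := ((finrank ℝ E - 1 + k : ℕ) : ℝ))
    (by have := Nat.cast_nonneg (α := ℝ) (finrank ℝ E - 1 + k); linarith)
  refine h.congr_fun (fun x _ => ?_) measurableSet_Ioi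
  simp only [Real.rpow_natCast, smul_eq_mul, pow_add]
  rw [neg_one_mul]
  ring

/-- A continuous homogeneous function is integrable against the Gaussian weight. -/
lemma integrable_homogeneous_mul_gauss [Nontrivial E] {F : E → ℝ} {k : ℕ} (hc : Continuous F)
    (hF : ∀ (r : ℝ) (x : E), F (r • x) = r ^ k * F x) :
    Integrable (fun x => F x * Real.exp (-‖x‖ ^ 2)) μ := by
  obtain ⟨C, hC⟩ := (isCompact_sphere (0 : E) 1).exists_bound_of_continuousOn hc.continuousOn
  refine ((integrable_pow_mul_gauss μ k).const_mul C).mono' (by fun_prop) ?_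
  have h0 : ∀ᵐ x ∂μ, x ≠ 0 := by
    have := Measure.ae_ne (μ := μ) (0 : E)
    simpa using this
  filter_upwards [h0] with x h0
  have hx : ‖x‖ ≠ 0 := norm_ne_zero_iff.mpr h0
  have : F x = ‖x‖ ^ k * F (‖x‖⁻¹ • x) := by
    rw [← hF, smul_smul, mul_inv_cancel₀ hx, one_smul]
  have h2 := hC (‖x‖⁻¹ • x) (by simp [norm_smul, hx])
  rw [this, norm_mul, norm_mul, Real.norm_of_nonneg (Real.exp_pos _).le,
    Real.norm_of_nonneg (by positivity : 0 ≤ ‖x‖ ^ k)]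
  calc _ ≤ ‖x‖ ^ k * C * Real.exp (-‖x‖ ^ 2) := by gcongr
    _ = _ := by ring

/-- Integration by parts on the sphere: for `P` homogeneous of degree `k + 1`, with derivative `P'`
in the direction `u`. -/
lemma sphere_stein [Nontrivial E] {P P' : E → ℝ} {k : ℕ} (u : E)
    (hP : Continuous P) (hP' : Continuous P')
    (hd : ∀ x, HasLineDerivAt ℝ P (P' x) x u)
    (hPh : ∀ (r : ℝ) (x : E), P (r • x) = r ^ (k + 1) * P x)
    (hPh' : ∀ (r : ℝ) (x : E), P' (r • x) = r ^ k * P' x) :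
    ((finrank ℝ E : ℝ) + k) * ∫ ω, inner ℝ u (ω : sphere (0 : E) 1).1 * P ω.1 ∂μ.toSphere =
      ∫ ω, P' (ω : sphere (0 : E) 1).1 ∂μ.toSphere := by
  set g : E → ℝ := fun x => Real.exp (-‖x‖ ^ 2)
  have hg : ∀ x, HasLineDerivAt ℝ g (-(2 * inner ℝ u x) * g x) x u := by
    intro x
    have h1 : HasFDerivAt (fun x : E => -‖x‖ ^ 2) (-(2 • (innerSL ℝ x))) x :=
      (hasStrictFDerivAt_norm_sq x).hasFDerivAt.neg
    have := (h1.exp).hasLineDerivAt u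
    convert! this using 1
    simp [g, real_inner_comm]
    ring
  have hih : ∀ (r : ℝ) (x : E), inner ℝ u (r • x) * P (r • x) = r ^ (k + 2) * (inner ℝ u x * P x) := by
    intro r x
    rw [hPh, inner_smul_right]
    ring
  have i1 := integrable_homogeneous_mul_gauss μ hP' hPh'
  have i2 := integrable_homogeneous_mul_gauss μ (F := fun x => inner ℝ u x * P x) (by fun_prop) hih
  have i3 := integrable_homogeneous_mul_gauss μ hP hPh
  -- Integrate by parts against the Gaussian on all of `E`. The radial moments of the two sides
  -- differ by the factor `(dim + k) / 2`, and the `2` cancels the one from differentiating the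
  -- Gaussian.
  have key := integral_bilinear_hasLineDerivAt_right_eq_neg_left_of_integrable (μ := μ)
    (f := P) (f' := P') (g := g) (g' := fun x => -(2 * inner ℝ u x) * g x) (v := u)
    (B := ContinuousLinearMap.mul ℝ ℝ) i1
    (by
      refine (i2.const_mul (-2)).congr (Filter.Eventually.of_forall fun x => ?_)
      simp only [ContinuousLinearMap.mul_apply', g]
      ring) i3 (fun x _ => hd x) (fun x _ => hg x)
  simp only [ContinuousLinearMap.mul_apply'] at key
  have e1 : ∫ x, P x * (-(2 * inner ℝ u x) * g x) ∂μ
      = -2 * ∫ x, (inner ℝ u x * P x) * Real.exp (-‖x‖ ^ 2) ∂μ := by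
    rw [← integral_const_mul]
    refine integral_congr_ae (Filter.Eventually.of_forall fun x => ?_)
    simp only [g]
    ring
  rw [e1, integral_homogeneous_mul_gauss μ hPh',
    integral_homogeneous_mul_gauss μ (F := fun x => inner ℝ u x * P x) hih] at key
  have hM : 0 < finrank ℝ E := finrank_pos
  have hc : ((finrank ℝ E - 1 + k : ℕ) : ℝ) = finrank ℝ E - 1 + k := by
    rw [Nat.cast_add, Nat.cast_pred hM]
  rw [← add_assoc, gaussMoment_add_two, hc] at key
  have hpos := gaussMoment_pos (finrank ℝ E - 1 + k)
  apply mul_left_cancel₀ hpos.ne'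
  linear_combination -key

end SphereIntegral

open MvPolynomial Metric Module

set_option linter.unusedSectionVars false

/-- Real polynomials in the three components of a vector. -/
abbrev Poly : Type := MvPolynomial (Fin 3) ℝ

/-! ### Polynomials in three variables, the Laplacian and the operator `|x|² Δ` -/

section Algebra

/-- The squared norm `x₁² + x₂² + x₃²`. -/
def normSqPoly : Poly := ∑ i, X i ^ 2

/-- The Laplacian. -/
def lap : Module.End ℝ Poly :=
  ∑ i, (pderiv i).toLinearMap ∘ₗ (pderiv i).toLinearMap

lemma lap_apply (p : Poly) : lap p = ∑ i, pderiv i (pderiv i p) := by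
  simp [lap]

/-- The dilation `p(x) ↦ p(t x)`. -/
def dil (t : ℝ) : Poly →ₐ[ℝ] Poly := aeval fun i => C t * X i

/-- The linear form `∑ Aᵢ xᵢ`. -/
def linForm (A : Fin 3 → ℝ) : Poly := ∑ i, C (A i) * X i

lemma isHomogeneous_linForm (A : Fin 3 → ℝ) : (linForm A).IsHomogeneous 1 :=
  IsHomogeneous.sum _ _ _ fun _ _ => isHomogeneous_C_mul_X _ _

lemma isHomogeneous_normSqPoly : normSqPoly.IsHomogeneous 2 :=
  IsHomogeneous.sum _ _ _ fun _ _ => isHomogeneous_X_pow _ _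

lemma isHomogeneous_normSqPoly_pow (j : ℕ) : (normSqPoly ^ j).IsHomogeneous (2 * j) :=
  isHomogeneous_normSqPoly.pow j

lemma eval_dil (t : ℝ) (x : Fin 3 → ℝ) (p : Poly) :
    eval x (dil t p) = eval (fun i => t * x i) p := by
  induction p using MvPolynomial.induction_on with
  | C a => simp [dil]
  | add p q hp hq => simp [hp, hq]
  | mul_X p i hp => rw [map_mul, map_mul, hp]; simp [dil]

lemma dil_of_isHomogeneous {p : Poly} {d : ℕ} (hp : p.IsHomogeneous d) (t : ℝ) :
    dil t p = t ^ d • p := by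
  apply MvPolynomial.funext
  intro x
  rw [eval_dil, smul_eval, eval_eq', eval_eq', Finset.mul_sum]
  refine Finset.sum_congr rfl fun s hs => ?_
  have hd := hp.degree_eq_sum_deg_support hs
  have hd' : ∑ i, s i = d := by
    rw [hd]
    exact (Finset.sum_subset (Finset.subset_univ _) (by simp)).symm
  simp only [mul_pow, Finset.prod_mul_distrib, Finset.prod_pow_eq_pow_sum, hd']
  ring

/-- A linear functional that vanishes on the `d`-th powers of all linear forms vanishes on all
homogeneous polynomials of degree `d`. -/
lemma eq_zero_of_linForm_pow {φ : Poly →ₗ[ℝ] ℝ} {d : ℕ} (h : ∀ A, φ (linForm A ^ d) = 0)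
    {p : Poly} (hp : p.IsHomogeneous d) : φ p = 0 := by
  -- By the multinomial theorem `Ψ` is `φ (linForm A ^ d)` as a polynomial in `A`. It vanishes
  -- identically, so each coefficient, a positive multinomial times `φ` of a monomial, is zero.
  obtain ⟨Ψ, hΨ⟩ : ∃ Ψ : Poly, Ψ = ∑ k ∈ Finset.piAntidiag (Finset.univ : Finset (Fin 3)) d,
    monomial (Finsupp.equivFunOnFinite.symm k)
      ((Nat.multinomial Finset.univ k : ℝ) * φ (monomial (Finsupp.equivFunOnFinite.symm k) 1)) :=
    ⟨_, rfl⟩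
  have hΨ0 : Ψ = 0 := by
    apply MvPolynomial.funext
    intro A
    rw [map_zero, ← h A, linForm, Finset.sum_pow_eq_sum_piAntidiag, map_sum φ, hΨ, map_sum]
    refine Finset.sum_congr rfl fun k _ => ?_
    have : ((Nat.multinomial Finset.univ k : Poly) * ∏ i, (C (A i) * X i : Poly) ^ k i)
        = ((Nat.multinomial Finset.univ k : ℝ) * ∏ i, A i ^ k i) •
          monomial (Finsupp.equivFunOnFinite.symm k) (1 : ℝ) := by
      rw [monomial_eq, Finsupp.prod_fintype _ _ (by simp), smul_eq_C_mul]
      simp only [mul_pow, Finset.prod_mul_distrib, map_mul, map_prod, map_pow, map_natCast,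
        Finsupp.equivFunOnFinite_symm_apply_apply, map_one, one_mul]
      ring
    rw [this, map_smul, eval_monomial, Finsupp.prod_fintype _ _ (by simp), smul_eq_mul]
    simp only [Finsupp.equivFunOnFinite_symm_apply_apply]
    ring
  have hmon : ∀ s : Fin 3 →₀ ℕ, s.degree = d → φ (monomial s 1) = 0 := by
    intro s hs
    have hc := congrArg (coeff s) hΨ0
    rw [hΨ, coeff_sum, coeff_zero, Finset.sum_eq_single (s : Fin 3 → ℕ)] at hc
    · have e : Finsupp.equivFunOnFinite.symm (s : Fin 3 → ℕ) = s := by ext; simp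
      rw [e, coeff_monomial, if_pos rfl] at hc
      rcases mul_eq_zero.mp hc with h1 | h1
      · exact absurd h1 (by exact_mod_cast (Nat.multinomial_pos _ _).ne')
      · exact h1
    · intro k _ hk
      rw [coeff_monomial, if_neg]
      rintro rfl
      exact hk (by ext; simp)
    · intro hk
      exact absurd (by simp [Finset.mem_piAntidiag, ← hs, Finsupp.degree_eq_sum]) hk
  rw [p.as_sum, map_sum]
  refine Finset.sum_eq_zero fun s hs => ?_
  have : monomial s (coeff s p) = coeff s p • monomial s (1 : ℝ) := by
    rw [smul_monomial, smul_eq_mul, mul_one]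
  rw [this, map_smul, hmon s (hp.degree_eq_sum_deg_support hs).symm, smul_zero]

lemma lap_isHomogeneous {p : Poly} {d : ℕ} (hp : p.IsHomogeneous (d + 2)) :
    (lap p).IsHomogeneous d := by
  rw [lap_apply]
  exact IsHomogeneous.sum _ _ _ fun i _ => (hp.pderiv (i := i)).pderiv

lemma lap_eq_zero {p : Poly} {d : ℕ} (hp : p.IsHomogeneous d) (hd : d < 2) : lap p = 0 := by
  rw [lap_apply]
  refine Finset.sum_eq_zero fun i _ => ?_
  have h1 : (pderiv i p).IsHomogeneous 0 := by
    have := hp.pderiv (i := i)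
    rwa [show d - 1 = 0 by omega] at this
  have h2 := totalDegree_eq_zero_iff_eq_C.mp ((totalDegree_zero_iff_isHomogeneous (p := pderiv i p)).mpr h1)
  rw [h2, pderiv_C]

lemma lap_pow_isHomogeneous {p : Poly} {d : ℕ} (hp : p.IsHomogeneous d) {j : ℕ} (hj : 2 * j ≤ d) :
    ((lap ^ j) p).IsHomogeneous (d - 2 * j) := by
  induction j with
  | zero => simpa using hp
  | succ j ih =>
    have := ih (by omega)
    rw [show d - 2 * j = d - 2 * (j + 1) + 2 by omega] at this
    rw [pow_succ', Module.End.mul_apply]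
    exact lap_isHomogeneous this

lemma lap_pow_eq_zero {p : Poly} {d : ℕ} (hp : p.IsHomogeneous d) {j : ℕ} (hj : d < 2 * j) :
    (lap ^ j) p = 0 := by
  induction j with
  | zero => omega
  | succ j ih =>
    rw [pow_succ', Module.End.mul_apply]
    rcases lt_or_ge d (2 * j) with h | h
    · rw [ih h, map_zero]
    · exact lap_eq_zero (lap_pow_isHomogeneous hp h) (by omega)

lemma pderiv_normSqPoly (i : Fin 3) : pderiv i normSqPoly = C 2 * X i := by
  rw [normSqPoly, map_sum, Finset.sum_eq_single i]
  · rw [pderiv_pow, pderiv_X_self]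
    simp [map_ofNat (C : ℝ →+* Poly)]
  · intro j _ hj
    rw [pderiv_pow, pderiv_X_of_ne hj]
    simp
  · simp

/-- The product rule with `Δ|x|² = 6`; the cross term is `4 x · ∇p = 4 e p` by Euler's identity. -/
lemma lap_normSqPoly_mul {p : Poly} {e : ℕ} (hp : p.IsHomogeneous e) :
    lap (normSqPoly * p) = normSqPoly * lap p + (4 * (e : ℝ) + 6) • p := by
  have euler := hp.sum_X_mul_pderiv
  rw [lap_apply, lap_apply]
  have : ∀ i, pderiv i (pderiv i (normSqPoly * p)) =
      normSqPoly * pderiv i (pderiv i p) + C 2 * p + C 4 * (X i * pderiv i p) := by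
    intro i
    have h4 : (C 4 : Poly) = C 2 + C 2 := by rw [← C_add]; norm_num
    simp only [Derivation.leibniz, pderiv_normSqPoly, map_add, smul_eq_mul, pderiv_C,
      pderiv_X_self, mul_one, mul_zero, add_zero, h4]
    ring
  simp only [this, Finset.sum_add_distrib, ← Finset.mul_sum, euler]
  simp only [Finset.sum_const, Finset.card_univ, Fintype.card_fin, smul_eq_C_mul, nsmul_eq_mul,
    map_add, map_mul, map_natCast]
  have h6 : (C 6 : Poly) = 3 * C 2 := by
    have : (3 : Poly) = C 3 := (map_ofNat (C : ℝ →+* Poly) 3).symm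
    rw [this, ← C_mul]; norm_num
  rw [h6]
  push_cast
  ring

lemma lap_normSqPoly_pow_mul {p : Poly} {e : ℕ} (hp : p.IsHomogeneous e) (j : ℕ) :
    lap (normSqPoly ^ (j + 1) * p) = normSqPoly ^ (j + 1) * lap p +
      (2 * ((j : ℝ) + 1) * (2 * e + 2 * j + 3)) • (normSqPoly ^ j * p) := by
  induction j with
  | zero =>
    have := lap_normSqPoly_mul hp
    simp only [zero_add, pow_one, pow_zero, one_mul, this]
    congr 2
    push_cast
    ring
  | succ j ih =>
    have h := lap_normSqPoly_mul ((isHomogeneous_normSqPoly_pow (j + 1)).mul hp)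
    rw [pow_succ' _ (j + 1), mul_assoc, h, ih, mul_add, mul_smul_comm, add_assoc, ← mul_assoc,
      ← pow_succ', ← mul_assoc, ← pow_succ', ← add_smul]
    congr 2
    push_cast
    ring

/-- The operator `|x|² Δ`. -/
def radialLap : Module.End ℝ Poly := LinearMap.mulLeft ℝ normSqPoly ∘ₗ lap

lemma radialLap_apply (p : Poly) : radialLap p = normSqPoly * lap p := rfl

/-- The eigenvalues of `|x|² Δ` on homogeneous polynomials of degree `d`. -/
def radialEig (d n : ℕ) : ℝ := 2 * n * (2 * d - 2 * n + 1)

/-- The polynomial `∏_{i < j} (T - radialEig d i)`. -/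
def radialProd (d j : ℕ) : Polynomial ℝ :=
  ∏ i ∈ Finset.range j, (Polynomial.X - Polynomial.C (radialEig d i))

/-- Applying `|x|² Δ` to `|x|^{2j} Δ^j p` gives `|x|^{2j+2} Δ^{j+1} p` plus `radialEig d j` times
the same polynomial, so each further power contributes one linear factor. Since `Δ^j p = 0` once `2
j > d`, the product eventually annihilates `p`: this is how `|x|² Δ` is diagonalized without
harmonic decomposition. -/
lemma normSqPoly_pow_mul_lap_pow {p : Poly} {d : ℕ} (hp : p.IsHomogeneous d) (j : ℕ) :
    normSqPoly ^ j * (lap ^ j) p = Polynomial.aeval radialLap (radialProd d j) p := by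
  induction j with
  | zero => simp [radialProd]
  | succ j ih =>
    rw [radialProd, Finset.prod_range_succ, mul_comm (∏ _ ∈ _, _), map_mul, Module.End.mul_apply,
      ← radialProd, ← ih, map_sub, Polynomial.aeval_X, Polynomial.aeval_C, LinearMap.sub_apply,
      radialLap_apply, pow_succ' lap, Module.End.mul_apply, Module.algebraMap_end_apply]
    rcases Nat.eq_zero_or_pos j with rfl | hj
    · simp [radialEig]
    · obtain ⟨i, rfl⟩ : ∃ i, j = i + 1 := ⟨j - 1, by omega⟩
      rcases le_or_gt (2 * (i + 1)) d with h | h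
      · have h1 := lap_pow_isHomogeneous hp h
        rw [lap_normSqPoly_pow_mul h1, mul_add, ← mul_assoc, ← pow_succ', mul_smul_comm,
          ← mul_assoc, ← pow_succ', add_sub_assoc, ← sub_smul, Nat.cast_sub h]
        rw [left_eq_add, smul_eq_zero]
        left
        rw [radialEig]
        push_cast
        ring
      · rw [lap_pow_eq_zero hp h]
        simp

end Algebra

/-! ### The correlation operator and its triangular structure -/

section CorrelationOperator

/-- The weight `s^{2j} / ∏_{i < j} 2 (i + 1) (m + 2 i)` of the `j`-th power of the Laplacian in the
correlation operator. -/
def corrWeight (m s2 : ℝ) (j : ℕ) : ℝ :=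
  s2 ^ j / ∏ i ∈ Finset.range j, (2 * ((i : ℝ) + 1) * (m + 2 * i))

/-- The correlation operator on polynomials of degree at most `D`:
`p ↦ ∑ j, w_j (1 - |x|²)^j (Δ^j p)(t x)`. -/
def corrOp (m t : ℝ) (D : ℕ) : Module.End ℝ Poly :=
  ∑ j ∈ Finset.range (D + 1), corrWeight m (1 - t ^ 2) j •
    (LinearMap.mulLeft ℝ ((1 - normSqPoly) ^ j) ∘ₗ (dil t).toLinearMap ∘ₗ (lap ^ j))

lemma corrOp_apply (m t : ℝ) (D : ℕ) (p : Poly) :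
    corrOp m t D p = ∑ j ∈ Finset.range (D + 1), corrWeight m (1 - t ^ 2) j •
      ((1 - normSqPoly) ^ j * dil t ((lap ^ j) p)) := by
  simp [corrOp]

/-- The polynomial in `|x|² Δ` that gives the leading part of the correlation operator in
degree `d`. -/
def leadPoly (m t : ℝ) (D d : ℕ) : Polynomial ℝ :=
  ∑ j ∈ Finset.range (D + 1),
    Polynomial.C (corrWeight m (1 - t ^ 2) j * (-1) ^ j * t ^ (d - 2 * j)) * radialProd d j

lemma one_sub_normSqPoly_pow_mul (r : Poly) (j : ℕ) :
    (1 - normSqPoly) ^ j * r = ∑ i ∈ Finset.range (j + 1),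
      ((-1 : ℝ) ^ i * (j.choose i : ℝ)) • (normSqPoly ^ i * r) := by
  have : (1 - normSqPoly : Poly) = (-1 : ℝ) • normSqPoly + 1 := by
    rw [neg_one_smul]; ring
  rw [this, add_pow, Finset.sum_mul]
  refine Finset.sum_congr rfl fun i _ => ?_
  simp only [one_pow, mul_one, smul_eq_C_mul, map_mul, map_pow, map_neg, map_one,
    map_natCast]
  ring

lemma totalDegree_corrOp_le_of_isHomogeneous (m t : ℝ) (D : ℕ) {p : Poly} {d : ℕ}
    (hp : p.IsHomogeneous d) : (corrOp m t D p).totalDegree ≤ d := by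
  rw [corrOp_apply]
  refine totalDegree_finsetSum_le fun j _ => (totalDegree_smul_le _ _).trans ?_
  rcases le_or_gt (2 * j) d with h | h
  · have h1 := lap_pow_isHomogeneous hp h
    rw [dil_of_isHomogeneous h1, one_sub_normSqPoly_pow_mul]
    refine totalDegree_finsetSum_le fun i hi => (totalDegree_smul_le _ _).trans ?_
    rw [Finset.mem_range] at hi
    rw [mul_smul_comm]
    refine (totalDegree_smul_le _ _).trans
      (((isHomogeneous_normSqPoly_pow i).mul h1).totalDegree_le.trans ?_)
    omega
  · rw [lap_pow_eq_zero hp h]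
    simp

/-- Only the top term `(-1)^j |x|^{2j}` of `(1 - |x|²)^j` restores the degree lost to `Δ^j`. -/
lemma homogeneousComponent_corrOp_of_isHomogeneous (m t : ℝ) (D : ℕ) {p : Poly} {d : ℕ}
    (hp : p.IsHomogeneous d) :
    homogeneousComponent d (corrOp m t D p) =
      Polynomial.aeval radialLap (leadPoly m t D d) p := by
  rw [corrOp_apply, map_sum, leadPoly, map_sum, LinearMap.sum_apply]
  refine Finset.sum_congr rfl fun j _ => ?_
  rw [map_mul, Module.End.mul_apply, ← normSqPoly_pow_mul_lap_pow hp, Polynomial.aeval_C,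
    Module.algebraMap_end_apply, map_smul]
  rcases le_or_gt (2 * j) d with h | h
  · have h1 := lap_pow_isHomogeneous hp h
    rw [dil_of_isHomogeneous h1, one_sub_normSqPoly_pow_mul, map_sum, Finset.sum_range_succ,
      Finset.sum_eq_zero]
    · have hm : homogeneousComponent d (normSqPoly ^ j * (lap ^ j) p)
          = normSqPoly ^ j * (lap ^ j) p := by
        have := (isHomogeneous_normSqPoly_pow j).mul h1
        rw [show 2 * j + (d - 2 * j) = d by omega] at this
        exact homogeneousComponent_eq_self this
      simp only [mul_smul_comm, map_smul, hm, Nat.choose_self, Nat.cast_one, mul_one, zero_add,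
        smul_smul]
      ring_nf
    · intro i hi
      rw [Finset.mem_range] at hi
      have := (isHomogeneous_normSqPoly_pow i).mul h1
      rw [mul_smul_comm, map_smul, map_smul,
        homogeneousComponent_of_mem ((mem_homogeneousSubmodule _ _).mpr this), if_neg (by omega)]
      simp
  · rw [lap_pow_eq_zero hp h]
    simp

lemma sum_homogeneousComponent_of_le {p : Poly} {d : ℕ} (hp : p.totalDegree ≤ d) :
    ∑ i ∈ Finset.range (d + 1), homogeneousComponent i p = p := by
  conv_rhs => rw [← sum_homogeneousComponent p]
  refine (Finset.sum_subset (Finset.range_mono (by omega)) fun i _ hi => ?_).symm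
  exact homogeneousComponent_eq_zero _ _ (by simpa using hi)

lemma totalDegree_corrOp_le (m t : ℝ) (D : ℕ) {p : Poly} {d : ℕ} (hp : p.totalDegree ≤ d) :
    (corrOp m t D p).totalDegree ≤ d := by
  rw [← sum_homogeneousComponent_of_le hp, map_sum]
  refine totalDegree_finsetSum_le fun i hi => ?_
  have := totalDegree_corrOp_le_of_isHomogeneous m t D (homogeneousComponent_isHomogeneous i p)
  rw [Finset.mem_range] at hi
  omega

lemma homogeneousComponent_corrOp (m t : ℝ) (D : ℕ) {p : Poly} {d : ℕ} (hp : p.totalDegree ≤ d) :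
    homogeneousComponent d (corrOp m t D p) =
      Polynomial.aeval radialLap (leadPoly m t D d) (homogeneousComponent d p) := by
  conv_lhs => rw [← sum_homogeneousComponent_of_le hp, map_sum, map_sum, Finset.sum_range_succ]
  rw [homogeneousComponent_corrOp_of_isHomogeneous m t D (homogeneousComponent_isHomogeneous d p),
    Finset.sum_eq_zero, zero_add]
  intro i hi
  rw [Finset.mem_range] at hi
  have := totalDegree_corrOp_le_of_isHomogeneous m t D (homogeneousComponent_isHomogeneous i p)
  exact homogeneousComponent_eq_zero _ _ (by omega)

/-- The eigenvalue of the correlation operator attached to `|x|^{2n} Y_l`, `Y_l` a solid harmonic of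
degree `l`. -/
def corrEig (m t : ℝ) (n l : ℕ) : ℝ :=
  ∑ j ∈ Finset.range (n + 1), (-1) ^ j * t ^ (2 * (n - j) + l) * (1 - t ^ 2) ^ j * n.choose j *
    ∏ i ∈ Finset.range j, ((2 * (n : ℝ) + 2 * l + 1 - 2 * i) / (m + 2 * i))

lemma prod_sub_div_eq_choose {n j : ℕ} (hj : j ≤ n) :
    ∏ i ∈ Finset.range j, (((n : ℝ) - i) / (i + 1)) = n.choose j := by
  induction j with
  | zero => simp
  | succ j ih =>
    rw [Finset.prod_range_succ, ih (by omega)]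
    have h := Nat.choose_succ_right_eq n j
    have h' : (n.choose (j + 1) : ℝ) * (j + 1) = n.choose j * ((n : ℝ) - j) := by
      rw [← Nat.cast_sub (by omega)]
      exact_mod_cast h
    field_simp
    linarith

/-- With `d = 2n + l`, the difference `radialEig d n - radialEig d i` factors as `2 (n - i) (2n + 2l
+ 1 - 2i)`. The factors `n - i` build the binomial coefficient, and the one with `i = n` removes
every term with `j > n`. -/
lemma eval_leadPoly {m : ℝ} (hm : 0 < m) (t : ℝ) {D n l : ℕ} (hD : n ≤ D) :
    (leadPoly m t D (2 * n + l)).eval (radialEig (2 * n + l) n) = corrEig m t n l := by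
  rw [leadPoly, Polynomial.eval_finsetSum, corrEig]
  symm
  refine Finset.sum_subset_zero_on_sdiff (Finset.range_mono (by omega)) ?_ ?_
  · intro j hj
    simp only [Finset.mem_sdiff, Finset.mem_range, not_lt] at hj
    rw [Polynomial.eval_mul, radialProd, Polynomial.eval_prod,
      Finset.prod_eq_zero (Finset.mem_range.mpr (by omega : n < j)) (by simp), mul_zero]
  · intro j hj
    rw [Finset.mem_range] at hj
    rw [Polynomial.eval_mul, Polynomial.eval_C, radialProd, Polynomial.eval_prod, corrWeight,
      ← prod_sub_div_eq_choose (by omega : j ≤ n)]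
    have : 2 * n + l - 2 * j = 2 * (n - j) + l := by omega
    rw [this]
    have e : ∀ i ∈ Finset.range j, Polynomial.eval (radialEig (2 * n + l) n)
        (Polynomial.X - Polynomial.C (radialEig (2 * n + l) i)) =
        (2 * ((i : ℝ) + 1) * (m + 2 * i)) * (((n : ℝ) - i) / (i + 1) *
          ((2 * (n : ℝ) + 2 * l + 1 - 2 * i) / (m + 2 * i))) := by
      intro i _
      rw [Polynomial.eval_sub, Polynomial.eval_X, Polynomial.eval_C, radialEig, radialEig]
      field_simp
      push_cast
      ring
    rw [show ∏ i ∈ Finset.range j, Polynomial.eval (radialEig (2 * n + l) n)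
        (Polynomial.X - Polynomial.C (radialEig (2 * n + l) i)) =
        (∏ i ∈ Finset.range j, (2 * ((i : ℝ) + 1) * (m + 2 * i))) *
        ((∏ i ∈ Finset.range j, (((n : ℝ) - i) / (i + 1))) *
        ∏ i ∈ Finset.range j, ((2 * (n : ℝ) + 2 * l + 1 - 2 * i) / (m + 2 * i))) by
      rw [Finset.prod_congr rfl e, ← Finset.prod_mul_distrib, ← Finset.prod_mul_distrib]]
    have hne : ∏ i ∈ Finset.range j, (2 * ((i : ℝ) + 1) * (m + 2 * i)) ≠ 0 :=
      Finset.prod_ne_zero_iff.mpr fun i _ => by positivity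
    generalize (∏ i ∈ Finset.range j, (2 * ((i : ℝ) + 1) * (m + 2 * i))) = a at *
    generalize (∏ i ∈ Finset.range j, (((n : ℝ) - i) / (i + 1))) = b
    generalize (∏ i ∈ Finset.range j, ((2 * (n : ℝ) + 2 * l + 1 - 2 * i) / (m + 2 * i))) = c
    field_simp

/-- If a product of linear factors in `f` kills a nonzero vector of an invariant subspace, then one
of the factors has an eigenvector in that subspace. -/
lemma exists_eigenvector_of_aeval_prod {V : Type*} [AddCommGroup V] [Module ℝ V]
    (f : Module.End ℝ V) (W : Submodule ℝ V) (hW : ∀ x ∈ W, f x ∈ W) (c : ℕ → ℝ) (k : ℕ) :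
    ∀ p ∈ W, p ≠ 0 → Polynomial.aeval f
      (∏ i ∈ Finset.range k, (Polynomial.X - Polynomial.C (c i))) p = 0 →
      ∃ n < k, ∃ q ∈ W, q ≠ 0 ∧ f q = c n • q := by
  induction k with
  | zero =>
    intro p _ h0 h
    simp at h
    exact absurd h h0
  | succ k ih =>
    intro p hp h0 h
    rw [Finset.prod_range_succ, map_mul, Module.End.mul_apply] at h
    have e : Polynomial.aeval f (Polynomial.X - Polynomial.C (c k)) p = f p - c k • p := by
      simp
    by_cases hz : f p - c k • p = 0
    · exact ⟨k, by omega, p, hp, h0, sub_eq_zero.mp hz⟩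
    · rw [e] at h
      obtain ⟨n, hn, q, hq⟩ := ih _ (W.sub_mem (hW p hp) (W.smul_mem _ hp)) hz h
      exact ⟨n, by omega, q, hq⟩

lemma radialLap_isHomogeneous {p : Poly} {d : ℕ} (hp : p.IsHomogeneous d) :
    (radialLap p).IsHomogeneous d := by
  rw [radialLap_apply]
  rcases lt_or_ge d 2 with h | h
  · rw [lap_eq_zero hp h, mul_zero]
    exact isHomogeneous_zero _ _ _
  · obtain ⟨e, rfl⟩ : ∃ e, d = e + 2 := ⟨d - 2, by omega⟩
    have := isHomogeneous_normSqPoly.mul (lap_isHomogeneous hp)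
    rwa [add_comm] at this

lemma aeval_radialLap_of_eigenvector {q : Poly} {c : ℝ} (hq : radialLap q = c • q)
    (f : Polynomial ℝ) : Polynomial.aeval radialLap f q = f.eval c • q := by
  by_cases h0 : q = 0
  · simp [h0]
  · exact Module.End.aeval_apply_of_hasEigenvector ⟨Module.End.mem_eigenspace_iff.mpr hq, h0⟩

/-- The eigenvalues of the correlation operator. -/
lemma exists_corrEig_of_eigenvector {m : ℝ} (hm : 0 < m) (t : ℝ) {D : ℕ} {p : Poly} {κ : ℝ} (h0 : p ≠ 0)
    (hD : p.totalDegree ≤ D) (hp : corrOp m t D p = κ • p) :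
    ∃ n l, 2 * n + l = p.totalDegree ∧ κ = corrEig m t n l ∧ ∃ q : Poly, q ≠ 0 ∧
      q.IsHomogeneous (2 * n + l) ∧ radialLap q = radialEig (2 * n + l) n • q := by
  obtain ⟨d, hd⟩ : ∃ d, d = p.totalDegree := ⟨_, rfl⟩
  rw [← hd] at hD ⊢
  have hlead := homogeneousComponent_corrOp m t D hd.ge
  rw [hp, map_smul] at hlead
  have htop : homogeneousComponent d p ≠ 0 := by
    intro h
    by_cases hd0 : d = 0
    · subst hd0
      have := sum_homogeneousComponent_of_le hd.ge
      rw [Finset.sum_range_one, h] at this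
      exact h0 this.symm
    · have h1 := sum_homogeneousComponent_of_le hd.ge
      rw [Finset.sum_range_succ, h, add_zero] at h1
      have h2 : p.totalDegree ≤ d - 1 := by
        rw [← h1]
        refine totalDegree_finsetSum_le fun i hi => ?_
        rw [Finset.mem_range] at hi
        have := (homogeneousComponent_isHomogeneous i p).totalDegree_le
        omega
      omega
  -- The top component of `p` is an eigenvector of the leading operator. As `|x|² Δ` commutes with
  -- that operator it acts on this eigenspace, where a product of linear factors kills the top
  -- component; so it has an eigenvector there, on which the leading operator can be evaluated.
  let W : Submodule ℝ Poly := homogeneousSubmodule (Fin 3) ℝ d ⊓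
    LinearMap.ker (Polynomial.aeval radialLap (leadPoly m t D d) - κ • LinearMap.id)
  have hWmem : ∀ x, x ∈ W ↔ x.IsHomogeneous d ∧
      Polynomial.aeval radialLap (leadPoly m t D d) x = κ • x := by
    intro x
    simp [W, sub_eq_zero]
  have hW : ∀ x ∈ W, radialLap x ∈ W := by
    intro x hx
    rw [hWmem] at hx ⊢
    refine ⟨radialLap_isHomogeneous hx.1, ?_⟩
    have hcomm : Polynomial.aeval radialLap (leadPoly m t D d) (radialLap x) =
        radialLap (Polynomial.aeval radialLap (leadPoly m t D d) x) := by
      have h3 := congrArg (fun f => Polynomial.aeval radialLap f x)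
        (mul_comm (leadPoly m t D d) Polynomial.X)
      simpa using h3
    rw [hcomm, hx.2, map_smul]
  have hmem : homogeneousComponent d p ∈ W :=
    (hWmem _).mpr ⟨homogeneousComponent_isHomogeneous d p, hlead.symm⟩
  have hkill : Polynomial.aeval radialLap (∏ i ∈ Finset.range (d / 2 + 1),
      (Polynomial.X - Polynomial.C (radialEig d i))) (homogeneousComponent d p) = 0 := by
    have := normSqPoly_pow_mul_lap_pow (homogeneousComponent_isHomogeneous d p) (d / 2 + 1)
    rw [radialProd] at this
    rw [← this, lap_pow_eq_zero (homogeneousComponent_isHomogeneous d p) (by omega), mul_zero]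
  obtain ⟨n, hn, q, hq, hq0, hqe⟩ := exists_eigenvector_of_aeval_prod radialLap W hW _ _ _ hmem htop
    hkill
  have hq' := (hWmem q).mp hq
  obtain ⟨l, rfl⟩ : ∃ l, d = 2 * n + l := ⟨d - 2 * n, by omega⟩
  refine ⟨n, l, rfl, ?_, q, hq0, hq'.1, hqe⟩
  have h1 := hq'.2
  rw [aeval_radialLap_of_eigenvector hqe, eval_leadPoly hm t (by omega)] at h1
  exact (smul_left_injective ℝ hq0 h1).symm

end CorrelationOperator

/-! ### Moments on the sphere and conditional expectation between two orthonormal triples -/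

section SphereMoments

variable {E : Type*} [NormedAddCommGroup E] [InnerProductSpace ℝ E]

/-- The components of a vector along a family of three vectors. -/
def coords (α : Fin 3 → E) (x : E) : Fin 3 → ℝ := fun i => inner ℝ (α i) x

/-- A polynomial in the components along `α`, as a function on `E`. -/
def polyFun (α : Fin 3 → E) (p : Poly) (x : E) : ℝ := eval (coords α x) p

@[simp] lemma polyFun_add (α : Fin 3 → E) (p q : Poly) (x : E) :
    polyFun α (p + q) x = polyFun α p x + polyFun α q x := by simp [polyFun]

@[simp] lemma polyFun_mul (α : Fin 3 → E) (p q : Poly) (x : E) :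
    polyFun α (p * q) x = polyFun α p x * polyFun α q x := by simp [polyFun]

@[simp] lemma polyFun_pow (α : Fin 3 → E) (p : Poly) (k : ℕ) (x : E) :
    polyFun α (p ^ k) x = polyFun α p x ^ k := by simp [polyFun]

@[simp] lemma polyFun_smul (α : Fin 3 → E) (c : ℝ) (p : Poly) (x : E) :
    polyFun α (c • p) x = c * polyFun α p x := by simp [polyFun]

@[simp] lemma polyFun_C (α : Fin 3 → E) (c : ℝ) (x : E) : polyFun α (C c) x = c := by
  simp [polyFun]

@[simp] lemma polyFun_one (α : Fin 3 → E) (x : E) : polyFun α 1 x = 1 := by simp [polyFun]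

@[simp] lemma polyFun_X (α : Fin 3 → E) (i : Fin 3) (x : E) :
    polyFun α (X i) x = inner ℝ (α i) x := by simp [polyFun, coords]

@[simp] lemma polyFun_sum {ι : Type*} (s : Finset ι) (α : Fin 3 → E) (p : ι → Poly) (x : E) :
    polyFun α (∑ i ∈ s, p i) x = ∑ i ∈ s, polyFun α (p i) x := by simp [polyFun]

@[fun_prop] lemma continuous_polyFun (α : Fin 3 → E) (p : Poly) : Continuous (polyFun α p) := by
  refine (continuous_eval p).comp (continuous_pi fun i => ?_)
  unfold coords
  fun_prop

lemma polyFun_smul_arg (α : Fin 3 → E) {p : Poly} {d : ℕ} (hp : p.IsHomogeneous d) (r : ℝ) (x : E) :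
    polyFun α p (r • x) = r ^ d * polyFun α p x := by
  have h := eval_dil r (coords α x) p
  rw [dil_of_isHomogeneous hp, smul_eval] at h
  have hc : coords α (r • x) = fun i => r * coords α x i := by
    ext i
    simp [coords, inner_smul_right]
  rw [polyFun, polyFun, h, hc]

lemma hasDerivAt_polyFun (α : Fin 3 → E) (p : Poly) (x u : E) :
    HasDerivAt (fun s : ℝ => polyFun α p (x + s • u))
      (∑ i, inner ℝ (α i) u * polyFun α (pderiv i p) x) 0 := by
  induction p using MvPolynomial.induction_on with
  | C a => simpa [polyFun] using hasDerivAt_const (0 : ℝ) a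
  | add p q hp hq =>
    simp only [polyFun_add, map_add, mul_add, Finset.sum_add_distrib]
    exact hp.add hq
  | mul_X p j hp =>
    have hX : HasDerivAt (fun s : ℝ => polyFun α (X j) (x + s • u)) (inner ℝ (α j) u) 0 := by
      simp only [polyFun_X, inner_add_right, inner_smul_right]
      simpa using (((hasDerivAt_id (0 : ℝ)).mul_const (inner ℝ (α j) u)).const_add
        (inner ℝ (α j) x))
    have := hp.mul hX
    simp only [polyFun_mul]
    refine this.congr_deriv ?_
    simp only [Derivation.leibniz, polyFun_add, smul_eq_mul, polyFun_mul, zero_smul, add_zero]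
    have e : ∀ i, polyFun α (pderiv i (X j)) x = if i = j then 1 else 0 := by
      intro i
      split_ifs with h
      · subst h; simp
      · rw [pderiv_X_of_ne (Ne.symm h)]; simp [polyFun]
    simp only [e, mul_add, Finset.sum_add_distrib]
    simp [Finset.sum_mul]
    rw [add_comm]
    congr 1
    · ring
    · exact Finset.sum_congr rfl fun i _ => by ring

variable [FiniteDimensional ℝ E] [MeasurableSpace E] [BorelSpace E]
  (μ : Measure E) [μ.IsAddHaarMeasure]

/-- The integral over the unit sphere. -/
def sphereInt (f : E → ℝ) : ℝ := ∫ ω : sphere (0 : E) 1, f ω ∂μ.toSphere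

variable {μ}

lemma sphereInt_congr {f g : E → ℝ} (h : ∀ x, ‖x‖ = 1 → f x = g x) :
    sphereInt μ f = sphereInt μ g :=
  integral_congr_ae (Filter.Eventually.of_forall fun ω => h ω (mem_sphere_zero_iff_norm.mp ω.2))

lemma integrable_sphere {f : E → ℝ} (hf : Continuous f) :
    Integrable (fun ω : sphere (0 : E) 1 => f ω) μ.toSphere :=
  (hf.comp continuous_subtype_val).integrable_of_hasCompactSupport (HasCompactSupport.of_compactSpace _)

lemma sphereInt_add {f g : E → ℝ} (hf : Continuous f) (hg : Continuous g) :
    sphereInt μ (fun x => f x + g x) = sphereInt μ f + sphereInt μ g :=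
  integral_add (integrable_sphere hf) (integrable_sphere hg)

lemma sphereInt_sub {f g : E → ℝ} (hf : Continuous f) (hg : Continuous g) :
    sphereInt μ (fun x => f x - g x) = sphereInt μ f - sphereInt μ g :=
  integral_sub (integrable_sphere hf) (integrable_sphere hg)

lemma sphereInt_const_mul (c : ℝ) (f : E → ℝ) :
    sphereInt μ (fun x => c * f x) = c * sphereInt μ f :=
  integral_const_mul _ _

lemma sphereInt_sum {ι : Type*} (s : Finset ι) {f : ι → E → ℝ} (hf : ∀ i ∈ s, Continuous (f i)) :
    sphereInt μ (fun x => ∑ i ∈ s, f i x) = ∑ i ∈ s, sphereInt μ (f i) :=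
  integral_finsetSum _ fun i hi => integrable_sphere (hf i hi)

variable (μ)

/-- The moment functional of a family of three vectors. -/
def moment (α : Fin 3 → E) : Poly →ₗ[ℝ] ℝ where
  toFun p := sphereInt μ (polyFun α p)
  map_add' p q := by
    simp only [← sphereInt_add (μ := μ) (continuous_polyFun α p) (continuous_polyFun α q)]
    congr 1
    ext x
    simp
  map_smul' c p := by
    simp only [← sphereInt_const_mul, RingHom.id_apply, smul_eq_mul]
    congr 1
    ext x
    simp

lemma moment_apply (α : Fin 3 → E) (p : Poly) : moment μ α p = sphereInt μ (polyFun α p) := rfl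

variable [Nontrivial E] {α : Fin 3 → E}

lemma sphereInt_stein {P P' : E → ℝ} {k : ℕ} (u : E)
    (hP : Continuous P) (hP' : Continuous P')
    (hd : ∀ x, HasDerivAt (fun s : ℝ => P (x + s • u)) (P' x) 0)
    (hPh : ∀ (r : ℝ) (x : E), P (r • x) = r ^ (k + 1) * P x)
    (hPh' : ∀ (r : ℝ) (x : E), P' (r • x) = r ^ k * P' x) :
    ((finrank ℝ E : ℝ) + k) * sphereInt μ (fun x => inner ℝ u x * P x) = sphereInt μ P' :=
  sphere_stein μ u hP hP' hd hPh hPh'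

/-- `g` is constant in the direction `u`, so integration by parts along `u` differentiates only the
power of `⟨u, x⟩`. -/
lemma stein_inner_pow {u : E} (hu : ∀ i, inner ℝ (α i) u = 0) {g : Poly} {a : ℕ}
    (hg : g.IsHomogeneous a) (j : ℕ) :
    ((finrank ℝ E : ℝ) + a + j) * sphereInt μ (fun x => polyFun α g x * inner ℝ u x ^ (j + 2)) =
      ((j : ℝ) + 1) * ‖u‖ ^ 2 * sphereInt μ (fun x => polyFun α g x * inner ℝ u x ^ j) := by
  have h := sphereInt_stein μ (P := fun x => polyFun α g x * inner ℝ u x ^ (j + 1))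
    (P' := fun x => ((j : ℝ) + 1) * ‖u‖ ^ 2 * (polyFun α g x * inner ℝ u x ^ j)) (k := a + j) u
    (by fun_prop) (by fun_prop) ?_ ?_ ?_
  · rw [Nat.cast_add, ← add_assoc] at h
    rw [← sphereInt_const_mul ((_ : ℝ) * _) (fun x => polyFun α g x * inner ℝ u x ^ j), ← h]
    congr 2
    ext ω
    ring
  · intro x
    have h1 := hasDerivAt_polyFun α g x u
    simp only [hu, zero_mul, Finset.sum_const_zero] at h1
    have h2 : HasDerivAt (fun s : ℝ => inner ℝ u (x + s • u)) (‖u‖ ^ 2) 0 := by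
      simp only [inner_add_right, inner_smul_right, real_inner_self_eq_norm_sq]
      simpa using ((hasDerivAt_id (0 : ℝ)).mul_const (‖u‖ ^ 2)).const_add (inner ℝ u x)
    have h3 := h1.mul (h2.pow (j + 1))
    refine h3.congr_deriv ?_
    simp
    ring
  · intro r x
    rw [polyFun_smul_arg α hg, inner_smul_right]
    ring
  · intro r x
    rw [polyFun_smul_arg α hg, inner_smul_right]
    ring

/-- Integrate `g ‖x‖²` by parts along `u`. On the sphere `‖x‖² = 1`, so the same integral stands on
both sides, with the different factors `dim + a + 1` and `2`. -/
lemma sphereInt_mul_inner_eq_zero (hE : 2 ≤ finrank ℝ E) {u : E} (hu : ∀ i, inner ℝ (α i) u = 0)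
    {g : Poly} {a : ℕ} (hg : g.IsHomogeneous a) :
    sphereInt μ (fun x => polyFun α g x * inner ℝ u x) = 0 := by
  have h := sphereInt_stein μ (P := fun x => polyFun α g x * ‖x‖ ^ 2)
    (P' := fun x => 2 * (polyFun α g x * inner ℝ u x)) (k := a + 1) u
    (by fun_prop) (by fun_prop) ?_ ?_ ?_
  · have h1 : sphereInt μ (fun x => inner ℝ u x * (polyFun α g x * ‖x‖ ^ 2)) =
        sphereInt μ (fun x => polyFun α g x * inner ℝ u x) :=
      sphereInt_congr fun x hx => by rw [hx]; ring
    have h2 := sphereInt_const_mul (μ := μ) 2 (fun x => polyFun α g x * inner ℝ u x)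
    rw [h1, h2] at h
    have h3 : (2 : ℝ) ≤ finrank ℝ E := by exact_mod_cast hE
    have h4 : (0 : ℝ) ≤ a := Nat.cast_nonneg a
    push_cast at h
    have : ((finrank ℝ E : ℝ) + a - 1) *
        sphereInt μ (fun x => polyFun α g x * inner ℝ u x) = 0 := by linarith
    rcases mul_eq_zero.mp this with h5 | h5
    · linarith
    · exact h5
  · intro x
    have h1 := hasDerivAt_polyFun α g x u
    simp only [hu, zero_mul, Finset.sum_const_zero] at h1
    have h2 : HasDerivAt (fun s : ℝ => ‖x + s • u‖ ^ 2) (2 * inner ℝ x u) 0 := by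
      have := ((hasStrictFDerivAt_norm_sq x).hasFDerivAt.hasLineDerivAt u)
      simpa [HasLineDerivAt] using this
    refine (h1.mul h2).congr_deriv ?_
    simp [real_inner_comm]
    ring
  · intro r x
    rw [polyFun_smul_arg α hg, norm_smul, mul_pow, Real.norm_eq_abs, sq_abs]
    ring
  · intro r x
    rw [polyFun_smul_arg α hg, inner_smul_right]
    ring

lemma polyFun_normSqPoly (α : Fin 3 → E) (x : E) :
    polyFun α normSqPoly x = ∑ i, inner ℝ (α i) x ^ 2 := by
  simp [normSqPoly]

/-- Replace `1 - |x|²` by its homogeneous form `Q = ‖x‖² - ∑ ⟨α i, x⟩²`, which is constant along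
each `α i`. Integrate `X i * g * Q ^ j` by parts along `α i` and sum over `i`: the squares add up to
`1 - Q` on the sphere, Euler's identity gives the factor `a`, and the three directions give the `3`.
-/
lemma moment_one_sub_normSq_pow (hα : Orthonormal ℝ α) {g : Poly} {a : ℕ}
    (hg : g.IsHomogeneous a) (j : ℕ) :
    ((finrank ℝ E : ℝ) + a + 2 * j) * moment μ α (g * (1 - normSqPoly) ^ (j + 1)) =
      ((finrank ℝ E : ℝ) - 3 + 2 * j) * moment μ α (g * (1 - normSqPoly) ^ j) := by
  classical
  set Q : E → ℝ := fun x => ‖x‖ ^ 2 - polyFun α normSqPoly x with hQ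
  have hQc : Continuous Q := by fun_prop
  have hQ1 : ∀ x, ‖x‖ = 1 → Q x = polyFun α (1 - normSqPoly) x := by
    intro x hx
    simp only [hQ, sub_eq_add_neg, polyFun_add, polyFun_one, hx]
    rw [← neg_one_smul ℝ normSqPoly, polyFun_smul]
    ring
  have hQh : ∀ (r : ℝ) (x : E), Q (r • x) = r ^ 2 * Q x := by
    intro r x
    simp only [hQ]
    rw [polyFun_smul_arg α isHomogeneous_normSqPoly, norm_smul, mul_pow, Real.norm_eq_abs, sq_abs]
    ring
  have hQd : ∀ (i : Fin 3) (x : E), HasDerivAt (fun s : ℝ => Q (x + s • α i)) 0 0 := by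
    intro i x
    have h2 : HasDerivAt (fun s : ℝ => ‖x + s • α i‖ ^ 2) (2 * inner ℝ x (α i)) 0 := by
      have := ((hasStrictFDerivAt_norm_sq x).hasFDerivAt.hasLineDerivAt (α i))
      simpa [HasLineDerivAt] using this
    refine (h2.sub (hasDerivAt_polyFun α normSqPoly x (α i))).congr_deriv ?_
    simp [pderiv_normSqPoly, orthonormal_iff_ite.mp hα, real_inner_comm]
  have stein : ∀ i : Fin 3, ((finrank ℝ E : ℝ) + a + 2 * j) *
      sphereInt μ (fun x => polyFun α (X i ^ 2 * g) x * Q x ^ j) =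
      sphereInt μ (fun x => polyFun α g x * Q x ^ j) +
        sphereInt μ (fun x => polyFun α (X i * pderiv i g) x * Q x ^ j) := by
    intro i
    have h := sphereInt_stein μ (P := fun x => polyFun α (X i * g) x * Q x ^ j)
      (P' := fun x => polyFun α g x * Q x ^ j + polyFun α (X i * pderiv i g) x * Q x ^ j)
      (k := a + 2 * j) (α i) (by fun_prop) (by fun_prop) ?_ ?_ ?_
    · rw [sphereInt_add (by fun_prop) (by fun_prop)] at h
      rw [← h]
      push_cast
      rw [← add_assoc]
      congr 2
      ext x
      simp
      ring
    · intro x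
      have h1 := hasDerivAt_polyFun α (X i * g) x (α i)
      refine (h1.mul ((hQd i x).pow j)).congr_deriv ?_
      simp [orthonormal_iff_ite.mp hα]
      ring
    · intro r x
      rw [polyFun_smul_arg α ((isHomogeneous_X ℝ i).mul hg), hQh]
      ring_nf
    · intro r x
      have hx : (X i * pderiv i g).IsHomogeneous a := by
        rcases Nat.eq_zero_or_pos a with rfl | ha
        · rw [totalDegree_eq_zero_iff_eq_C.mp
            ((totalDegree_zero_iff_isHomogeneous (p := g)).mpr hg), pderiv_C, mul_zero]
          exact isHomogeneous_zero _ _ _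
        · have := (isHomogeneous_X ℝ i).mul (hg.pderiv (i := i))
          rwa [show 1 + (a - 1) = a by omega] at this
      rw [polyFun_smul_arg α hg, polyFun_smul_arg α hx, hQh]
      ring_nf
  have hsum := Finset.sum_congr (rfl : (Finset.univ : Finset (Fin 3)) = Finset.univ)
    fun i _ => stein i
  rw [← Finset.mul_sum, Finset.sum_add_distrib, Finset.sum_const,
    ← sphereInt_sum _ (fun i _ => by fun_prop), ← sphereInt_sum _ (fun i _ => by fun_prop)] at hsum
  have e0 : ∀ k, sphereInt μ (fun x => polyFun α g x * Q x ^ k) =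
      moment μ α (g * (1 - normSqPoly) ^ k) := by
    intro k
    rw [moment_apply]
    exact sphereInt_congr fun x hx => by rw [hQ1 x hx]; simp
  have e1 : sphereInt μ (fun x => ∑ i, polyFun α (X i * pderiv i g) x * Q x ^ j) =
      a * moment μ α (g * (1 - normSqPoly) ^ j) := by
    rw [← e0, ← sphereInt_const_mul]
    congr 1
    ext x
    have := congrArg (fun p => polyFun α p x) hg.sum_X_mul_pderiv
    simp only [polyFun_sum] at this
    rw [← Finset.sum_mul, this, ← Nat.cast_smul_eq_nsmul ℝ, polyFun_smul]
    ring
  have e2 : sphereInt μ (fun x => ∑ i, polyFun α (X i ^ 2 * g) x * Q x ^ j) =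
      moment μ α (g * (1 - normSqPoly) ^ j) - moment μ α (g * (1 - normSqPoly) ^ (j + 1)) := by
    rw [← e0, ← e0, ← sphereInt_sub (by fun_prop) (by fun_prop)]
    refine sphereInt_congr fun x hx => ?_
    simp only [hQ, hx, polyFun_normSqPoly]
    simp only [polyFun_mul, polyFun_pow, polyFun_X, ← Finset.sum_mul]
    ring
  rw [e1, e2, e0] at hsum
  simp only [Finset.card_univ, Fintype.card_fin, nsmul_eq_mul] at hsum
  push_cast at hsum
  linarith

/-- The even moments of a component orthogonal to `α`, relative to those of the squared distance to
the span of `α`. -/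
lemma sphereInt_inner_pow (hα : Orthonormal ℝ α) (hE : 3 < finrank ℝ E) {u : E}
    (hu : ∀ i, inner ℝ (α i) u = 0) {g : Poly} {a : ℕ} (hg : g.IsHomogeneous a) (j : ℕ) :
    sphereInt μ (fun x => polyFun α g x * inner ℝ u x ^ (2 * j)) =
      ‖u‖ ^ (2 * j) * (∏ i ∈ Finset.range j, ((2 * (i : ℝ) + 1) / ((finrank ℝ E : ℝ) - 3 + 2 * i))) *
        moment μ α (g * (1 - normSqPoly) ^ j) := by
  have hE' : (3 : ℝ) < finrank ℝ E := by exact_mod_cast hE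
  induction j with
  | zero => simp [moment_apply]
  | succ j ih =>
    have h1 := stein_inner_pow μ hu hg (2 * j)
    have h2 := moment_one_sub_normSq_pow μ hα hg j
    rw [ih] at h1
    rw [Finset.prod_range_succ]
    have hj : (0 : ℝ) ≤ j := Nat.cast_nonneg j
    have ha : (0 : ℝ) ≤ a := Nat.cast_nonneg a
    have hc : (finrank ℝ E : ℝ) + a + 2 * j ≠ 0 := by positivity
    have hm : (finrank ℝ E : ℝ) - 3 + 2 * j ≠ 0 := by
      have : 0 < (finrank ℝ E : ℝ) - 3 + 2 * j := by linarith
      exact this.ne'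
    -- The recursions for `⟨u, x⟩` and for `1 - |x|²` carry the same factor `dim + a + 2j`.
    -- Cancelling it leaves ratios that do not depend on the degree of `g`.
    apply mul_left_cancel₀ hc
    push_cast at h1
    rw [show 2 * (j + 1) = 2 * j + 2 by ring, h1]
    calc _ = (2 * (j : ℝ) + 1) * ‖u‖ ^ (2 * j + 2) * (∏ i ∈ Finset.range j,
          ((2 * (i : ℝ) + 1) / ((finrank ℝ E : ℝ) - 3 + 2 * i))) *
          (((finrank ℝ E : ℝ) - 3 + 2 * j) * moment μ α (g * (1 - normSqPoly) ^ j)) /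
            ((finrank ℝ E : ℝ) - 3 + 2 * j) := by field_simp; ring
      _ = _ := by
        rw [← h2]
        field_simp

lemma lap_linForm_pow (A : Fin 3 → ℝ) (d : ℕ) :
    lap (linForm A ^ d) = ((d : ℝ) * (d - 1) * ∑ i, A i ^ 2) • linForm A ^ (d - 2) := by
  have h1 : ∀ i, pderiv i (linForm A) = C (A i) := by
    intro i
    rw [linForm, map_sum, Finset.sum_eq_single i]
    · simp [Derivation.leibniz]
    · intro j _ hj
      simp [Derivation.leibniz, pderiv_X_of_ne hj]
    · simp
  have h2 : ∀ i, pderiv i (pderiv i (linForm A ^ d)) =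
      ((d : ℝ) * (d - 1) * A i ^ 2) • linForm A ^ (d - 2) := by
    intro i
    rcases d with _ | _ | d
    · simp
    · simp [h1]
    · simp only [pderiv_pow, h1, Derivation.leibniz, pderiv_C, smul_eq_mul, Nat.cast_add,
        Nat.cast_one, map_add, Derivation.map_natCast, Derivation.map_one_eq_zero]
      simp only [smul_eq_C_mul, map_mul, map_add, map_sub, map_pow, map_natCast, map_one]
      rw [show d + 1 + 1 - 1 - 1 = d by omega, show d + 1 + 1 - 2 = d by omega]
      push_cast
      ring
  rw [lap_apply, Finset.sum_congr rfl fun i _ => h2 i, ← Finset.sum_smul, Finset.mul_sum]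

/-- The coefficient is `d! / (d - 2j)!`, written as a binomial coefficient times `(2j)!` so as to
match the binomial expansion in `sphereInt_mul_linForm_pow`. -/
lemma lap_pow_linForm_pow (A : Fin 3 → ℝ) (d j : ℕ) :
    (lap ^ j) (linForm A ^ d) =
      ((d.choose (2 * j) : ℝ) * (∏ i ∈ Finset.range j, (2 * ((i : ℝ) + 1) * (2 * i + 1))) *
        (∑ i, A i ^ 2) ^ j) • linForm A ^ (d - 2 * j) := by
  induction j with
  | zero => simp
  | succ j ih =>
    rw [pow_succ', Module.End.mul_apply, ih, map_smul, lap_linForm_pow, smul_smul,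
      Finset.prod_range_succ, show d - 2 * (j + 1) = d - 2 * j - 2 by omega]
    congr 1
    have e1 := Nat.choose_succ_right_eq d (2 * j)
    have e2 := Nat.choose_succ_right_eq d (2 * j + 1)
    have key : (d.choose (2 * j) : ℝ) * (((d - 2 * j : ℕ) : ℝ) * (((d - 2 * j : ℕ) : ℝ) - 1)) =
        d.choose (2 * (j + 1)) * (2 * ((j : ℝ) + 1) * (2 * j + 1)) := by
      have e1' : (d.choose (2 * j + 1) : ℝ) * (2 * j + 1) = d.choose (2 * j) * (d - 2 * j : ℕ) := by
        exact_mod_cast e1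
      have e2' : (d.choose (2 * j + 2) : ℝ) * (2 * j + 2) =
          d.choose (2 * j + 1) * (d - (2 * j + 1) : ℕ) := by exact_mod_cast e2
      rw [show 2 * (j + 1) = 2 * j + 2 by ring]
      rcases le_or_gt (2 * j + 1) d with h | h
      · have e3 : ((d - (2 * j + 1) : ℕ) : ℝ) = ((d - 2 * j : ℕ) : ℝ) - 1 := by
          rw [Nat.cast_sub h, Nat.cast_sub (by omega)]; push_cast; ring
        rw [e3] at e2'
        linear_combination -(((d - 2 * j : ℕ) : ℝ) - 1) * e1' - (2 * (j : ℝ) + 1) * e2'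
      · rw [Nat.choose_eq_zero_of_lt (by omega : d < 2 * j + 2),
          show d - 2 * j = 0 by omega]
        simp
    rw [pow_succ]
    linear_combination (∏ i ∈ Finset.range j, (2 * ((i : ℝ) + 1) * (2 * i + 1))) *
      (∑ i, A i ^ 2) ^ j * (∑ i, A i ^ 2) * key

lemma sum_range_even_odd (f : ℕ → ℝ) (hf : ∀ j, f (2 * j + 1) = 0) (n : ℕ) :
    ∑ k ∈ Finset.range (2 * n), f k = ∑ j ∈ Finset.range n, f (2 * j) := by
  induction n with
  | zero => simp
  | succ n ih =>
    rw [show 2 * (n + 1) = 2 * n + 1 + 1 by ring, Finset.sum_range_succ, Finset.sum_range_succ, ih,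
      hf, add_zero, Finset.sum_range_succ]

lemma sphereInt_inner_pow_odd (hE : 3 < finrank ℝ E) {u : E}
    (hu : ∀ i, inner ℝ (α i) u = 0) {g : Poly} {a : ℕ} (hg : g.IsHomogeneous a) (j : ℕ) :
    sphereInt μ (fun x => polyFun α g x * inner ℝ u x ^ (2 * j + 1)) = 0 := by
  induction j with
  | zero => simpa using sphereInt_mul_inner_eq_zero μ (by omega) hu hg
  | succ j ih =>
    have h1 := stein_inner_pow μ hu hg (2 * j + 1)
    rw [ih, mul_zero] at h1
    have hE' : (0 : ℝ) < finrank ℝ E := by exact_mod_cast (by omega : 0 < finrank ℝ E)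
    have hc : (finrank ℝ E : ℝ) + a + (2 * j + 1 : ℕ) ≠ 0 := by positivity
    exact (mul_eq_zero.mp h1).resolve_left hc

/-- The linear form along `β` is `t` times the one along `α` plus `⟨u, x⟩`, with `u` orthogonal to
`α` and `‖u‖² = (1 - t²) |A|²`. Expand the `d`-th power: odd powers of `⟨u, x⟩` integrate to zero,
and even ones become powers of `1 - |x|²`. The weights `corrWeight` are what remains after the
factors `2 (i + 1) (2 i + 1)` from the iterated Laplacian are divided out. -/
lemma sphereInt_mul_linForm_pow {β : Fin 3 → E} {t : ℝ} (hα : Orthonormal ℝ α)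
    (hβ : Orthonormal ℝ β) (hαβ : ∀ i j, inner ℝ (α i) (β j) = if i = j then t else 0)
    (hE : 3 < finrank ℝ E) {g : Poly} {a : ℕ} (hg : g.IsHomogeneous a) (A : Fin 3 → ℝ) {d D : ℕ}
    (hd : d ≤ D) :
    sphereInt μ (fun x => polyFun α g x * polyFun β (linForm A ^ d) x) =
      moment μ α (g * corrOp ((finrank ℝ E : ℝ) - 3) t D (linForm A ^ d)) := by
  have hα' := orthonormal_iff_ite.mp hα
  have hβ' := orthonormal_iff_ite.mp hβ
  have hαβ' : ∀ i j, inner ℝ (β i) (α j) = if i = j then t else 0 := by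
    intro i j
    rw [real_inner_comm, hαβ]
    simp [eq_comm]
  set u : E := ∑ i, A i • (β i - t • α i) with hu
  have hu0 : ∀ i, inner ℝ (α i) u = 0 := by
    intro i
    simp [hu, inner_sum, inner_smul_right, inner_sub_right, hαβ, hα']
  have hun : ‖u‖ ^ 2 = (1 - t ^ 2) * ∑ i, A i ^ 2 := by
    rw [← real_inner_self_eq_norm_sq]
    simp only [hu, inner_sum, sum_inner, inner_smul_left, inner_smul_right, inner_sub_right,
      inner_sub_left, hαβ, hα', hβ', hαβ']
    simp only [Finset.mul_sum]
    refine Finset.sum_congr rfl fun i _ => ?_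
    rw [Finset.sum_eq_single i]
    · simp
      ring
    · intro j _ hj
      simp [hj]
    · simp
  have hpt : ∀ x, polyFun β (linForm A) x = t * polyFun α (linForm A) x + inner ℝ u x := by
    intro x
    simp only [linForm, polyFun_sum, polyFun_mul, polyFun_C, polyFun_X, hu, sum_inner,
      inner_smul_left, inner_sub_left, Finset.mul_sum, ← Finset.sum_add_distrib]
    refine Finset.sum_congr rfl fun i _ => ?_
    simp
    ring
  have hl : ∀ k, (g * linForm A ^ k).IsHomogeneous (a + k) := by
    intro k
    have := hg.mul ((isHomogeneous_linForm A).pow k)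
    rwa [one_mul] at this
  set f : ℕ → ℝ := fun k => (d.choose k : ℝ) * t ^ (d - k) *
    sphereInt μ (fun x => polyFun α (g * linForm A ^ (d - k)) x * inner ℝ u x ^ k) with hf
  have hodd : ∀ j, f (2 * j + 1) = 0 := by
    intro j
    simp only [hf]
    rw [sphereInt_inner_pow_odd μ hE hu0 (hl _), mul_zero]
  have h1 : sphereInt μ (fun x => polyFun α g x * polyFun β (linForm A ^ d) x) =
      ∑ k ∈ Finset.range (d + 1), f k := by
    simp only [hf, ← sphereInt_const_mul]
    rw [← sphereInt_sum _ (fun k _ => by fun_prop)]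
    congr 1
    ext x
    rw [polyFun_pow, hpt, add_comm, add_pow, Finset.mul_sum]
    refine Finset.sum_congr rfl fun k _ => ?_
    rw [polyFun_mul, polyFun_pow]
    ring
  have h2 : ∑ k ∈ Finset.range (d + 1), f k = ∑ k ∈ Finset.range (2 * (D + 1)), f k := by
    refine Finset.sum_subset (Finset.range_mono (by omega)) fun k _ hk => ?_
    rw [Finset.mem_range, not_lt] at hk
    simp only [hf]
    rw [Nat.choose_eq_zero_of_lt (by omega)]
    simp
  rw [h1, h2, sum_range_even_odd f hodd, corrOp_apply, Finset.mul_sum, map_sum]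
  refine Finset.sum_congr rfl fun j _ => ?_
  have hE' : (3 : ℝ) < finrank ℝ E := by exact_mod_cast hE
  simp only [hf]
  rw [sphereInt_inner_pow μ hα hE hu0 (hl _), lap_pow_linForm_pow, map_smul,
    dil_of_isHomogeneous (by simpa using (isHomogeneous_linForm A).pow (d - 2 * j))]
  simp only [mul_smul_comm, map_smul, smul_eq_mul]
  rw [pow_mul ‖u‖, hun, mul_pow, corrWeight, Finset.prod_div_distrib, Finset.prod_mul_distrib,
    Finset.prod_mul_distrib (f := fun i : ℕ => 2 * ((i : ℝ) + 1))]
  have hne : ∏ i ∈ Finset.range j, (2 * ((i : ℝ) + 1)) ≠ 0 :=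
    Finset.prod_ne_zero_iff.mpr fun i _ => by positivity
  rw [show g * ((1 - normSqPoly) ^ j * linForm A ^ (d - 2 * j)) =
    g * linForm A ^ (d - 2 * j) * (1 - normSqPoly) ^ j by ring]
  generalize (∏ i ∈ Finset.range j, (2 * ((i : ℝ) + 1))) = a at *
  generalize (∏ i ∈ Finset.range j, ((finrank ℝ E : ℝ) - 3 + 2 * i)) = b
  generalize (∏ i ∈ Finset.range j, (2 * (i : ℝ) + 1)) = c
  field_simp

/-- The correlation operator is the conditional expectation of a polynomial in the components along
`β` given the components along `α`. -/
theorem sphereInt_polyFun_mul {β : Fin 3 → E} {t : ℝ} (hα : Orthonormal ℝ α)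
    (hβ : Orthonormal ℝ β) (hαβ : ∀ i j, inner ℝ (α i) (β j) = if i = j then t else 0)
    (hE : 3 < finrank ℝ E) (g : Poly) {p : Poly} {D : ℕ} (hp : p.totalDegree ≤ D) :
    sphereInt μ (fun x => polyFun α g x * polyFun β p x) =
      moment μ α (g * corrOp ((finrank ℝ E : ℝ) - 3) t D p) := by
  have hom : ∀ (i : ℕ) (d : ℕ), d ≤ D →
      sphereInt μ (fun x => polyFun α (homogeneousComponent i g) x *
        polyFun β (homogeneousComponent d p) x) =
      moment μ α (homogeneousComponent i g *
        corrOp ((finrank ℝ E : ℝ) - 3) t D (homogeneousComponent d p)) := by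
    intro i d hd
    let φ : Poly →ₗ[ℝ] ℝ :=
      { toFun := fun q => sphereInt μ (fun x => polyFun α (homogeneousComponent i g) x *
          polyFun β q x)
        map_add' := fun q r => by
          rw [← sphereInt_add (by fun_prop) (by fun_prop)]
          congr 1
          ext x
          simp [mul_add]
        map_smul' := fun c q => by
          rw [RingHom.id_apply, smul_eq_mul, ← sphereInt_const_mul]
          congr 1
          ext x
          simp only [polyFun_smul]
          ring }
    let ψ : Poly →ₗ[ℝ] ℝ := moment μ α ∘ₗ LinearMap.mulLeft ℝ (homogeneousComponent i g) ∘ₗ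
      corrOp ((finrank ℝ E : ℝ) - 3) t D
    -- Both sides are linear in the polynomial along `β`, so by polarization powers of linear forms
    -- suffice.
    have h := eq_zero_of_linForm_pow (φ := φ - ψ) (d := d) (fun A => by
      rw [LinearMap.sub_apply, sub_eq_zero]
      exact sphereInt_mul_linForm_pow μ hα hβ hαβ hE (homogeneousComponent_isHomogeneous i g) A hd)
      (homogeneousComponent_isHomogeneous d p)
    rw [LinearMap.sub_apply, sub_eq_zero] at h
    exact h
  calc sphereInt μ (fun x => polyFun α g x * polyFun β p x)
      = ∑ i ∈ Finset.range (g.totalDegree + 1), ∑ d ∈ Finset.range (D + 1),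
          sphereInt μ (fun x => polyFun α (homogeneousComponent i g) x *
            polyFun β (homogeneousComponent d p) x) := by
        rw [Finset.sum_congr rfl fun i _ => (sphereInt_sum (μ := μ) (Finset.range (D + 1))
          (f := fun d x => polyFun α (homogeneousComponent i g) x *
            polyFun β (homogeneousComponent d p) x) (fun d _ => by fun_prop)).symm,
          ← sphereInt_sum _ (fun i _ => by fun_prop)]
        congr 1
        ext x
        simp_rw [← Finset.mul_sum, ← Finset.sum_mul, ← polyFun_sum, sum_homogeneousComponent_of_le hp,
          sum_homogeneousComponent]
    _ = ∑ i ∈ Finset.range (g.totalDegree + 1), ∑ d ∈ Finset.range (D + 1),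
          moment μ α (homogeneousComponent i g *
            corrOp ((finrank ℝ E : ℝ) - 3) t D (homogeneousComponent d p)) :=
        Finset.sum_congr rfl fun i _ => Finset.sum_congr rfl fun d hd =>
          hom i d (by rw [Finset.mem_range] at hd; omega)
    _ = _ := by
        simp_rw [← map_sum, ← Finset.mul_sum, ← Finset.sum_mul, ← map_sum,
          sum_homogeneousComponent_of_le hp, sum_homogeneousComponent]

end SphereMoments

/-! ### Spectral bounds for the correlation operator on polynomials -/

section Spectral

/-- The quadratic form of a symmetric operator is bounded by any upper bound of its eigenvalues. -/
lemma inner_le_of_eigenvalue_le {V : Type*} [NormedAddCommGroup V] [InnerProductSpace ℝ V]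
    [FiniteDimensional ℝ V] {T : V →ₗ[ℝ] V} (hT : T.IsSymmetric) {c : ℝ}
    (h : ∀ κ (x : V), x ≠ 0 → T x = κ • x → κ ≤ c) (x : V) : inner ℝ (T x) x ≤ c * inner ℝ x x := by
  set b := hT.eigenvectorBasis rfl
  rw [← b.sum_inner_mul_inner, ← b.sum_inner_mul_inner, Finset.mul_sum]
  refine Finset.sum_le_sum fun i _ => ?_
  have hi : T (b i) = hT.eigenvalues rfl i • b i := hT.apply_eigenvectorBasis rfl i
  have hle := h _ (b i) (b.orthonormal.ne_zero i) hi
  rw [hT, hi, inner_smul_right, real_inner_comm x (b i), mul_assoc]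
  exact mul_le_mul_of_nonneg_right hle (mul_self_nonneg _)

/-- The same for an operator symmetric with respect to a positive definite bilinear form. -/
lemma bilin_le_of_eigenvalue_le {V : Type*} [AddCommGroup V] [Module ℝ V] [FiniteDimensional ℝ V]
    (A : V →ₗ[ℝ] V →ₗ[ℝ] ℝ) (hs : ∀ x y, A x y = A y x) (hp : ∀ x, 0 ≤ A x x)
    (hd : ∀ x, A x x = 0 → x = 0) {T : V →ₗ[ℝ] V} (hT : ∀ x y, A (T x) y = A x (T y)) {c : ℝ}
    (h : ∀ κ (x : V), x ≠ 0 → T x = κ • x → κ ≤ c) (x : V) : A (T x) x ≤ c * A x x := by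
  let core : InnerProductSpace.Core ℝ V :=
    { inner := fun x y => A x y
      conj_inner_symm := fun x y => hs y x
      re_inner_nonneg := hp
      add_left := fun x y z => by simp
      smul_left := fun x y r => by simp
      definite := hd }
  let _ : NormedAddCommGroup V := core.toNormedAddCommGroup
  let _ : InnerProductSpace ℝ V := InnerProductSpace.ofCore core.toCore
  exact inner_le_of_eigenvalue_le (V := V) (T := T) hT h x

variable {E : Type*} [NormedAddCommGroup E] [InnerProductSpace ℝ E] [FiniteDimensional ℝ E]
  [MeasurableSpace E] [BorelSpace E] (μ : Measure E) [μ.IsAddHaarMeasure] [Nontrivial E]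
  {α β : Fin 3 → E} {t : ℝ}

lemma sphereInt_inner_pow_eq_of_norm_eq (hE : 3 < finrank ℝ E) {u v : E} (huv : ‖u‖ = ‖v‖) (j : ℕ) :
    sphereInt μ (fun x => inner ℝ u x ^ j) = sphereInt μ (fun x => inner ℝ v x ^ j) := by
  -- Taking the zero family for `α` and `g = 1` makes the orthogonality condition empty, so the
  -- moment recursions hold for every vector.
  have h0 : ∀ w : E, ∀ i : Fin 3, inner ℝ ((fun _ => 0 : Fin 3 → E) i) w = 0 := by simp
  have st := fun w : E => stein_inner_pow μ (h0 w) (isHomogeneous_one (Fin 3) ℝ)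
  have od := fun w : E => sphereInt_inner_pow_odd μ hE (h0 w) (isHomogeneous_one (Fin 3) ℝ)
  simp only [polyFun_one, one_mul, Nat.cast_zero, add_zero] at st od
  rcases Nat.even_or_odd' j with ⟨k, rfl | rfl⟩
  · induction k with
    | zero => simp
    | succ k ih =>
      have hu := st u (2 * k)
      have hv := st v (2 * k)
      rw [ih, huv, ← hv] at hu
      have hE' : (0 : ℝ) < finrank ℝ E := by exact_mod_cast (by omega : 0 < finrank ℝ E)
      exact mul_left_cancel₀ (by positivity) hu
  · rw [od, od]

/-- The moments do not depend on the orthonormal family. -/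
lemma moment_eq_moment (hE : 3 < finrank ℝ E) (hα : Orthonormal ℝ α) (hβ : Orthonormal ℝ β)
    (p : Poly) : moment μ α p = moment μ β p := by
  have hw : ∀ γ : Fin 3 → E, Orthonormal ℝ γ → ∀ A : Fin 3 → ℝ,
      (∀ x, polyFun γ (linForm A) x = inner ℝ (∑ i, A i • γ i) x) ∧
      ‖∑ i, A i • γ i‖ ^ 2 = ∑ i, A i ^ 2 := by
    intro γ hγ A
    refine ⟨fun x => ?_, ?_⟩
    · simp [linForm, sum_inner, inner_smul_left]
    · rw [← real_inner_self_eq_norm_sq, hγ.inner_sum]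
      exact Finset.sum_congr rfl fun i _ => by simp; ring
  rw [← sum_homogeneousComponent p, map_sum, map_sum]
  refine Finset.sum_congr rfl fun d _ => ?_
  rw [← sub_eq_zero, ← LinearMap.sub_apply]
  refine eq_zero_of_linForm_pow (fun A => ?_) (homogeneousComponent_isHomogeneous d p)
  rw [LinearMap.sub_apply, sub_eq_zero, moment_apply, moment_apply]
  have e : ∀ γ : Fin 3 → E, Orthonormal ℝ γ → polyFun γ (linForm A ^ d) =
      fun x => inner ℝ (∑ i, A i • γ i) x ^ d := by
    intro γ hγ
    ext x
    rw [polyFun_pow, (hw γ hγ A).1]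
  rw [e α hα, e β hβ]
  refine sphereInt_inner_pow_eq_of_norm_eq μ hE ?_ d
  rw [← sq_eq_sq₀ (norm_nonneg _) (norm_nonneg _), (hw α hα A).2, (hw β hβ A).2]

lemma moment_mul_self_nonneg (α : Fin 3 → E) (p : Poly) : 0 ≤ moment μ α (p * p) :=
  integral_nonneg fun ω => by
    rw [polyFun_mul]
    exact mul_self_nonneg _

lemma exists_unit_orthogonal (hE : 3 < finrank ℝ E) (α : Fin 3 → E) :
    ∃ f : E, ‖f‖ = 1 ∧ ∀ i, inner ℝ (α i) f = 0 := by
  set W := Submodule.span ℝ (Set.range α)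
  have h1 : finrank ℝ W ≤ 3 := by
    have := finrank_range_le_card (R := ℝ) α
    simpa [Set.finrank, W] using this
  have h2 := Submodule.finrank_add_finrank_orthogonal W
  have h3 : 0 < finrank ℝ Wᗮ := by omega
  have : Nontrivial Wᗮ := finrank_pos_iff.mp h3
  obtain ⟨f, hf⟩ := exists_norm_eq Wᗮ (zero_le_one' ℝ)
  exact ⟨f, hf, fun i => f.2 _ (Submodule.subset_span ⟨i, rfl⟩)⟩

/-- The second moment form is positive definite. -/
lemma eq_zero_of_moment_mul_self (hE : 3 < finrank ℝ E) (hα : Orthonormal ℝ α) {p : Poly}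
    (hp : moment μ α (p * p) = 0) : p = 0 := by
  have hc : Continuous fun ω : sphere (0 : E) 1 => polyFun α (p * p) ω :=
    (continuous_polyFun α _).comp continuous_subtype_val
  have h1 := (integral_eq_zero_iff_of_nonneg (fun ω : sphere (0 : E) 1 => by
    simp only [polyFun_mul]
    exact mul_self_nonneg _) (integrable_sphere (μ := μ) (continuous_polyFun α (p * p)))).mp hp
  have h2 := (Continuous.ae_eq_iff_eq (μ := μ.toSphere) hc continuous_const).mp h1
  obtain ⟨f, hf1, hf⟩ := exists_unit_orthogonal hE α
  have hα' := orthonormal_iff_ite.mp hα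
  -- By continuity `p` vanishes at the coordinates of every unit vector. Each point of this cube has
  -- squared norm at most `3/4`, so a multiple of the fourth direction `f` completes it to a unit
  -- vector.
  refine MvPolynomial.funext_set (fun _ => Set.Icc (-(1 / 2) : ℝ) (1 / 2))
    (fun _ => Set.Icc_infinite (by norm_num)) fun x hx => ?_
  have hx' : ∑ i, x i ^ 2 ≤ 3 / 4 := by
    have : ∀ i, x i ^ 2 ≤ 1 / 4 := by
      intro i
      have := hx i (Set.mem_univ i)
      nlinarith [this.1, this.2]
    calc ∑ i, x i ^ 2 ≤ ∑ i : Fin 3, (1 / 4 : ℝ) := Finset.sum_le_sum fun i _ => this i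
      _ = 3 / 4 := by simp; norm_num
  set ξ : E := ∑ i, x i • α i + Real.sqrt (1 - ∑ i, x i ^ 2) • f with hξ
  have hin : ∀ i, inner ℝ (α i) ξ = x i := by
    intro i
    simp [hξ, inner_add_right, inner_sum, inner_smul_right, hα', hf]
  have hξn : ‖ξ‖ = 1 := by
    have hsq : ‖ξ‖ ^ 2 = 1 := by
      have h0 : inner ℝ (∑ i, x i • α i) f = 0 := by
        simp [sum_inner, inner_smul_left, hf]
      rw [hξ, norm_add_sq_real, inner_smul_right, h0, norm_smul, hf1, mul_one, Real.norm_eq_abs,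
        sq_abs, Real.sq_sqrt (by linarith), ← real_inner_self_eq_norm_sq, hα.inner_sum]
      simp [← sq]
    nlinarith [norm_nonneg ξ]
  have h3 := congrFun h2 ⟨ξ, mem_sphere_zero_iff_norm.mpr hξn⟩
  simp only [polyFun_mul] at h3
  have h4 : coords α ξ = x := _root_.funext hin
  rw [map_zero, ← h4]
  exact mul_self_eq_zero.mp h3

/-- The correlation operator is symmetric. -/
lemma moment_mul_corrOp_comm (hα : Orthonormal ℝ α) (hβ : Orthonormal ℝ β)
    (hαβ : ∀ i j, inner ℝ (α i) (β j) = if i = j then t else 0) (hE : 3 < finrank ℝ E)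
    {g p : Poly} {D : ℕ} (hg : g.totalDegree ≤ D) (hp : p.totalDegree ≤ D) :
    moment μ α (g * corrOp ((finrank ℝ E : ℝ) - 3) t D p) =
      moment μ α (p * corrOp ((finrank ℝ E : ℝ) - 3) t D g) := by
  have hβα : ∀ i j, inner ℝ (β i) (α j) = if i = j then t else 0 := by
    intro i j
    rw [real_inner_comm, hαβ]
    simp [eq_comm]
  rw [← sphereInt_polyFun_mul μ hα hβ hαβ hE g hp, moment_eq_moment μ hE hα hβ,
    ← sphereInt_polyFun_mul μ hβ hα hβα hE p hg]
  congr 1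
  ext x
  ring

/-- The left side is the integral of `p(α) p(β)`, at most the average of the second moments of
`p(α)` and `p(β)`, which coincide. -/
lemma abs_moment_mul_corrOp_le (hα : Orthonormal ℝ α) (hβ : Orthonormal ℝ β)
    (hαβ : ∀ i j, inner ℝ (α i) (β j) = if i = j then t else 0) (hE : 3 < finrank ℝ E)
    {p : Poly} {D : ℕ} (hp : p.totalDegree ≤ D) :
    |moment μ α (p * corrOp ((finrank ℝ E : ℝ) - 3) t D p)| ≤ moment μ α (p * p) := by
  rw [← sphereInt_polyFun_mul μ hα hβ hαβ hE p hp]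
  have h1 : moment μ α (p * p) =
      sphereInt μ (fun x => 1 / 2 * (polyFun α (p * p) x + polyFun β (p * p) x)) := by
    rw [sphereInt_const_mul, sphereInt_add (by fun_prop) (by fun_prop), ← moment_apply,
      ← moment_apply, moment_eq_moment μ hE hβ hα]
    ring
  rw [h1]
  refine (abs_integral_le_integral_abs).trans (integral_mono
    (integrable_sphere (f := fun x => |polyFun α p x * polyFun β p x|) (by fun_prop))
    (integrable_sphere (f := fun x => 1 / 2 * (polyFun α (p * p) x + polyFun β (p * p) x))
      (by fun_prop)) fun ω => ?_)
  simp only [polyFun_mul]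
  rw [abs_le]
  constructor <;> nlinarith [sq_nonneg (polyFun α p ω + polyFun β p ω),
    sq_nonneg (polyFun α p ω - polyFun β p ω)]

/-- The eigenvalues of the correlation operator have absolute value at most one. -/
lemma abs_corrEig_le_one (hα : Orthonormal ℝ α) (hβ : Orthonormal ℝ β)
    (hαβ : ∀ i j, inner ℝ (α i) (β j) = if i = j then t else 0) (hE : 3 < finrank ℝ E)
    {n l : ℕ} {q : Poly} (hq0 : q ≠ 0) (hq : q.IsHomogeneous (2 * n + l))
    (hqe : radialLap q = radialEig (2 * n + l) n • q) :
    |corrEig ((finrank ℝ E : ℝ) - 3) t n l| ≤ 1 := by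
  obtain ⟨μ, _⟩ : ∃ μ : Measure E, μ.IsAddHaarMeasure :=
    ⟨(stdOrthonormalBasis ℝ E).toBasis.addHaar, inferInstance⟩
  have hm : 0 < (finrank ℝ E : ℝ) - 3 := by
    have : (3 : ℝ) < finrank ℝ E := by exact_mod_cast hE
    linarith
  set d := 2 * n + l with hd
  set κ := corrEig ((finrank ℝ E : ℝ) - 3) t n l with hκ
  set K := corrOp ((finrank ℝ E : ℝ) - 3) t d with hK
  set F : Module.End ℝ Poly := K - κ • LinearMap.id with hF
  have hFa : ∀ p, F p = K p - κ • p := fun p => by simp [hF]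
  suffices h : ∃ f : Poly, f ≠ 0 ∧ f.totalDegree ≤ d ∧ F f = 0 by
    obtain ⟨f, hf0, hfd, hFf⟩ := h
    rw [hFa, sub_eq_zero] at hFf
    have h1 := abs_moment_mul_corrOp_le μ hα hβ hαβ hE hfd
    rw [← hK, hFf, mul_smul_comm, map_smul, smul_eq_mul, abs_mul,
      abs_of_nonneg (moment_mul_self_nonneg μ α f)] at h1
    have h2 : 0 < moment μ α (f * f) :=
      lt_of_le_of_ne (moment_mul_self_nonneg μ α f) fun h =>
        hf0 (eq_zero_of_moment_mul_self μ hE hα h.symm)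
    exact le_of_mul_le_mul_right (by linarith) h2
  let W : Submodule ℝ Poly := restrictTotalDegree (Fin 3) ℝ d ⊓
    LinearMap.ker (homogeneousComponent (R := ℝ) (σ := Fin 3) d)
  have hWm : ∀ p, p ∈ W ↔ p.totalDegree ≤ d ∧ homogeneousComponent d p = 0 := by
    intro p
    simp [W, mem_restrictTotalDegree]
  have hFd : ∀ p : Poly, p.totalDegree ≤ d → (F p).totalDegree ≤ d := by
    intro p hp
    rw [hFa]
    exact (totalDegree_sub _ _).trans
      (max_le (totalDegree_corrOp_le _ _ _ hp) ((totalDegree_smul_le _ _).trans hp))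
  have hFW : ∀ p ∈ W, F p ∈ W := by
    intro p hp
    rw [hWm] at hp ⊢
    refine ⟨hFd p hp.1, ?_⟩
    rw [hFa, map_sub, map_smul, hp.2, homogeneousComponent_corrOp _ _ _ hp.1, hp.2]
    simp
  have hqd : q.totalDegree ≤ d := hq.totalDegree_le
  have hFq : F q ∈ W := by
    rw [hWm]
    refine ⟨hFd q hqd, ?_⟩
    rw [hFa, map_sub, map_smul, homogeneousComponent_corrOp _ _ _ hqd,
      homogeneousComponent_eq_self hq, aeval_radialLap_of_eigenvector hqe,
      eval_leadPoly hm t (by omega), sub_self]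
  have : FiniteDimensional ℝ W := Submodule.finiteDimensional_of_le inf_le_left
  -- `F = K - κ` maps `q` into the space `W` of polynomials of lower degree. If `F` is injective on
  -- the finite-dimensional `W` it is onto, and `q` can be corrected by lower-order terms to an
  -- element of the kernel; otherwise the kernel already meets `W`.
  by_cases hinj : Function.Injective (F.restrict hFW)
  · obtain ⟨r, hr⟩ := LinearMap.injective_iff_surjective.mp hinj ⟨F q, hFq⟩
    have hr' : F r.1 = F q := congrArg Subtype.val hr
    have hrW := (hWm r.1).mp r.2
    refine ⟨q - r.1, fun h => hq0 ?_, ?_, by rw [map_sub, hr', sub_self]⟩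
    · have := congrArg (homogeneousComponent d) h
      rwa [map_sub, hrW.2, homogeneousComponent_eq_self hq, map_zero, sub_zero] at this
    · exact (totalDegree_sub _ _).trans (max_le hqd hrW.1)
  · rw [← LinearMap.ker_eq_bot, Submodule.eq_bot_iff] at hinj
    push Not at hinj
    obtain ⟨f, hf, hf0⟩ := hinj
    refine ⟨f.1, fun h => hf0 (Subtype.ext h), ((hWm f.1).mp f.2).1, ?_⟩
    exact congrArg Subtype.val (LinearMap.mem_ker.mp hf)

/-- An upper bound for the eigenvalues bounds the correlation form on polynomials of mean zero. -/
lemma moment_mul_corrOp_le (hα : Orthonormal ℝ α) (hβ : Orthonormal ℝ β)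
    (hαβ : ∀ i j, inner ℝ (α i) (β j) = if i = j then t else 0) (hE : 3 < finrank ℝ E) {c : ℝ}
    (hc : ∀ n l, 1 ≤ 2 * n + l → ∀ q : Poly, q ≠ 0 → q.IsHomogeneous (2 * n + l) →
      radialLap q = radialEig (2 * n + l) n • q → corrEig ((finrank ℝ E : ℝ) - 3) t n l ≤ c)
    {p : Poly} {D : ℕ} (hp : p.totalDegree ≤ D) (hp0 : moment μ α p = 0) :
    moment μ α (p * corrOp ((finrank ℝ E : ℝ) - 3) t D p) ≤ c * moment μ α (p * p) := by
  have hm : 0 < (finrank ℝ E : ℝ) - 3 := by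
    have : (3 : ℝ) < finrank ℝ E := by exact_mod_cast hE
    linarith
  set K := corrOp ((finrank ℝ E : ℝ) - 3) t D with hK
  let W : Submodule ℝ Poly := restrictTotalDegree (Fin 3) ℝ D ⊓ LinearMap.ker (moment μ α)
  have hWm : ∀ p, p ∈ W ↔ p.totalDegree ≤ D ∧ moment μ α p = 0 := by
    intro p
    simp [W, mem_restrictTotalDegree]
  have hKW : ∀ p ∈ W, K p ∈ W := by
    intro p hp
    rw [hWm] at hp ⊢
    -- The operator preserves means: test against `1` and use that the moments along `α` and `β`
    -- agree.
    refine ⟨totalDegree_corrOp_le _ _ _ hp.1, ?_⟩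
    have := sphereInt_polyFun_mul μ hα hβ hαβ hE 1 hp.1
    rw [one_mul] at this
    rw [hK, ← this]
    simp only [polyFun_one, one_mul]
    rw [← hp.2, moment_eq_moment μ hE hα hβ]
    rfl
  have : FiniteDimensional ℝ W := Submodule.finiteDimensional_of_le inf_le_left
  let A : W →ₗ[ℝ] W →ₗ[ℝ] ℝ := LinearMap.mk₂ ℝ (fun x y => moment μ α (x.1 * y.1))
    (fun x y z => by simp [add_mul]) (fun c x y => by simp)
    (fun x y z => by simp [mul_add]) (fun c x y => by simp)
  have key := bilin_le_of_eigenvalue_le A (fun x y => by simp [A, mul_comm])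
    (fun x => moment_mul_self_nonneg μ α x.1)
    (fun x hx => Subtype.ext (eq_zero_of_moment_mul_self μ hE hα hx))
    (T := K.restrict hKW) (c := c) ?_ ?_ ⟨p, (hWm p).mpr ⟨hp, hp0⟩⟩
  · rw [mul_comm p]
    exact key
  · intro x y
    have := moment_mul_corrOp_comm μ hα hβ hαβ hE ((hWm x.1).mp x.2).1 ((hWm y.1).mp y.2).1
    rw [← hK] at this
    simp only [A, LinearMap.mk₂_apply, LinearMap.coe_restrict_apply]
    rw [this, mul_comm]
  · intro κ x hx hκ
    have hx' := (hWm x.1).mp x.2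
    have h0 : x.1 ≠ 0 := fun h => hx (Subtype.ext h)
    obtain ⟨n, l, hd, rfl, q, hq0, hq, hqe⟩ := exists_corrEig_of_eigenvector hm t h0 hx'.1
      (congrArg Subtype.val hκ)
    refine hc n l ?_ q hq0 hq hqe
    by_contra hlt
    have h1 : x.1.totalDegree = 0 := by omega
    rw [totalDegree_eq_zero_iff_eq_C] at h1
    refine h0 (eq_zero_of_moment_mul_self μ hE hα ?_)
    conv_lhs => rw [h1, ← smul_eq_C_mul, map_smul, ← h1, hx'.2, smul_zero]

end Spectral

/-- In the model with two vectors of `ℝ³` on the sphere of `ℝ⁶` all angles occur. -/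
lemma abs_corrEig_three_le_one {t : ℝ} (ht : t ^ 2 ≤ 1) {n l : ℕ} {q : Poly} (hq0 : q ≠ 0)
    (hq : q.IsHomogeneous (2 * n + l)) (hqe : radialLap q = radialEig (2 * n + l) n • q) :
    |corrEig 3 t n l| ≤ 1 := by
  classical
  let e : Fin 2 × Fin 3 → EuclideanSpace ℝ (Fin 2 × Fin 3) := fun i => EuclideanSpace.single i 1
  have he : ∀ i j, inner ℝ (e i) (e j) = if i = j then (1 : ℝ) else 0 :=
    orthonormal_iff_ite.mp EuclideanSpace.orthonormal_single
  have hα : Orthonormal ℝ fun i => e (0, i) := by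
    rw [orthonormal_iff_ite]
    intro i j
    simp [he]
  have hβ : Orthonormal ℝ fun i => t • e (0, i) + Real.sqrt (1 - t ^ 2) • e (1, i) := by
    rw [orthonormal_iff_ite]
    intro i j
    have hs : Real.sqrt (1 - t ^ 2) * Real.sqrt (1 - t ^ 2) = 1 - t ^ 2 :=
      Real.mul_self_sqrt (by linarith)
    have hs' : t * t + Real.sqrt (1 - t ^ 2) * Real.sqrt (1 - t ^ 2) = 1 := by rw [hs]; ring
    simp only [inner_add_left, inner_add_right, inner_smul_left, inner_smul_right, he]
    by_cases hij : i = j <;> simp [hij, hs']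
  have h := abs_corrEig_le_one (t := t) hα hβ
    (fun i j => by simp [inner_add_right, inner_smul_right, he]) (by simp) hq0 hq hqe
  have h6 : ((finrank ℝ (EuclideanSpace ℝ (Fin 2 × Fin 3)) : ℕ) : ℝ) - 3 = 3 := by
    simp
    norm_num
  rwa [h6] at h

/-! ### The case `m = 3`: recursion and differential equation for the eigenvalues -/

section EigenvalueBounds

lemma corrEig_zero_left (m t : ℝ) (l : ℕ) : corrEig m t 0 l = t ^ l := by
  simp [corrEig]

lemma corrEig_neg (m t : ℝ) (n l : ℕ) : corrEig m (-t) n l = (-1) ^ l * corrEig m t n l := by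
  rw [corrEig, corrEig, Finset.mul_sum]
  refine Finset.sum_congr rfl fun j _ => ?_
  rw [neg_pow t, neg_sq, pow_add (-1 : ℝ), pow_mul (-1 : ℝ)]
  norm_num
  ring

/-- The coefficients of `corrEig 3`. -/
def corrCoeff (n l j : ℕ) : ℝ :=
  (-1) ^ j * n.choose j * ∏ i ∈ Finset.range j, ((2 * (n : ℝ) + 2 * l + 1 - 2 * i) / (3 + 2 * i))

lemma corrCoeff_eq_zero {n l j : ℕ} (h : n < j) : corrCoeff n l j = 0 := by
  simp [corrCoeff, Nat.choose_eq_zero_of_lt h]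

lemma corrEig_three (t : ℝ) (n l : ℕ) : corrEig 3 t n l =
    ∑ j ∈ Finset.range (n + 1), corrCoeff n l j * (t ^ (2 * (n - j) + l) * (1 - t ^ 2) ^ j) := by
  rw [corrEig]
  exact Finset.sum_congr rfl fun j _ => by rw [corrCoeff]; ring

/-- The ratio of consecutive coefficients is what makes the second-order equation in
`hasDerivAt_angleFunDeriv` telescope. -/
lemma corrCoeff_succ (n l j : ℕ) : (2 * (j : ℝ) + 3) * (2 * j + 2) * corrCoeff n l (j + 1) =
    -((2 * (n : ℝ) - 2 * j) * (2 * n + 2 * l + 1 - 2 * j)) * corrCoeff n l j := by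
  have h : (n.choose (j + 1) : ℝ) * (j + 1) = n.choose j * ((n : ℝ) - j) := by
    rcases le_or_gt j n with hj | hj
    · rw [← Nat.cast_sub hj]
      exact_mod_cast Nat.choose_succ_right_eq n j
    · rw [Nat.choose_eq_zero_of_lt hj, Nat.choose_eq_zero_of_lt (by omega)]
      simp
  rw [corrCoeff, corrCoeff, Finset.prod_range_succ, pow_succ]
  have h3 : (3 : ℝ) + 2 * j ≠ 0 := by positivity
  have e : (2 * (n : ℝ) + 2 * l + 1 - 2 * j) / (3 + 2 * j) * (2 * j + 3) =
      2 * (n : ℝ) + 2 * l + 1 - 2 * j := by field_simp; ring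
  linear_combination (-2) * (-1 : ℝ) ^ j * (∏ i ∈ Finset.range j,
    ((2 * (n : ℝ) + 2 * l + 1 - 2 * i) / (3 + 2 * i))) * ((2 * (n : ℝ) + 2 * l + 1 - 2 * j) * h +
    n.choose (j + 1) * (j + 1) * e)

/-- A recursion between consecutive angular momenta. -/
lemma corrEig_three_recursion (t : ℝ) (n l : ℕ) :
    (2 * (n : ℝ) + l + 4) * (t * corrEig 3 t (n + 1) l) =
      ((n : ℝ) + l + 3) * corrEig 3 t (n + 1) (l + 1) + ((n : ℝ) + 1) * corrEig 3 t n (l + 1) := by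
  set z : ℕ → ℝ := fun j => t ^ (2 * (n + 1 - j) + l + 1) * (1 - t ^ 2) ^ j with hz
  have h1 : t * corrEig 3 t (n + 1) l =
      ∑ j ∈ Finset.range (n + 2), corrCoeff (n + 1) l j * z j := by
    rw [corrEig_three, Finset.mul_sum]
    exact Finset.sum_congr rfl fun j _ => by simp only [hz, pow_succ]; ring
  have h2 : corrEig 3 t (n + 1) (l + 1) =
      ∑ j ∈ Finset.range (n + 2), corrCoeff (n + 1) (l + 1) j * z j := by
    rw [corrEig_three]
    exact Finset.sum_congr rfl fun j _ => by simp only [hz, add_assoc]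
  -- The factor `1 = t² + (1 - t²)` raises this term to the common degree, so that all three
  -- eigenvalues are expanded in the same monomials `z j`.
  have h3 : corrEig 3 t n (l + 1) = ∑ j ∈ Finset.range (n + 2), corrCoeff n (l + 1) j * z j +
      ∑ j ∈ Finset.range (n + 1), corrCoeff n (l + 1) j * z (j + 1) := by
    rw [Finset.sum_range_succ _ (n + 1), corrCoeff_eq_zero (by omega : n < n + 1), zero_mul, add_zero,
      ← Finset.sum_add_distrib, corrEig_three]
    refine Finset.sum_congr rfl fun j hj => ?_
    rw [Finset.mem_range] at hj
    simp only [hz]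
    rw [show n + 1 - j = n - j + 1 by omega, show n + 1 - (j + 1) = n - j by omega]
    ring
  have h4 : ∑ j ∈ Finset.range (n + 1), corrCoeff n (l + 1) j * z (j + 1) =
      ∑ j ∈ Finset.range (n + 2), (if j = 0 then 0 else corrCoeff n (l + 1) (j - 1)) * z j := by
    rw [Finset.sum_range_succ' _ (n + 1)]
    simp
  rw [h1, h2, h3, h4, ← Finset.sum_add_distrib, Finset.mul_sum, Finset.mul_sum, Finset.mul_sum,
    ← Finset.sum_add_distrib]
  refine Finset.sum_congr rfl fun j hj => ?_
  rcases j with _ | j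
  · simp [corrCoeff]
    ring
  · rw [if_neg (by omega), Nat.add_sub_cancel]
    have hjn : j ≤ n := by rw [Finset.mem_range] at hj; omega
    set P := ∏ i ∈ Finset.range j, ((2 * (n : ℝ) + 2 * (l + 1 : ℕ) + 1 - 2 * i) / (3 + 2 * i)) with hP
    have c1 : ((n + 1).choose (j + 1) : ℝ) * (j + 1) = n.choose j * (n + 1) := by
      have := Nat.add_one_mul_choose_eq n j
      have h' : ((n : ℝ) + 1) * n.choose j = (n + 1).choose (j + 1) * (j + 1) := by exact_mod_cast this
      linarith
    have c2 : (n.choose (j + 1) : ℝ) * (j + 1) = n.choose j * ((n : ℝ) - j) := by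
      rw [← Nat.cast_sub hjn]
      exact_mod_cast Nat.choose_succ_right_eq n j
    have hj1 : (j : ℝ) + 1 ≠ 0 := by positivity
    have hj3 : (3 : ℝ) + 2 * j ≠ 0 := by positivity
    have p1 : ∏ i ∈ Finset.range (j + 1),
        ((2 * ((n + 1 : ℕ) : ℝ) + 2 * l + 1 - 2 * i) / (3 + 2 * i)) =
        P * ((2 * n + 2 * l + 3 - 2 * j) / (3 + 2 * j)) := by
      rw [Finset.prod_range_succ, hP]
      push_cast
      congr 1
      · exact Finset.prod_congr rfl fun i _ => by ring
      · ring
    have p2 : ∏ i ∈ Finset.range (j + 1),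
        ((2 * ((n + 1 : ℕ) : ℝ) + 2 * (l + 1 : ℕ) + 1 - 2 * i) / (3 + 2 * i)) =
        P * ((2 * n + 2 * l + 5) / (3 + 2 * j)) := by
      rw [Finset.prod_div_distrib, Finset.prod_range_succ', Finset.prod_range_succ, hP,
        Finset.prod_div_distrib, div_mul_div_comm]
      push_cast
      congr 1
      congr 1
      · exact Finset.prod_congr rfl fun i _ => by ring
      · ring
    have p3 : ∏ i ∈ Finset.range (j + 1),
        ((2 * (n : ℝ) + 2 * (l + 1 : ℕ) + 1 - 2 * i) / (3 + 2 * i)) =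
        P * ((2 * n + 2 * l + 3 - 2 * j) / (3 + 2 * j)) := by
      rw [Finset.prod_range_succ, hP]
      push_cast
      congr 1
      ring
    have e1 : ((n + 1).choose (j + 1) : ℝ) = n.choose j * (n + 1) / (j + 1) := by
      rw [← c1]; field_simp
    have e2 : (n.choose (j + 1) : ℝ) = n.choose j * ((n : ℝ) - j) / (j + 1) := by
      rw [← c2]; field_simp
    have key : (2 * (n : ℝ) + l + 4) * corrCoeff (n + 1) l (j + 1) =
        ((n : ℝ) + l + 3) * corrCoeff (n + 1) (l + 1) (j + 1) +
        ((n : ℝ) + 1) * (corrCoeff n (l + 1) (j + 1) + corrCoeff n (l + 1) j) := by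
      rw [corrCoeff, corrCoeff, corrCoeff, corrCoeff, p1, p2, p3, ← hP, e1, e2, pow_succ]
      generalize (-1 : ℝ) ^ j = ε
      field_simp
      ring
    linear_combination z (j + 1) * key

/-- `sin θ cos θ · corrEig 3 (cos θ) n l`. -/
def angleFun (n l : ℕ) (θ : ℝ) : ℝ :=
  ∑ j ∈ Finset.range (n + 1), corrCoeff n l j *
    (Real.cos θ ^ (2 * (n - j) + l + 1) * Real.sin θ ^ (2 * j + 1))

/-- The derivative of `angleFun`. -/
def angleFunDeriv (n l : ℕ) (θ : ℝ) : ℝ :=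
  ∑ j ∈ Finset.range (n + 1), corrCoeff n l j *
    (((2 * j + 1 : ℕ) : ℝ) * (Real.cos θ ^ (2 * (n - j) + l + 2) * Real.sin θ ^ (2 * j)) -
      ((2 * (n - j) + l + 1 : ℕ) : ℝ) * (Real.cos θ ^ (2 * (n - j) + l) * Real.sin θ ^ (2 * j + 2)))

/-- With the factor `sin θ cos θ` the equation in `θ` has no first-order term, as the energy
argument requires. -/
lemma angleFun_eq (n l : ℕ) (θ : ℝ) :
    angleFun n l θ = Real.sin θ * Real.cos θ * corrEig 3 (Real.cos θ) n l := by
  rw [angleFun, corrEig_three, Finset.mul_sum]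
  refine Finset.sum_congr rfl fun j _ => ?_
  rw [← Real.sin_sq, pow_succ, pow_succ (Real.sin θ), pow_mul (Real.sin θ)]
  ring

/-- The truncated exponents `b - 1` and `a - 1` are harmless at zero because of the prefactors `b`
and `a`. -/
lemma hasDerivAt_cos_pow_mul_sin_pow (a b : ℕ) (θ : ℝ) :
    HasDerivAt (fun θ => Real.cos θ ^ a * Real.sin θ ^ b)
      (b * (Real.cos θ ^ (a + 1) * Real.sin θ ^ (b - 1)) -
        a * (Real.cos θ ^ (a - 1) * Real.sin θ ^ (b + 1))) θ := by
  refine (((Real.hasDerivAt_cos θ).pow a).mul ((Real.hasDerivAt_sin θ).pow b)).congr_deriv ?_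
  simp only [Pi.pow_apply]
  ring

lemma hasDerivAt_angleFun (n l : ℕ) (θ : ℝ) :
    HasDerivAt (angleFun n l) (angleFunDeriv n l θ) θ := by
  refine HasDerivAt.fun_sum fun j _ => ?_
  exact (hasDerivAt_cos_pow_mul_sin_pow _ _ θ).const_mul _

/-- The second order equation satisfied by `angleFun`. -/
lemma hasDerivAt_angleFunDeriv (n l : ℕ) {θ : ℝ} (hθ : Real.cos θ ≠ 0) :
    HasDerivAt (angleFunDeriv n l)
      (-((2 * (n : ℝ) + l + 2) ^ 2 - l * (l + 1) / Real.cos θ ^ 2) * angleFun n l θ) θ := by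
  have hd := HasDerivAt.fun_sum (u := Finset.range (n + 1)) fun j _ =>
    ((((hasDerivAt_cos_pow_mul_sin_pow (2 * (n - j) + l + 2) (2 * j) θ).const_mul
      ((2 * j + 1 : ℕ) : ℝ)).sub
      ((hasDerivAt_cos_pow_mul_sin_pow (2 * (n - j) + l) (2 * j + 2) θ).const_mul
      ((2 * (n - j) + l + 1 : ℕ) : ℝ))).const_mul (corrCoeff n l j))
  refine hd.congr_deriv ?_
  set c := Real.cos θ
  set s := Real.sin θ
  have hcs : s ^ 2 = 1 - c ^ 2 := Real.sin_sq θ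
  apply mul_left_cancel₀ (pow_ne_zero 2 hθ)
  have rhs : c ^ 2 * (-((2 * (n : ℝ) + l + 2) ^ 2 - l * (l + 1) / c ^ 2) * angleFun n l θ) =
      ∑ j ∈ Finset.range (n + 1), (l * (l + 1) - (2 * (n : ℝ) + l + 2) ^ 2 * c ^ 2) *
        (corrCoeff n l j * (c ^ (2 * (n - j) + l + 1) * s ^ (2 * j + 1))) := by
    rw [angleFun, ← Finset.mul_sum]
    field_simp
    ring
  rw [rhs, Finset.mul_sum, ← sub_eq_zero, ← Finset.sum_sub_distrib]
  -- The difference of the two sides is the telescoping sum of `X j - X (j + 1)`. Both ends vanish: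
  -- `X 0` by its factor `2 j`, `X (n + 1)` by its coefficient.
  set X : ℕ → ℝ := fun j => corrCoeff n l j * ((2 * (j : ℝ) + 1) * (2 * j)) *
    (c ^ (2 * (n - j) + l + 3) * s ^ (2 * j - 1)) with hX
  have tele := Finset.sum_range_sub' X (n + 1)
  have hX0 : X 0 = 0 := by simp [hX]
  have hXn : X (n + 1) = 0 := by simp [hX, corrCoeff_eq_zero (Nat.lt_succ_self n)]
  rw [hX0, hXn, sub_zero] at tele
  rw [← tele]
  refine Finset.sum_congr rfl fun j hj => ?_
  have hjn : j ≤ n := by rw [Finset.mem_range] at hj; omega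
  have hX1 : X (j + 1) = -((2 * (n : ℝ) - 2 * j) * (2 * n + 2 * l + 1 - 2 * j)) * corrCoeff n l j *
      (c ^ (2 * (n - j) + l + 1) * s ^ (2 * j + 1)) := by
    rw [← corrCoeff_succ]
    simp only [hX]
    rcases eq_or_lt_of_le hjn with rfl | h
    · simp [corrCoeff_eq_zero (Nat.lt_succ_self j)]
    · rw [show 2 * (n - (j + 1)) + l + 3 = 2 * (n - j) + l + 1 by omega,
        show 2 * (j + 1) - 1 = 2 * j + 1 by omega]
      push_cast
      ring
  rw [hX1]
  simp only [hX]
  obtain ⟨r, rfl⟩ : ∃ r, n = j + r := ⟨n - j, by omega⟩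
  rw [Nat.add_sub_cancel_left]
  -- This and `hca` absorb the truncated exponents `2 * j - 1` and `2 * r + l - 1`, whose prefactors
  -- vanish when the subtraction is not exact.
  have hsb : (2 * (j : ℝ)) * s ^ (2 * j - 1) * s ^ 2 = (2 * (j : ℝ)) * s ^ (2 * j + 1) := by
    rcases j with _ | j
    · simp
    · rw [show 2 * (j + 1) - 1 = 2 * j + 1 by omega]; ring
  have hca : ((2 * r + l : ℕ) : ℝ) * c ^ (2 * r + l - 1) * c = ((2 * r + l : ℕ) : ℝ) * c ^ (2 * r + l) := by
    rcases Nat.eq_zero_or_pos (2 * r + l) with h | h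
    · rw [h]; simp
    · rw [mul_assoc, ← pow_succ, Nat.sub_add_cancel h]
  rw [show 2 * r + l + 2 - 1 = 2 * r + l + 1 by omega, show 2 * j + 2 - 1 = 2 * j + 1 by omega,
    show 2 * r + l + 2 + 1 = 2 * r + l + 3 by omega, pow_succ c (2 * r + l),
    pow_add c (2 * r + l) 3, show 2 * j + 2 + 1 = 2 * j + 1 + 2 by omega, pow_add s (2 * j + 1) 2]
  push_cast at hca ⊢
  generalize c ^ (2 * r + l - 1) = C' at *
  generalize c ^ (2 * r + l) = C at *
  generalize s ^ (2 * j - 1) = S' at *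
  generalize s ^ (2 * j + 1) = S at *
  generalize corrCoeff (j + r) l j = K
  linear_combination K * (-(2 * (j : ℝ) + 1) * c ^ 3 * C * hsb +
    (2 * (j : ℝ) + 1) * (2 * j) * c ^ 3 * C * S' * hcs + c * (2 * (r : ℝ) + l + 1) * S * s ^ 2 * hca
    + (2 * (r : ℝ) + l + 1) * (2 * r + l) * c * C * S * hcs)

end EigenvalueBounds

/-! ### Energy estimate and the sharp bound at correlation `1/2` -/

section EigenvalueBounds

lemma angleFun_zero (n l : ℕ) : angleFun n l 0 = 0 := by
  simp [angleFun]

lemma angleFunDeriv_zero (n l : ℕ) : angleFunDeriv n l 0 = 1 := by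
  rw [angleFunDeriv, Finset.sum_range_succ', Finset.sum_eq_zero]
  · simp [corrCoeff]
  · intro j _
    simp

/-- An energy estimate for the eigenvalues at correlation `1/2`. -/
lemma corrEig_three_half_energy (n l : ℕ) :
    ((2 * (n : ℝ) + l + 2) ^ 2 - 4 * (l * (l + 1))) * (3 / 16) * corrEig 3 (1 / 2) n l ^ 2 ≤ 1 := by
  set Q : ℝ → ℝ := fun θ => (2 * (n : ℝ) + l + 2) ^ 2 - l * (l + 1) / Real.cos θ ^ 2 with hQ
  -- For `f'' = -Q f` the energy `H = f'² + Q f²` has derivative `Q' f²`, which is nonpositive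
  -- because `Q` decreases on `[0, π/3]`. Compare `H(0) = 1` with `H(π/3)`, where the cosine is
  -- `1/2` and `f² = (3/16) corrEig²`.
  set H : ℝ → ℝ := fun θ => angleFunDeriv n l θ ^ 2 + Q θ * angleFun n l θ ^ 2 with hH
  have hcos : ∀ θ ∈ Set.Icc (0 : ℝ) (Real.pi / 3), 0 < Real.cos θ := fun θ hθ =>
    Real.cos_pos_of_mem_Ioo ⟨by linarith [hθ.1, Real.pi_pos], by linarith [hθ.2, Real.pi_pos]⟩
  have hQd : ∀ θ ∈ Set.Icc (0 : ℝ) (Real.pi / 3),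
      HasDerivAt Q (-(2 * (l * (l + 1)) * Real.sin θ / Real.cos θ ^ 3)) θ := by
    intro θ hθ
    have hc := (hcos θ hθ).ne'
    refine ((((Real.hasDerivAt_cos θ).pow 2).inv (pow_ne_zero 2 hc)).const_mul
      ((l : ℝ) * (l + 1))).const_sub ((2 * (n : ℝ) + l + 2) ^ 2) |>.congr_deriv ?_
    simp only [Pi.pow_apply]
    rw [show 2 - 1 = 1 from rfl, pow_one]
    field_simp
    push_cast
    ring
  have hHd : ∀ θ ∈ Set.Icc (0 : ℝ) (Real.pi / 3), HasDerivAt H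
      (-(2 * (l * (l + 1)) * Real.sin θ / Real.cos θ ^ 3) * angleFun n l θ ^ 2) θ := by
    intro θ hθ
    refine (((hasDerivAt_angleFunDeriv n l (hcos θ hθ).ne').pow 2).add
      ((hQd θ hθ).mul ((hasDerivAt_angleFun n l θ).pow 2))).congr_deriv ?_
    simp only [Pi.pow_apply, hQ]
    ring
  have hanti : AntitoneOn H (Set.Icc 0 (Real.pi / 3)) := by
    refine antitoneOn_of_deriv_nonpos (convex_Icc _ _)
      (fun θ hθ => (hHd θ hθ).continuousAt.continuousWithinAt)
      (fun θ hθ => (hHd θ (interior_subset hθ)).differentiableAt.differentiableWithinAt) ?_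
    intro θ hθ
    have hθ' := interior_subset hθ
    rw [(hHd θ hθ').deriv]
    have h1 : 0 ≤ Real.sin θ :=
      Real.sin_nonneg_of_nonneg_of_le_pi hθ'.1 (by linarith [hθ'.2, Real.pi_pos])
    have h2 := hcos θ hθ'
    have h3 : 0 ≤ 2 * (l * (l + 1)) * Real.sin θ / Real.cos θ ^ 3 * angleFun n l θ ^ 2 := by
      positivity
    linarith
  have hpi : (0 : ℝ) ≤ Real.pi / 3 := by positivity
  have h := hanti (Set.left_mem_Icc.mpr hpi) (Set.right_mem_Icc.mpr hpi) hpi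
  simp only [hH, hQ, angleFun_zero, angleFunDeriv_zero] at h
  rw [angleFun_eq n l (Real.pi / 3), Real.cos_pi_div_three, mul_pow, mul_pow, Real.sin_pi_div_three,
    div_pow (√3), Real.sq_sqrt (by norm_num)] at h
  norm_num at h
  linarith [sq_nonneg (angleFunDeriv n l (Real.pi / 3))]

/-- The threshold `64/3` makes the coefficient in the energy estimate at least `4`. -/
lemma abs_corrEig_three_half_le_of_energy {n l : ℕ}
    (h : (64 : ℝ) / 3 ≤ (2 * (n : ℝ) + l + 2) ^ 2 - 4 * (l * (l + 1))) :
    |corrEig 3 (1 / 2) n l| ≤ 1 / 2 := by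
  have h1 := corrEig_three_half_energy n l
  refine abs_le_of_sq_le_sq' ?_ (by norm_num) |> abs_le.mpr
  nlinarith [sq_nonneg (corrEig 3 (1 / 2) n l)]

/-- Induction on `n + l`. The energy estimate covers `l = 0`, `n ≥ 2` and `1 ≤ l ≤ 2n - 2`; the case
`n = 1`, `l = 0` is an equality. For larger `l` the recursion expresses the eigenvalue through two
with smaller `n + l`, and with indices `(n + 1, l + 1)` the constants close exactly when `2n ≤ l`.
-/
lemma abs_corrEig_three_half_le : ∀ d n l : ℕ, n + l = d → 1 ≤ 2 * n + l →
    |corrEig 3 (1 / 2) n l| ≤ 1 / 2 := by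
  intro d
  induction d with
  | zero => intro n l h h'; omega
  | succ d ih =>
    intro n l h h'
    rcases Nat.eq_zero_or_pos n with rfl | hn
    · rw [corrEig_zero_left, abs_of_nonneg (by positivity)]
      exact pow_le_of_le_one (by norm_num) (by norm_num) (by omega)
    obtain ⟨n, rfl⟩ : ∃ n', n = n' + 1 := ⟨n - 1, by omega⟩
    rcases Nat.eq_zero_or_pos l with rfl | hl
    · rcases Nat.eq_zero_or_pos n with rfl | hn'
      · simp [corrEig, Finset.sum_range_succ]
        norm_num
      · have hn1 : (1 : ℝ) ≤ n := by exact_mod_cast hn'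
        apply abs_corrEig_three_half_le_of_energy
        push_cast
        nlinarith
    · rcases lt_or_ge (l + 1) (2 * (n + 1)) with hlt | hge
      · have hl1 : (1 : ℝ) ≤ l := by exact_mod_cast hl
        have h2 : (l : ℝ) ≤ 2 * n := by exact_mod_cast (by omega : l ≤ 2 * n)
        apply abs_corrEig_three_half_le_of_energy
        push_cast
        nlinarith
      · obtain ⟨l, rfl⟩ : ∃ l', l = l' + 1 := ⟨l - 1, by omega⟩
        have hnl : 2 * (n : ℝ) ≤ l := by exact_mod_cast (by omega : 2 * n ≤ l)
        have r := corrEig_three_recursion (1 / 2) n l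
        have a := abs_le.mp (ih (n + 1) l (by omega) (by omega))
        have b := abs_le.mp (ih n (l + 1) (by omega) (by omega))
        have hn0 : (0 : ℝ) ≤ n := n.cast_nonneg
        rw [abs_le]
        have hpos : (0 : ℝ) < n + l + 3 := by positivity
        constructor
        · rw [← mul_le_mul_iff_right₀ hpos]
          nlinarith [a.1, b.2]
        · rw [← mul_le_mul_iff_right₀ hpos]
          nlinarith [a.2, b.1]

end EigenvalueBounds

/-! ### Averaging: eigenvalues for general `m` from those for `m = 3` -/

section Mixture

/-- The moments `∏ (3 + 2 i) / (m + 2 i)` of the squared length of a three dimensional projection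
of a uniform unit vector of `ℝ^m`. -/
def momentRatio (m : ℝ) (j : ℕ) : ℝ := ∏ i ∈ Finset.range j, ((3 + 2 * (i : ℝ)) / (m + 2 * i))

/-- The moment sequence `momentRatio m` is positive on `[0, 1]`. -/
lemma abs_sum_mul_momentRatio_le {m : ℕ} (hm : 3 < m) {a b : ℕ} {c d : ℕ → ℝ}
    (h : ∀ r ∈ Set.Icc (0 : ℝ) 1,
      |∑ j ∈ Finset.range a, c j * r ^ j| ≤ ∑ j ∈ Finset.range b, d j * r ^ j) :
    |∑ j ∈ Finset.range a, c j * momentRatio m j| ≤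
      ∑ j ∈ Finset.range b, d j * momentRatio m j := by
  classical
  let E := EuclideanSpace ℝ (Fin m)
  let γ : Fin 3 → E := fun i => EuclideanSpace.single (Fin.castLE hm.le i) 1
  have hγ : Orthonormal ℝ γ :=
    EuclideanSpace.orthonormal_single.comp _ (Fin.castLE_injective hm.le)
  have hE : finrank ℝ E = m := by simp [E]
  have hE3 : 3 < finrank ℝ E := by omega
  have : Nontrivial E := (finrank_pos_iff (R := ℝ)).mp (by omega)
  obtain ⟨μ, _⟩ : ∃ μ : Measure E, μ.IsAddHaarMeasure :=
    ⟨(stdOrthonormalBasis ℝ E).toBasis.addHaar, inferInstance⟩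
  have hpos : 0 < moment μ γ 1 := by
    refine lt_of_le_of_ne ?_ fun h0 => one_ne_zero
      (eq_zero_of_moment_mul_self μ hE3 hγ (p := 1) (by rw [mul_one]; exact h0.symm))
    simpa using moment_mul_self_nonneg μ γ 1
  have hmom : ∀ j, moment μ γ (normSqPoly ^ j) = moment μ γ 1 * momentRatio m j := by
    intro j
    induction j with
    | zero => simp [momentRatio]
    | succ j ih =>
      -- With `g = |x|^{2j}` the recursion at exponent zero relates consecutive moments of `|x|²`.
      have h1 := moment_one_sub_normSq_pow μ hγ (isHomogeneous_normSqPoly_pow j) 0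
      rw [zero_add, pow_one, pow_zero, mul_one, mul_sub, mul_one, ← pow_succ, map_sub, hE] at h1
      push_cast at h1
      have hm0 : (0 : ℝ) < m + 2 * j := by
        have : (0 : ℝ) < m := by exact_mod_cast (by omega : 0 < m)
        positivity
      rw [momentRatio, Finset.prod_range_succ, ← mul_assoc, ← momentRatio, ← ih]
      field_simp
      linarith
  have hsum : ∀ (k : ℕ) (e : ℕ → ℝ), moment μ γ (∑ j ∈ Finset.range k, e j • normSqPoly ^ j) =
      moment μ γ 1 * ∑ j ∈ Finset.range k, e j * momentRatio m j := by
    intro k e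
    rw [map_sum, Finset.mul_sum]
    refine Finset.sum_congr rfl fun j _ => ?_
    rw [map_smul, hmom, smul_eq_mul]
    ring
  have key : |moment μ γ (∑ j ∈ Finset.range a, c j • normSqPoly ^ j)| ≤
      moment μ γ (∑ j ∈ Finset.range b, d j • normSqPoly ^ j) := by
    rw [moment_apply, moment_apply, sphereInt, sphereInt]
    refine (abs_integral_le_integral_abs).trans (integral_mono
      (integrable_sphere (continuous_polyFun γ _)).abs
      (integrable_sphere (continuous_polyFun γ _)) fun ω => ?_)
    have hω : ‖(ω : E)‖ = 1 := mem_sphere_zero_iff_norm.mp ω.2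
    have hr : polyFun γ normSqPoly ω ∈ Set.Icc (0 : ℝ) 1 := by
      rw [polyFun_normSqPoly]
      refine ⟨Finset.sum_nonneg fun i _ => sq_nonneg _, ?_⟩
      have := hγ.sum_inner_products_le (s := Finset.univ) (ω : E)
      rw [hω] at this
      simpa using this
    have := h _ hr
    simpa only [polyFun_sum, polyFun_smul, polyFun_pow] using this
  rw [hsum, hsum, abs_mul, abs_of_pos hpos] at key
  exact le_of_mul_le_mul_left key hpos

lemma corrEig_eq_sum_momentRatio (m t : ℝ) (n l : ℕ) : corrEig m t n l =
    ∑ j ∈ Finset.range (n + 1),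
      corrCoeff n l j * (t ^ (2 * (n - j) + l) * (1 - t ^ 2) ^ j) * momentRatio m j := by
  rw [corrEig]
  refine Finset.sum_congr rfl fun j _ => ?_
  have : ∏ i ∈ Finset.range j, ((2 * (n : ℝ) + 2 * l + 1 - 2 * i) / (m + 2 * i)) =
      (∏ i ∈ Finset.range j, ((2 * (n : ℝ) + 2 * l + 1 - 2 * i) / (3 + 2 * i))) *
        momentRatio m j := by
    rw [momentRatio, ← Finset.prod_mul_distrib]
    refine Finset.prod_congr rfl fun i _ => ?_
    have : (3 : ℝ) + 2 * i ≠ 0 := by positivity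
    rw [div_mul_div_cancel₀ this]
  rw [this, corrCoeff]
  ring

/-- With `τ² = t² + (1 - t²) r`, `corrEig m t n l` is the mean of `τ^(2n+l) corrEig 3 (t / τ) n l`,
where `r` has moments `momentRatio m`. As `τ ≥ |t|`, the three-dimensional eigenvalue is at most `1`
in absolute value, and `τ ≤ 1` lets `τ^(2n+l)` be replaced by `τ^(2k)`, whose mean is the right
side. -/
lemma abs_corrEig_le_mixture {m : ℕ} (hm : 3 < m) {t : ℝ} (ht0 : t ≠ 0) (ht : t ^ 2 ≤ 1) {n l k : ℕ}
    (hk : 2 * k ≤ 2 * n + l) {q : Poly} (hq0 : q ≠ 0) (hq : q.IsHomogeneous (2 * n + l))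
    (hqe : radialLap q = radialEig (2 * n + l) n • q) :
    |corrEig m t n l| ≤ ∑ i ∈ Finset.range (k + 1),
      ((t ^ 2) ^ (k - i) * (1 - t ^ 2) ^ i * k.choose i) * momentRatio m i := by
  rw [corrEig_eq_sum_momentRatio]
  refine abs_sum_mul_momentRatio_le hm fun r hr => ?_
  set τ := √(t ^ 2 + (1 - t ^ 2) * r) with hτ
  have ht2 : 0 < t ^ 2 := by positivity
  have hp : 0 ≤ (1 - t ^ 2) * r := mul_nonneg (by linarith) hr.1
  have hτ2 : τ ^ 2 = t ^ 2 + (1 - t ^ 2) * r := Real.sq_sqrt (by linarith)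
  have hτ0 : 0 < τ := Real.sqrt_pos.mpr (by linarith)
  have hτ1 : τ ≤ 1 := Real.sqrt_le_one.mpr (by nlinarith [hr.2])
  have e1 : ∑ j ∈ Finset.range (n + 1),
      corrCoeff n l j * (t ^ (2 * (n - j) + l) * (1 - t ^ 2) ^ j) * r ^ j =
      τ ^ (2 * n + l) * corrEig 3 (t / τ) n l := by
    rw [corrEig_three, Finset.mul_sum]
    refine Finset.sum_congr rfl fun j hj => ?_
    have hj' : j ≤ n := by rw [Finset.mem_range] at hj; omega
    have h1 : 1 - (t / τ) ^ 2 = (1 - t ^ 2) * r / τ ^ 2 := by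
      rw [div_pow, eq_div_iff (by positivity)]
      field_simp
      linarith
    rw [h1, show 2 * n + l = (2 * (n - j) + l) + 2 * j by omega, pow_add τ, pow_mul τ 2 j, div_pow,
      div_pow, mul_pow]
    field_simp
  have e2 : ∑ i ∈ Finset.range (k + 1), ((t ^ 2) ^ (k - i) * (1 - t ^ 2) ^ i * k.choose i) * r ^ i =
      (τ ^ 2) ^ k := by
    rw [hτ2, add_comm (t ^ 2), add_pow]
    refine Finset.sum_congr rfl fun i _ => ?_
    rw [mul_pow]
    ring
  rw [e1, e2, abs_mul, abs_of_pos (by positivity)]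
  have h3 : (t / τ) ^ 2 ≤ 1 := by
    rw [div_pow, div_le_one (by positivity)]
    linarith
  calc τ ^ (2 * n + l) * |corrEig 3 (t / τ) n l| ≤ τ ^ (2 * n + l) * 1 :=
        mul_le_mul_of_nonneg_left (abs_corrEig_three_le_one h3 hq0 hq hqe) (by positivity)
    _ ≤ (τ ^ 2) ^ k := by
        rw [mul_one, ← pow_mul]
        exact pow_le_pow_of_le_one hτ0.le hτ1 hk

end Mixture

/-! ### The largest nontrivial eigenvalue of the correlation operator -/

section UpperBound

/-- The largest nontrivial eigenvalue of the correlation operator, in terms of `x = N - 1`. -/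
def topCorr (x : ℝ) : ℝ := (5 * x + 2) / (3 * x ^ 3)

/-- For `n = 0` the eigenvalue is `t ^ l`: negative for `l = 1`, and at most `1 / x²` otherwise. -/
lemma corrEig_zero_le {x : ℝ} (hx : 2 ≤ x) {l : ℕ} (hl : 1 ≤ l) (m : ℝ) :
    corrEig m (-(1 / x)) 0 l ≤ topCorr x := by
  have hx0 : 0 < x := by linarith
  have hk : 0 ≤ topCorr x := by unfold topCorr; positivity
  rw [corrEig_zero_left]
  rcases Nat.lt_or_ge l 2 with h | h
  · obtain rfl : l = 1 := by omega
    have : 0 < 1 / x := by positivity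
    linarith
  · refine (le_abs_self _).trans ?_
    rw [abs_pow, abs_neg, abs_of_pos (by positivity)]
    refine (pow_le_pow_of_le_one (by positivity) ?_ h).trans ?_
    · rw [div_le_one hx0]; linarith
    · rw [topCorr, one_div, inv_pow, ← one_div, div_le_div_iff₀ (by positivity) (by positivity)]
      nlinarith [mul_pos (pow_pos hx0 2) hx0, pow_pos hx0 2]

lemma corrEig_one_one {x : ℝ} (hx : 2 ≤ x) :
    corrEig (3 * (x - 1)) (-(1 / x)) 1 1 = topCorr x := by
  have h1 : x - 1 ≠ 0 := by linarith
  have h2 : x ≠ 0 := by linarith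
  simp only [corrEig, topCorr, Finset.sum_range_succ, Finset.prod_range_succ, Finset.sum_range_zero,
    Finset.prod_range_zero]
  norm_num
  field_simp
  ring

/-- The pair `(1, 1)` gives equality. In the other cases the substitution `x = y + 3` leaves, after
clearing denominators, a difference with nonnegative coefficients in `y`. -/
lemma corrEig_small_le {x : ℝ} (hx : 3 ≤ x) {n l : ℕ} (hn : 1 ≤ n) (h : 2 * n + l ≤ 5) :
    corrEig (3 * (x - 1)) (-(1 / x)) n l ≤ topCorr x := by
  have h1 : 0 < x - 1 := by linarith
  have h2 : 0 < x := by linarith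
  have h3 : 0 < 3 * x - 1 := by linarith
  obtain ⟨y, hy, rfl⟩ : ∃ y : ℝ, 0 ≤ y ∧ x = y + 3 := ⟨x - 3, by linarith, by ring⟩
  have h4 : 3 * (y + 3 - 1) + 2 = 3 * (y + 3) - 1 := by ring
  have hcase : (n = 1 ∧ l = 0) ∨ (n = 1 ∧ l = 1) ∨ (n = 1 ∧ l = 2) ∨ (n = 1 ∧ l = 3) ∨
    (n = 2 ∧ l = 0) ∨ (n = 2 ∧ l = 1) := by omega
  rcases hcase with ⟨rfl, rfl⟩ | ⟨rfl, rfl⟩ | ⟨rfl, rfl⟩ | ⟨rfl, rfl⟩ | ⟨rfl, rfl⟩ | ⟨rfl, rfl⟩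
  pick_goal 2
  · exact (corrEig_one_one (by linarith)).le
  all_goals
    rw [← sub_nonneg]
    simp only [corrEig, topCorr, Finset.sum_range_succ, Finset.prod_range_succ,
      Finset.sum_range_zero, Finset.prod_range_zero]
    norm_num [h4, Nat.choose]
    field_simp
    rw [← sub_nonneg]
    ring_nf
    positivity

lemma corrEig_four_small_le {n l : ℕ} (hn : 1 ≤ n) (h6 : 6 ≤ 2 * n + l) (h : 2 * n + l ≤ 7) :
    corrEig 6 (-(1 / 3)) n l ≤ topCorr 3 := by
  have hcase : (n = 1 ∧ l = 4) ∨ (n = 1 ∧ l = 5) ∨ (n = 2 ∧ l = 2) ∨ (n = 2 ∧ l = 3) ∨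
    (n = 3 ∧ l = 0) ∨ (n = 3 ∧ l = 1) := by omega
  rcases hcase with ⟨rfl, rfl⟩ | ⟨rfl, rfl⟩ | ⟨rfl, rfl⟩ | ⟨rfl, rfl⟩ | ⟨rfl, rfl⟩ | ⟨rfl, rfl⟩
  all_goals
    simp only [corrEig, topCorr, Finset.sum_range_succ, Finset.prod_range_succ,
      Finset.sum_range_zero, Finset.prod_range_zero]
    norm_num [Nat.choose]

lemma corrEig_le_topCorr {N : ℕ} (hN : 3 ≤ N) {n l : ℕ} (h : 1 ≤ 2 * n + l) {q : Poly} (hq0 : q ≠ 0)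
    (hq : q.IsHomogeneous (2 * n + l)) (hqe : radialLap q = radialEig (2 * n + l) n • q) :
    corrEig (3 * (N : ℝ) - 6) (-(1 / ((N : ℝ) - 1))) n l ≤ topCorr ((N : ℝ) - 1) := by
  rcases Nat.eq_zero_or_pos n with rfl | hn
  · refine corrEig_zero_le ?_ (by omega) _
    have : (3 : ℝ) ≤ N := by exact_mod_cast hN
    linarith
  have hm : 3 * (N : ℝ) - 6 = ((3 * N - 6 : ℕ) : ℝ) := by
    rw [Nat.cast_sub (by omega)]
    push_cast
    ring
  rcases lt_trichotomy N 4 with h3 | rfl | h5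
  · obtain rfl : N = 3 := by omega
    have e : topCorr ((3 : ℕ) - 1) = 1 / 2 := by norm_num [topCorr]
    have hb := abs_corrEig_three_half_le _ n l rfl h
    rw [e, corrEig_neg]
    norm_num at hb ⊢
    refine (le_abs_self _).trans ?_
    rwa [abs_mul, abs_pow, abs_neg, abs_one, one_pow, one_mul]
  -- For `N = 4` the mixture bound with `k = 3` is `185/729`, above `topCorr 3 = 17/81`. Degrees 6
  -- and 7 are therefore computed, and `k = 4` serves from degree 8 on; for `N ≥ 5`, `k = 3`
  -- suffices from degree 6 on.
  · rcases le_or_gt (2 * n + l) 5 with hs | hs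
    · convert corrEig_small_le (x := 3) le_rfl hn hs using 2 <;> norm_num
    rcases le_or_gt (2 * n + l) 7 with hs' | hs'
    · convert corrEig_four_small_le hn hs hs' using 2 <;> norm_num
    · rw [hm]
      refine (le_abs_self _).trans ((abs_corrEig_le_mixture (k := 4) (by norm_num) (by norm_num)
        (by norm_num) hs' hq0 hq hqe).trans ?_)
      simp only [momentRatio, topCorr, Finset.sum_range_succ, Finset.prod_range_succ,
        Finset.sum_range_zero, Finset.prod_range_zero]
      norm_num [Nat.choose]
  · have hN4 : (5 : ℝ) ≤ N := by exact_mod_cast h5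
    rcases le_or_gt (2 * n + l) 5 with hs | hs
    · convert corrEig_small_le (x := (N : ℝ) - 1) (by linarith) hn hs using 2
      ring
    · have ht : (-(1 / ((N : ℝ) - 1))) ^ 2 ≤ 1 := by
        rw [neg_sq, div_pow, one_pow, div_le_one (by nlinarith)]
        nlinarith
      have ht0 : -(1 / ((N : ℝ) - 1)) ≠ 0 := by
        rw [neg_ne_zero]
        exact (one_div_pos.mpr (by linarith)).ne'
      rw [hm]
      refine (le_abs_self _).trans ((abs_corrEig_le_mixture (k := 3) (by omega) ht0 ht hs hq0 hq
        hqe).trans ?_)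
      rw [← hm]
      obtain ⟨y, hy, hxy⟩ : ∃ y : ℝ, 0 ≤ y ∧ (N : ℝ) = y + 5 := ⟨N - 5, by linarith, by ring⟩
      rw [hxy]
      have e1 : 3 * (y + 5) - 6 = 3 * (y + 3) := by ring
      have e2 : y + 5 - 1 = y + 4 := by ring
      have e3 : 3 * (y + 3) + 2 = 3 * y + 11 := by ring
      have e4 : 3 * (y + 3) + 2 * 2 = 3 * y + 13 := by ring
      rw [← sub_nonneg, e1, e2]
      simp only [momentRatio, topCorr, Finset.sum_range_succ, Finset.prod_range_succ,
        Finset.sum_range_zero, Finset.prod_range_zero]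
      norm_num [Nat.choose, e3, e4]
      field_simp
      rw [← sub_nonneg]
      ring_nf
      positivity

end UpperBound

/-! ### The state space as a sphere, and the triples attached to the particles -/

section Configurations

variable {N : ℕ}

lemma mem_zeroMomentum {v : Conf N} : v ∈ zeroMomentum N ↔ ∑ j, v j = 0 := Iff.rfl

lemma finrank_zeroMomentum (hN : 1 ≤ N) : finrank ℝ (zeroMomentum N) = 3 * N - 3 := by
  classical
  let S : Conf N →ₗ[ℝ] EuclideanSpace ℝ (Fin 3) :=
    { toFun := fun v => ∑ j, v j
      map_add' := fun v w => by simp [Finset.sum_add_distrib]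
      map_smul' := fun c v => by simp [Finset.smul_sum] }
  have hker : LinearMap.ker S = zeroMomentum N := by
    ext v
    exact LinearMap.mem_ker
  have hsurj : LinearMap.range S = ⊤ := by
    rw [LinearMap.range_eq_top]
    intro w
    refine ⟨WithLp.toLp 2 fun j => if j = ⟨0, hN⟩ then w else 0, ?_⟩
    change ∑ j, (if j = (⟨0, hN⟩ : Fin N) then w else 0) = w
    simp
  have h := S.finrank_range_add_finrank_ker
  rw [hker, hsurj, finrank_top, finrank_euclideanSpace, Fintype.card_fin,
    (WithLp.linearEquiv 2 ℝ (Fin N → EuclideanSpace ℝ (Fin 3))).finrank_eq,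
    finrank_pi_fintype] at h
  simp at h
  omega

/-- The vectors `e_i` in the `k`-th slot, projected to zero total momentum and normalized. -/
def partVec (k : Fin N) (i : Fin 3) : zeroMomentum N :=
  ⟨WithLp.toLp 2 fun j => (√((N : ℝ) / ((N : ℝ) - 1)) * ((if j = k then 1 else 0) - 1 / (N : ℝ))) •
    EuclideanSpace.single i (1 : ℝ), by
    rw [mem_zeroMomentum]
    have hN : (N : ℝ) ≠ 0 := by
      have := k.pos
      positivity
    simp only [← Finset.sum_smul, ← Finset.mul_sum, Finset.sum_sub_distrib]
    simp [hN]⟩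

lemma partVec_apply (k j : Fin N) (i a : Fin 3) : (partVec k i : Conf N) j a =
    √((N : ℝ) / ((N : ℝ) - 1)) * ((if j = k then 1 else 0) - 1 / (N : ℝ)) *
      (if a = i then 1 else 0) := by
  simp [partVec]

/-- The component `-1/N` shared by all slots pairs to zero with a configuration of zero total
momentum. -/
lemma inner_partVec (k : Fin N) (i : Fin 3) (u : zeroMomentum N) :
    inner ℝ (partVec k i) u = √((N : ℝ) / ((N : ℝ) - 1)) * (u : Conf N) k i := by
  rw [Submodule.coe_inner, PiLp.inner_apply]
  have h0 : ∑ j, (u : Conf N) j i = 0 := by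
    have := congrArg (fun w : EuclideanSpace ℝ (Fin 3) => w i) (mem_zeroMomentum.mp u.2)
    simpa using this
  have h1 : ∀ j, inner ℝ ((partVec k i : Conf N) j) ((u : Conf N) j) =
      √((N : ℝ) / ((N : ℝ) - 1)) * ((if j = k then (u : Conf N) j i else 0) -
        1 / (N : ℝ) * (u : Conf N) j i) := by
    intro j
    change inner ℝ ((_ : ℝ) • EuclideanSpace.single i (1 : ℝ)) _ = _
    rw [real_inner_smul_left, EuclideanSpace.inner_single_left]
    split_ifs <;> simp <;> ring
  simp only [h1, ← Finset.mul_sum, Finset.sum_sub_distrib, h0]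
  simp

lemma inner_partVec_partVec (hN : 2 ≤ N) (k l : Fin N) (i j : Fin 3) :
    inner ℝ (partVec k i) (partVec l j) =
      (if k = l then 1 else -(1 / ((N : ℝ) - 1))) * (if i = j then 1 else 0) := by
  have hN' : (2 : ℝ) ≤ N := by exact_mod_cast hN
  have h1 : (N : ℝ) - 1 ≠ 0 := by linarith
  have hs : √((N : ℝ) / ((N : ℝ) - 1)) * √((N : ℝ) / ((N : ℝ) - 1)) = (N : ℝ) / ((N : ℝ) - 1) :=
    Real.mul_self_sqrt (div_nonneg (by linarith) (by linarith))
  rw [inner_partVec, partVec_apply, ← mul_assoc, ← mul_assoc, hs]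
  congr 1
  split_ifs
  · field_simp
  · field_simp
    ring

lemma orthonormal_partVec (hN : 2 ≤ N) (k : Fin N) : Orthonormal ℝ (partVec k) := by
  rw [orthonormal_iff_ite]
  intro i j
  rw [inner_partVec_partVec hN]
  simp

lemma inner_partVec_of_ne (hN : 2 ≤ N) {k l : Fin N} (hkl : k ≠ l) (i j : Fin 3) :
    inner ℝ (partVec k i) (partVec l j) = if i = j then -(1 / ((N : ℝ) - 1)) else 0 := by
  rw [inner_partVec_partVec hN, if_neg hkl]
  split_ifs <;> simp

instance : (lebesgueZeroMomentum N).IsAddHaarMeasure := by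
  unfold lebesgueZeroMomentum
  infer_instance

lemma measurable_scaleMap : Measurable (scaleMap N) := by
  have : Continuous (scaleMap N) := by
    have h : Continuous fun u : sphere (0 : zeroMomentum N) 1 => √(N : ℝ) • (u.1 : Conf N) := by
      fun_prop
    exact h.subtype_mk _
  exact this.measurable

lemma nontrivial_zeroMomentum (hN : 3 ≤ N) : Nontrivial (zeroMomentum N) := by
  apply (finrank_pos_iff (R := ℝ)).mp
  rw [finrank_zeroMomentum (by omega)]
  omega

lemma toSphere_univ_ne_zero (hN : 3 ≤ N) : (lebesgueZeroMomentum N).toSphere Set.univ ≠ 0 := by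
  have := nontrivial_zeroMomentum hN
  rw [Measure.toSphere_apply_univ]
  refine mul_ne_zero ?_ (measure_ball_pos _ _ one_pos).ne'
  rw [finrank_zeroMomentum (by omega)]
  exact_mod_cast (by omega : 3 * N - 3 ≠ 0)

lemma isProbabilityMeasure_sigma (hN : 3 ≤ N) : IsProbabilityMeasure (sigma N) := by
  have : IsProbabilityMeasure (((lebesgueZeroMomentum N).toSphere Set.univ)⁻¹ •
      (lebesgueZeroMomentum N).toSphere) := by
    refine ⟨?_⟩
    rw [Measure.smul_apply, smul_eq_mul]
    exact ENNReal.inv_mul_cancel (toSphere_univ_ne_zero hN) (measure_ne_top _ _)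
  exact Measure.isProbabilityMeasure_map measurable_scaleMap.aemeasurable

/-- The normalizing constant of `sigma`. -/
def sphereConst (N : ℕ) : ℝ := (((lebesgueZeroMomentum N).toSphere Set.univ)⁻¹).toReal

lemma sphereConst_pos (hN : 3 ≤ N) : 0 < sphereConst N :=
  ENNReal.toReal_pos (ENNReal.inv_ne_zero.mpr (measure_ne_top _ _))
    (ENNReal.inv_ne_top.mpr (toSphere_univ_ne_zero hN))

lemma integral_sigma {f : stateSpace N → ℝ} (hf : Measurable f) :
    ∫ v, f v ∂sigma N =
      sphereConst N * ∫ u, f (scaleMap N u) ∂(lebesgueZeroMomentum N).toSphere := by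
  rw [sigma, integral_map measurable_scaleMap.aemeasurable hf.aestronglyMeasurable,
    integral_smul_measure, sphereConst, smul_eq_mul]

/-- The function `v ↦ p (v_k / √(N - 1))`. -/
def velPoly (k : Fin N) (p : Poly) (v : stateSpace N) : ℝ :=
  eval (fun i => velocity k v i / √((N : ℝ) - 1)) p

lemma continuous_velPoly (k : Fin N) (p : Poly) : Continuous (velPoly k p) := by
  unfold velPoly velocity
  have : Continuous fun v : stateSpace N => fun i => (v.1 k) i / √((N : ℝ) - 1) := by fun_prop
  exact (MvPolynomial.continuous_eval p).comp this

/-- The radius `√N` of the state space and the normalization `√(N / (N - 1))` of `partVec` combine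
to the scale `√(N - 1)`. -/
lemma velPoly_scaleMap (hN : 2 ≤ N) (k : Fin N) (p : Poly) (u : sphere (0 : zeroMomentum N) 1) :
    velPoly k p (scaleMap N u) = polyFun (partVec k) p u := by
  rw [velPoly, polyFun]
  congr 2
  funext i
  have hN' : (2 : ℝ) ≤ N := by exact_mod_cast hN
  rw [coords, inner_partVec, Real.sqrt_div (by linarith)]
  change (√(N : ℝ) • ((u : zeroMomentum N) : Conf N)) k i / _ = _
  simp
  ring

end Configurations

/-! ### Functions of one velocity in `L²` and their inner products -/

section VelocityFunctions

variable {N : ℕ}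

instance : IsFiniteMeasure (sigma N) := by
  have : IsFiniteMeasure (((lebesgueZeroMomentum N).toSphere Set.univ)⁻¹ •
      (lebesgueZeroMomentum N).toSphere) := by
    refine ⟨?_⟩
    rw [Measure.smul_apply, smul_eq_mul]
    -- This covers every `N`: should the total mass vanish, then `∞ * 0 = 0`.
    exact (ENNReal.inv_mul_le_one _).trans_lt ENNReal.one_lt_top
  unfold sigma
  infer_instance

lemma norm_sq_of_mem_stateSpace {v : Conf N} (hv : v ∈ stateSpace N) : ‖v‖ ^ 2 = N := by
  have h := hv.1
  -- For `N = 0` the convention `1 / 0 = 0` contradicts the energy condition, so the state space is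
  -- empty.
  have hN : (N : ℝ) ≠ 0 := by
    rintro h0
    simp [h0] at h
  rw [PiLp.norm_sq_eq_of_L2]
  field_simp at h
  exact h

lemma isCompact_stateSpace : IsCompact (stateSpace N) := by
  refine Metric.isCompact_of_isClosed_isBounded ?_ ?_
  · exact (isClosed_eq (by fun_prop) continuous_const).inter
      (isClosed_eq (by fun_prop) continuous_const)
  · refine (Metric.isBounded_closedBall (x := (0 : Conf N)) (r := √(N : ℝ))).subset fun v hv => ?_
    rw [mem_closedBall_zero_iff, ← norm_sq_of_mem_stateSpace hv, Real.sqrt_sq (norm_nonneg v)]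

instance : CompactSpace (stateSpace N) := isCompact_iff_compactSpace.mp isCompact_stateSpace

/-- The square integrable function `v ↦ p (v_k / √(N - 1))`. -/
def velLp (k : Fin N) : Poly →ₗ[ℝ] L2 N where
  toFun p := ContinuousMap.toLp 2 (sigma N) ℝ ⟨velPoly k p, continuous_velPoly k p⟩
  map_add' p q := by
    rw [← map_add]
    congr 1
    ext v
    simp [velPoly]
  map_smul' c p := by
    rw [← map_smul]
    congr 1
    ext v
    simp [velPoly]

lemma coeFn_velLp (k : Fin N) (p : Poly) : velLp k p =ᵐ[sigma N] velPoly k p :=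
  ContinuousMap.coeFn_toLp (sigma N) _

/-- The constant function `1`. -/
def oneLp (N : ℕ) : L2 N := ContinuousMap.toLp 2 (sigma N) ℝ 1

lemma coeFn_oneLp : oneLp N =ᵐ[sigma N] fun _ => 1 := ContinuousMap.coeFn_toLp (sigma N) _

lemma velLp_one (k : Fin N) : velLp k 1 = oneLp N := by
  change ContinuousMap.toLp 2 (sigma N) ℝ _ = ContinuousMap.toLp 2 (sigma N) ℝ 1
  congr 1
  ext v
  simp [velPoly]

lemma inner_oneLp (f : L2 N) : inner ℝ (oneLp N) f = ∫ v, f v ∂sigma N := by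
  rw [L2.inner_def]
  refine integral_congr_ae ?_
  filter_upwards [coeFn_oneLp (N := N)] with v hv
  rw [hv]
  simp

lemma norm_oneLp (hN : 3 ≤ N) : ‖oneLp N‖ = 1 := by
  have := isProbabilityMeasure_sigma hN
  have h : ‖oneLp N‖ ^ 2 = 1 := by
    rw [← real_inner_self_eq_norm_sq, inner_oneLp, integral_congr_ae coeFn_oneLp]
    simp
  nlinarith [norm_nonneg (oneLp N)]

lemma inner_velLp_velLp (hN : 2 ≤ N) (k l : Fin N) (p q : Poly) :
    inner ℝ (velLp k p) (velLp l q) = sphereConst N * sphereInt (lebesgueZeroMomentum N)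
      (fun x => polyFun (partVec k) p x * polyFun (partVec l) q x) := by
  rw [L2.inner_def]
  have h : ∫ v, inner ℝ (velLp k p v) (velLp l q v) ∂sigma N =
      ∫ v, velPoly k p v * velPoly l q v ∂sigma N := by
    refine integral_congr_ae ?_
    filter_upwards [coeFn_velLp k p, coeFn_velLp l q] with v h1 h2
    rw [h1, h2]
    simp [mul_comm]
  rw [h, integral_sigma (f := fun v => velPoly k p v * velPoly l q v)
    ((continuous_velPoly k p).mul (continuous_velPoly l q)).measurable, sphereInt]
  simp only [velPoly_scaleMap hN]

/-- The integral of a polynomial in one rescaled velocity. -/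
def velMoment (N : ℕ) (k : Fin N) : Poly →ₗ[ℝ] ℝ :=
  sphereConst N • moment (lebesgueZeroMomentum N) (partVec k)

lemma velMoment_apply (k : Fin N) (p : Poly) : velMoment N k p =
    sphereConst N * moment (lebesgueZeroMomentum N) (partVec k) p := rfl

lemma inner_velLp_same (hN : 2 ≤ N) (k : Fin N) (p q : Poly) :
    inner ℝ (velLp k p) (velLp k q) = velMoment N k (p * q) := by
  rw [inner_velLp_velLp hN, velMoment_apply, moment_apply]
  congr 2
  funext x
  rw [polyFun_mul]

/-- The correlation operator between the velocities of two particles. -/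
def velCorr (N D : ℕ) : Module.End ℝ Poly :=
  corrOp (3 * (N : ℝ) - 6) (-(1 / ((N : ℝ) - 1))) D

lemma three_lt_finrank (hN : 3 ≤ N) : 3 < finrank ℝ (zeroMomentum N) := by
  rw [finrank_zeroMomentum (by omega)]
  omega

lemma velCorr_eq (hN : 3 ≤ N) (D : ℕ) : velCorr N D =
    corrOp ((finrank ℝ (zeroMomentum N) : ℝ) - 3) (-(1 / ((N : ℝ) - 1))) D := by
  rw [velCorr, finrank_zeroMomentum (by omega), Nat.cast_sub (by omega)]
  push_cast
  congr 1
  ring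

lemma inner_velLp_of_ne (hN : 3 ≤ N) {k l : Fin N} (hkl : k ≠ l) (p : Poly) {q : Poly} {D : ℕ}
    (hq : q.totalDegree ≤ D) :
    inner ℝ (velLp k p) (velLp l q) = velMoment N k (p * velCorr N D q) := by
  have := nontrivial_zeroMomentum hN
  rw [inner_velLp_velLp (by omega), velMoment_apply, velCorr_eq hN,
    sphereInt_polyFun_mul (lebesgueZeroMomentum N) (orthonormal_partVec (by omega) k)
    (orthonormal_partVec (by omega) l) (inner_partVec_of_ne (by omega) hkl) (three_lt_finrank hN) p hq]

lemma velMoment_eq (hN : 3 ≤ N) (k l : Fin N) : velMoment N k = velMoment N l := by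
  have := nontrivial_zeroMomentum hN
  refine LinearMap.ext fun p => ?_
  rw [velMoment_apply, velMoment_apply, moment_eq_moment (lebesgueZeroMomentum N)
    (three_lt_finrank hN) (orthonormal_partVec (by omega) k) (orthonormal_partVec (by omega) l)]

lemma velMoment_mul_velCorr_le (hN : 3 ≤ N) (k : Fin N) {p : Poly} {D : ℕ} (hp : p.totalDegree ≤ D)
    (hp0 : velMoment N k p = 0) :
    velMoment N k (p * velCorr N D p) ≤ topCorr ((N : ℝ) - 1) * velMoment N k (p * p) := by
  have := nontrivial_zeroMomentum hN
  obtain ⟨l, hl⟩ : ∃ l : Fin N, k ≠ l := by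
    have : Nontrivial (Fin N) := Fin.nontrivial_iff_two_le.mpr (by omega)
    exact (exists_ne k).imp fun _ h => h.symm
  have hc := sphereConst_pos hN
  have hp0' : moment (lebesgueZeroMomentum N) (partVec k) p = 0 := by
    rw [velMoment_apply] at hp0
    exact (mul_eq_zero.mp hp0).resolve_left hc.ne'
  have hM : ((finrank ℝ (zeroMomentum N) : ℝ) - 3) = 3 * (N : ℝ) - 6 := by
    rw [finrank_zeroMomentum (by omega), Nat.cast_sub (by omega)]
    push_cast
    ring
  have h := moment_mul_corrOp_le (lebesgueZeroMomentum N) (orthonormal_partVec (by omega) k)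
    (orthonormal_partVec (by omega) l) (inner_partVec_of_ne (by omega) hl) (three_lt_finrank hN)
    (c := topCorr ((N : ℝ) - 1)) (fun n l hnl q hq0 hq hqe => by
      rw [hM]; exact corrEig_le_topCorr hN hnl hq0 hq hqe) hp hp0'
  rw [velMoment_apply, velMoment_apply, velCorr_eq hN, mul_left_comm]
  exact mul_le_mul_of_nonneg_left h hc.le

/-- The squared norm of a sum of functions of single velocities. -/
lemma norm_sum_velLp_sq (hN : 3 ≤ N) (k₀ : Fin N) (p : Fin N → Poly) {D : ℕ}
    (hp : ∀ k, (p k).totalDegree ≤ D) :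
    ‖∑ k, velLp k (p k)‖ ^ 2 = ∑ k, velMoment N k₀ (p k * p k) +
      (velMoment N k₀ ((∑ k, p k) * velCorr N D (∑ k, p k)) -
        ∑ k, velMoment N k₀ (p k * velCorr N D (p k))) := by
  classical
  rw [← real_inner_self_eq_norm_sq, sum_inner]
  simp only [inner_sum]
  have h : ∀ k l, inner ℝ (velLp k (p k)) (velLp l (p l)) =
      velMoment N k₀ (p k * velCorr N D (p l)) + if k = l then
        velMoment N k₀ (p k * p k) - velMoment N k₀ (p k * velCorr N D (p k)) else 0 := by
    intro k l
    rw [velMoment_eq hN k₀ k]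
    split_ifs with hkl
    · subst hkl
      rw [inner_velLp_same (by omega)]
      ring
    · rw [inner_velLp_of_ne hN hkl _ (hp l), add_zero]
  simp only [h, Finset.sum_add_distrib, Finset.sum_ite_eq, Finset.mem_univ, if_true,
    Finset.sum_sub_distrib]
  rw [map_sum, Finset.sum_mul_sum, map_sum]
  simp only [map_sum]
  ring

end VelocityFunctions

/-! ### Norm of a sum of mean-zero functions of single velocities -/

section CorrelationBound

variable {N : ℕ}

lemma velMoment_mul_self_nonneg (hN : 3 ≤ N) (k : Fin N) (p : Poly) : 0 ≤ velMoment N k (p * p) := by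
  rw [← inner_velLp_same (by omega)]
  exact real_inner_self_nonneg

/-- The correlations are at least `-1 / (N - 1)`. -/
lemma neg_le_velMoment_mul_velCorr (hN : 3 ≤ N) (k : Fin N) {p : Poly} {D : ℕ}
    (hp : p.totalDegree ≤ D) :
    -(1 / ((N : ℝ) - 1)) * velMoment N k (p * p) ≤ velMoment N k (p * velCorr N D p) := by
  -- The same `p` for all particles: the squared norm is `N` times the second moment plus `N (N -
  -- 1)` times the correlation, and it is nonnegative.
  have h := norm_sum_velLp_sq hN k (fun _ => p) (fun _ => hp)
  have hN3 : (3 : ℝ) ≤ N := by exact_mod_cast hN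
  simp only [Finset.sum_const, Finset.card_univ, Fintype.card_fin, nsmul_eq_mul,
    mul_assoc] at h
  have e : ∀ q : Poly, velMoment N k ((N : Poly) * q) = N * velMoment N k q := by
    intro q
    rw [← nsmul_eq_mul, map_nsmul, nsmul_eq_mul]
  have h2 : velCorr N D ((N : Poly) * p) = (N : Poly) * velCorr N D p := by
    rw [← nsmul_eq_mul, map_nsmul, nsmul_eq_mul]
  rw [h2, mul_left_comm p, e, e] at h
  have h3 : 0 ≤ (N : ℝ) * velMoment N k (p * p) + (N * (N * velMoment N k (p * velCorr N D p)) -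
      N * velMoment N k (p * velCorr N D p)) := h ▸ sq_nonneg _
  have h4 : 0 ≤ velMoment N k (p * p) + (N - 1) * velMoment N k (p * velCorr N D p) := by
    have hN0 : (0 : ℝ) < N := by linarith
    nlinarith
  have h1 : (0 : ℝ) < N - 1 := by linarith
  rw [neg_mul, one_div_mul_eq_div, neg_le_iff_add_nonneg, ← sub_nonneg]
  have : velMoment N k (p * velCorr N D p) + velMoment N k (p * p) / ((N : ℝ) - 1) - 0 =
      (velMoment N k (p * p) + (N - 1) * velMoment N k (p * velCorr N D p)) / (N - 1) := by
    field_simp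
    ring
  rw [this]
  positivity

/-- Write `p k = r + (p k - r)` with `r` the average. On the average the form is `1 + (N - 1) K`,
bounded through the top eigenvalue; on the deviations, which sum to zero, it is `1 - K ≤ 1 + 1 / (N
- 1)`. The second bound is the smaller one (`hk`). -/
lemma norm_sum_velLp_sq_le (hN : 3 ≤ N) (p : Fin N → Poly)
    (hp : ∀ k, inner ℝ (oneLp N) (velLp k (p k)) = 0) :
    ‖∑ k, velLp k (p k)‖ ^ 2 ≤
      (1 + ((N : ℝ) - 1) * topCorr ((N : ℝ) - 1)) * ∑ k, ‖velLp k (p k)‖ ^ 2 := by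
  have hN3 : (3 : ℝ) ≤ N := by exact_mod_cast hN
  let k₀ : Fin N := ⟨0, by omega⟩
  have hp' : ∀ k, velMoment N k₀ (p k) = 0 := by
    intro k
    rw [velMoment_eq hN k₀ k, ← hp k, ← velLp_one k, inner_velLp_same (by omega), one_mul]
  set D := Finset.univ.sup fun k => (p k).totalDegree with hD
  have hpD : ∀ k, (p k).totalDegree ≤ D := fun k =>
    Finset.le_sup (f := fun k => (p k).totalDegree) (Finset.mem_univ k)
  set P := ∑ k, p k with hP
  have hPD : P.totalDegree ≤ D := totalDegree_finsetSum_le fun k _ => hpD k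
  set r : Poly := (1 / (N : ℝ)) • P with hr
  have hrD : r.totalDegree ≤ D := (totalDegree_smul_le _ _).trans hPD
  have hNr : P = (N : ℝ) • r := by
    rw [hr, smul_smul, mul_one_div_cancel (by linarith), one_smul]
  have hr0 : velMoment N k₀ r = 0 := by
    rw [hr, map_smul, hP, map_sum, Finset.sum_eq_zero fun k _ => hp' k, smul_zero]
  have split : ∀ T : Module.End ℝ Poly, ∑ k, velMoment N k₀ (p k * T (p k)) =
      ∑ k, velMoment N k₀ ((p k - r) * T (p k - r)) + N * velMoment N k₀ (r * T r) := by
    intro T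
    have h1 : ∀ k, velMoment N k₀ ((p k - r) * T (p k - r)) = velMoment N k₀ (p k * T (p k)) -
        velMoment N k₀ (p k * T r) - velMoment N k₀ (r * T (p k)) + velMoment N k₀ (r * T r) := by
      intro k
      rw [map_sub, sub_mul, mul_sub, mul_sub, map_sub, map_sub, map_sub]
      ring
    have h2 : ∑ k, velMoment N k₀ (p k * T r) = N * velMoment N k₀ (r * T r) := by
      rw [← map_sum, ← Finset.sum_mul, ← hP, hNr, smul_mul_assoc, map_smul, smul_eq_mul]
    have h3 : ∑ k, velMoment N k₀ (r * T (p k)) = N * velMoment N k₀ (r * T r) := by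
      rw [← map_sum, ← Finset.mul_sum, ← map_sum, ← hP, hNr, map_smul, mul_smul_comm, map_smul,
        smul_eq_mul]
    simp only [h1, Finset.sum_add_distrib, Finset.sum_sub_distrib, h2, h3]
    simp
  have sA := split 1
  simp only [Module.End.one_apply] at sA
  have hn : ∀ k, ‖velLp k (p k)‖ ^ 2 = velMoment N k₀ (p k * p k) := by
    intro k
    rw [← real_inner_self_eq_norm_sq, inner_velLp_same (by omega), velMoment_eq hN k₀ k]
  have hb1 := velMoment_mul_velCorr_le hN k₀ hrD hr0
  have hb2 : -(1 / ((N : ℝ) - 1)) * ∑ k, velMoment N k₀ ((p k - r) * (p k - r)) ≤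
      ∑ k, velMoment N k₀ ((p k - r) * velCorr N D (p k - r)) := by
    rw [Finset.mul_sum]
    exact Finset.sum_le_sum fun k _ => neg_le_velMoment_mul_velCorr hN k₀
      ((totalDegree_sub _ _).trans (max_le (hpD k) hrD))
  have hA : 0 ≤ ∑ k, velMoment N k₀ ((p k - r) * (p k - r)) :=
    Finset.sum_nonneg fun k _ => velMoment_mul_self_nonneg hN k₀ _
  have hk : 1 / ((N : ℝ) - 1) ≤ ((N : ℝ) - 1) * topCorr ((N : ℝ) - 1) := by
    have hx : (0 : ℝ) < N - 1 := by linarith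
    have : ((N : ℝ) - 1) * topCorr ((N : ℝ) - 1) = (5 * (N - 1) + 2) / (3 * (N - 1) ^ 2) := by
      rw [topCorr]
      field_simp
    rw [this, div_le_div_iff₀ hx (by positivity)]
    nlinarith [mul_pos hx hx]
  rw [norm_sum_velLp_sq hN k₀ p hpD]
  simp only [hn]
  have hB : velMoment N k₀ (P * velCorr N D P) = N * (N * velMoment N k₀ (r * velCorr N D r)) := by
    rw [hNr, map_smul, smul_mul_assoc, mul_smul_comm, map_smul, map_smul]
    rfl
  rw [split (velCorr N D), sA, ← hP, hB]
  have hm : (0 : ℝ) ≤ N * (N - 1) := by nlinarith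
  nlinarith [mul_le_mul_of_nonneg_left hb1 hm, mul_le_mul_of_nonneg_right hk hA]

end CorrelationBound

/-! ### Density of polynomials in the functions of one velocity -/

section Density

variable {N : ℕ}

/-- The rescaled coordinate functions on a ball of velocities. -/
def ballCoord (N : ℕ) (i : Fin 3) : C(closedBall (0 : EuclideanSpace ℝ (Fin 3)) (√(N : ℝ)), ℝ) :=
  ⟨fun w => w.1 i / √((N : ℝ) - 1), by fun_prop⟩

lemma denseRange_aeval_ballCoord (hN : 2 ≤ N) :
    DenseRange (aeval (ballCoord N) : Poly →ₐ[ℝ] _) := by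
  have hN' : (2 : ℝ) ≤ N := by exact_mod_cast hN
  have h := ContinuousMap.subalgebra_topologicalClosure_eq_top_of_separatesPoints
    (aeval (ballCoord N) : Poly →ₐ[ℝ] _).range ?_
  · have h' := congrArg (fun A : Subalgebra ℝ
      C(closedBall (0 : EuclideanSpace ℝ (Fin 3)) (√(N : ℝ)), ℝ) => (A : Set
      C(closedBall (0 : EuclideanSpace ℝ (Fin 3)) (√(N : ℝ)), ℝ))) h
    simp only [Subalgebra.topologicalClosure_coe, AlgHom.coe_range, Algebra.coe_top] at h'
    rw [DenseRange, dense_iff_closure_eq, h']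
  · intro x y hxy
    obtain ⟨i, hi⟩ : ∃ i, x.1 i ≠ y.1 i := by
      by_contra! hc
      exact hxy (Subtype.ext (PiLp.ext hc))
    refine ⟨ballCoord N i, ⟨ballCoord N i, ⟨X i, aeval_X _ _⟩, rfl⟩, ?_⟩
    have hs : √((N : ℝ) - 1) ≠ 0 := (Real.sqrt_pos.mpr (by linarith)).ne'
    change x.1 i / √((N : ℝ) - 1) ≠ y.1 i / √((N : ℝ) - 1)
    rwa [Ne, div_left_inj' hs]

lemma norm_velocity_le (k : Fin N) (v : stateSpace N) : ‖velocity k v‖ ≤ √(N : ℝ) := by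
  rw [← norm_sq_of_mem_stateSpace v.2, Real.sqrt_sq (norm_nonneg _)]
  exact PiLp.norm_apply_le _ k

/-- The velocity as a point of a ball. -/
def velocityBall (k : Fin N) (v : stateSpace N) :
    closedBall (0 : EuclideanSpace ℝ (Fin 3)) (√(N : ℝ)) :=
  ⟨velocity k v, mem_closedBall_zero_iff.mpr (norm_velocity_le k v)⟩

lemma measurable_velocityBall (k : Fin N) : Measurable (velocityBall k) :=
  (measurable_velocity k).subtype_mk

lemma aeval_ballCoord_velocityBall (k : Fin N) (p : Poly) (v : stateSpace N) :
    aeval (ballCoord N) p (velocityBall k v) = velPoly k p v := by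
  rw [velPoly]
  induction p using MvPolynomial.induction_on with
  | C a => simp
  | add p q hp hq => simp [hp, hq]
  | mul_X p i hp =>
    rw [map_mul, ContinuousMap.mul_apply, hp, aeval_X, map_mul, eval_X]
    rfl

/-- The square integrable functions of `v_k`. -/
abbrev velSpace (N : ℕ) (k : Fin N) : Submodule ℝ (L2 N) :=
  lpMeas ℝ ℝ (MeasurableSpace.comap (velocity k) inferInstance) 2 (sigma N)

lemma velLp_mem_velSpace (k : Fin N) (p : Poly) : velLp k p ∈ velSpace N k := by
  rw [mem_lpMeas_iff_aestronglyMeasurable]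
  refine ⟨velPoly k p, ?_, coeFn_velLp k p⟩
  have h : Measurable fun w : EuclideanSpace ℝ (Fin 3) =>
      eval (fun i => w i / √((N : ℝ) - 1)) p := by
    have : Continuous fun w : EuclideanSpace ℝ (Fin 3) => fun i => w i / √((N : ℝ) - 1) := by
      fun_prop
    exact ((MvPolynomial.continuous_eval p).comp this).measurable
  exact (h.comp (comap_measurable (velocity k))).stronglyMeasurable

/-- Polynomials are dense in the square integrable functions of `v_k`. -/
lemma mem_closure_range_velLp (hN : 2 ≤ N) {k : Fin N} {f : L2 N} (hf : f ∈ velSpace N k) :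
    f ∈ closure (Set.range (velLp k)) := by
  set ν := Measure.map (velocityBall k) (sigma N) with hν
  have hmp : MeasurePreserving (velocityBall k) (sigma N) ν := ⟨measurable_velocityBall k, rfl⟩
  have : IsFiniteMeasure ν := by rw [hν]; infer_instance
  obtain ⟨g, hg, hfg⟩ := mem_lpMeas_iff_aestronglyMeasurable.mp hf
  -- Regarding `v_k` as a point of a compact ball changes nothing in its σ-algebra. So `f` is the
  -- isometric pullback of a function on the ball, where Stone–Weierstrass applies.
  have hcomap : MeasurableSpace.comap (velocity k) inferInstance =
      MeasurableSpace.comap (velocityBall k) inferInstance := by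
    rw [show velocity k = Subtype.val ∘ velocityBall k from rfl, ← MeasurableSpace.comap_comp]
    rfl
  rw [hcomap] at hg
  obtain ⟨G, hG, rfl⟩ := hg.exists_eq_measurable_comp
  have hGL : MemLp G 2 ν := by
    rw [hν, memLp_map_measure_iff hG.aestronglyMeasurable (measurable_velocityBall k).aemeasurable]
    exact (Lp.memLp f).ae_eq hfg
  have hfG : f = Lp.compMeasurePreserving (velocityBall k) hmp (hGL.toLp G) := by
    rw [Lp.toLp_compMeasurePreserving]
    refine Lp.ext ?_
    exact hfg.trans (MemLp.coeFn_toLp _).symm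
  have hd : DenseRange fun p : Poly =>
      ContinuousMap.toLp (E := ℝ) 2 ν ℝ (aeval (ballCoord N) p) :=
    (ContinuousMap.toLp_denseRange ℝ ν ℝ (by norm_num)).comp (denseRange_aeval_ballCoord hN)
      (ContinuousMap.toLp (E := ℝ) 2 ν ℝ).continuous
  rw [hfG]
  refine map_mem_closure (Lp.isometry_compMeasurePreserving hmp).continuous (hd (hGL.toLp G)) ?_
  rintro _ ⟨p, rfl⟩
  refine ⟨p, Lp.ext ?_⟩
  refine (coeFn_velLp k p).trans ?_
  refine Filter.EventuallyEq.symm ((Lp.coeFn_compMeasurePreserving _ hmp).trans ?_)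
  have h1 := hmp.quasiMeasurePreserving.ae_eq_comp
    (ContinuousMap.coeFn_toLp (p := 2) (𝕜 := ℝ) ν (aeval (ballCoord N) p))
  refine h1.trans (Filter.Eventually.of_forall fun v => ?_)
  exact aeval_ballCoord_velocityBall k p v

end Density

/-! ### The averaged projection off the constants -/

section Projections

variable {N : ℕ}

lemma condProj_mem (k : Fin N) (f : L2 N) : condProj N k f ∈ velSpace N k :=
  (condExpL2 ℝ ℝ (measurable_velocity k).comap_le f).2

lemma condProj_of_mem {k : Fin N} {f : L2 N} (hf : f ∈ velSpace N k) : condProj N k f = f := by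
  have : Fact (MeasurableSpace.comap (velocity k) inferInstance ≤
      (inferInstance : MeasurableSpace (stateSpace N))) := ⟨(measurable_velocity k).comap_le⟩
  exact Submodule.starProjection_eq_self_iff.mpr hf

lemma inner_condProj_left (k : Fin N) (f g : L2 N) :
    inner ℝ (condProj N k f) g = inner ℝ f (condProj N k g) :=
  inner_condExpL2_left_eq_right (measurable_velocity k).comap_le

lemma inner_condProj_self (k : Fin N) (f : L2 N) :
    inner ℝ f (condProj N k f) = ‖condProj N k f‖ ^ 2 := by
  rw [← real_inner_self_eq_norm_sq, inner_condProj_left, condProj_of_mem (condProj_mem k f)]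

lemma condProj_oneLp (k : Fin N) : condProj N k (oneLp N) = oneLp N := by
  rw [← velLp_one k]
  exact condProj_of_mem (velLp_mem_velSpace k 1)

/-- Limit of the polynomial case; subtracting from each approximant its mean keeps the limit, since
the means tend to zero. -/
lemma norm_sum_sq_le (hN : 3 ≤ N) (f : Fin N → L2 N) (hf : ∀ k, f k ∈ velSpace N k)
    (hf0 : ∀ k, inner ℝ (oneLp N) (f k) = 0) :
    ‖∑ k, f k‖ ^ 2 ≤ (1 + ((N : ℝ) - 1) * topCorr ((N : ℝ) - 1)) * ∑ k, ‖f k‖ ^ 2 := by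
  have hseq : ∀ k, ∃ p : ℕ → Poly,
      Filter.Tendsto (fun n => velLp k (p n)) Filter.atTop (nhds (f k)) := by
    intro k
    obtain ⟨u, hu, hlim⟩ := mem_closure_iff_seq_limit.mp
      (mem_closure_range_velLp (by omega) (hf k))
    choose p hp using hu
    exact ⟨p, by simpa only [hp] using hlim⟩
  choose p hp using hseq
  set q : Fin N → ℕ → Poly := fun k n =>
    p k n - (inner ℝ (oneLp N) (velLp k (p k n)) : ℝ) • (1 : Poly) with hq
  have hqv : ∀ k n, velLp k (q k n) =
      velLp k (p k n) - (inner ℝ (oneLp N) (velLp k (p k n)) : ℝ) • oneLp N := by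
    intro k n
    rw [hq, map_sub, map_smul, velLp_one]
  have hqlim : ∀ k, Filter.Tendsto (fun n => velLp k (q k n)) Filter.atTop (nhds (f k)) := by
    intro k
    simp only [hqv]
    have h1 : Filter.Tendsto (fun n => (inner ℝ (oneLp N) (velLp k (p k n)) : ℝ)) Filter.atTop
        (nhds (inner ℝ (oneLp N) (f k))) := Filter.Tendsto.inner tendsto_const_nhds (hp k)
    have h2 := (hp k).sub (h1.smul_const (oneLp N))
    rwa [hf0, zero_smul, sub_zero] at h2
  have hq0 : ∀ k n, inner ℝ (oneLp N) (velLp k (q k n)) = 0 := by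
    intro k n
    rw [hqv, inner_sub_right, inner_smul_right, real_inner_self_eq_norm_sq, norm_oneLp hN]
    ring
  refine le_of_tendsto_of_tendsto' (((tendsto_finsetSum _ fun k _ => hqlim k).norm).pow 2)
    ((tendsto_finsetSum _ fun k _ => ((hqlim k).norm).pow 2).const_mul _) fun n => ?_
  exact norm_sum_velLp_sq_le hN (fun k => q k n) fun k => hq0 k n

/-- The second largest eigenvalue of `conjP0 N`. -/
def secondEig (N : ℕ) : ℝ := (3 * (N : ℝ) - 1) / (3 * ((N : ℝ) - 1) ^ 2)

lemma one_add_mul_topCorr (hN : 3 ≤ N) :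
    1 + ((N : ℝ) - 1) * topCorr ((N : ℝ) - 1) = N * secondEig N := by
  have hN3 : (3 : ℝ) ≤ N := by exact_mod_cast hN
  have h1 : (N : ℝ) - 1 ≠ 0 := by linarith
  rw [topCorr, secondEig]
  field_simp
  ring

lemma secondEig_pos (hN : 3 ≤ N) : 0 < secondEig N := by
  have hN3 : (3 : ℝ) ≤ N := by exact_mod_cast hN
  have h1 : 0 < (N : ℝ) - 1 := by linarith
  have h2 : 0 < 3 * (N : ℝ) - 1 := by linarith
  unfold secondEig
  positivity

lemma secondEig_lt_one (hN : 3 ≤ N) : secondEig N < 1 := by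
  have hN3 : (3 : ℝ) ≤ N := by exact_mod_cast hN
  rw [secondEig, div_lt_one (by nlinarith)]
  nlinarith

lemma inner_conjP0 (f g : L2 N) : inner ℝ f (conjP0 N g) =
    1 / (N : ℝ) * ∑ k, inner ℝ f (condProj N k g) := by
  rw [conjP0, smul_apply, inner_smul_right, sum_apply,
    inner_sum]

lemma inner_conjP0_left (f g : L2 N) : inner ℝ (conjP0 N f) g = inner ℝ f (conjP0 N g) := by
  rw [real_inner_comm, inner_conjP0, inner_conjP0]
  congr 1
  refine Finset.sum_congr rfl fun k _ => ?_
  rw [← inner_condProj_left, real_inner_comm]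

lemma conjP0_oneLp (hN : 3 ≤ N) : conjP0 N (oneLp N) = oneLp N := by
  have hN0 : (N : ℝ) ≠ 0 := by
    have : 0 < N := by omega
    positivity
  rw [conjP0, smul_apply, sum_apply]
  simp only [condProj_oneLp, Finset.sum_const, Finset.card_univ, Fintype.card_fin]
  rw [← Nat.cast_smul_eq_nsmul ℝ, smul_smul, one_div_mul_cancel hN0, one_smul]

/-- Off the constants, the averaged projection is bounded by `secondEig N`. -/
lemma inner_conjP0_le (hN : 3 ≤ N) {f : L2 N} (hf : inner ℝ (oneLp N) f = 0) :
    inner ℝ f (conjP0 N f) ≤ secondEig N * ‖f‖ ^ 2 := by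
  have hN0 : (0 : ℝ) < N := by
    have : 0 < N := by omega
    positivity
  have h1 := norm_sum_sq_le hN (fun k => condProj N k f) (fun k => condProj_mem k f) fun k => by
    rw [← inner_condProj_left, condProj_oneLp, hf]
  rw [one_add_mul_topCorr hN] at h1
  set S := ∑ k, ‖condProj N k f‖ ^ 2 with hS
  have hS' : inner ℝ f (∑ k, condProj N k f) = S := by
    rw [inner_sum]
    exact Finset.sum_congr rfl fun k _ => inner_condProj_self k f
  have hP : inner ℝ f (conjP0 N f) = 1 / (N : ℝ) * S := by
    rw [inner_conjP0, ← inner_sum, hS']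
  have h2 : S ≤ ‖f‖ * ‖∑ k, condProj N k f‖ := hS' ▸ real_inner_le_norm _ _
  have hS0 : 0 ≤ S := Finset.sum_nonneg fun k _ => sq_nonneg _
  -- Cauchy–Schwarz on `S = ⟨f, ∑ P_k f⟩`, followed by the bound on `‖∑ P_k f‖²`, in which `S`
  -- reappears and can be divided out.
  have h3 : S ^ 2 ≤ ‖f‖ ^ 2 * (N * secondEig N * S) := by
    calc S ^ 2 ≤ (‖f‖ * ‖∑ k, condProj N k f‖) ^ 2 := pow_le_pow_left₀ hS0 h2 2
      _ = ‖f‖ ^ 2 * ‖∑ k, condProj N k f‖ ^ 2 := mul_pow _ _ _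
      _ ≤ _ := mul_le_mul_of_nonneg_left h1 (sq_nonneg _)
  have h4 : S ≤ N * (secondEig N * ‖f‖ ^ 2) := by
    rcases hS0.eq_or_lt with h0 | h0
    · rw [← h0]
      have := secondEig_pos hN
      positivity
    · refine le_of_mul_le_mul_right ?_ h0
      linarith [sq S]
  rw [hP, one_div_mul_eq_div, div_le_iff₀ hN0]
  linarith

end Projections

/-! ### The extremal function built from `|x|² x₀` -/

section Eigenvector

variable {N : ℕ}

/-- The difference of the two sides is a function of `v_k` orthogonal to all polynomials in `v_k`,
which are dense. -/
lemma condProj_velLp (hN : 3 ≤ N) {k l : Fin N} (hkl : k ≠ l) {p : Poly} {D : ℕ}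
    (hp : p.totalDegree ≤ D) : condProj N k (velLp l p) = velLp k (velCorr N D p) := by
  set u := condProj N k (velLp l p) - velLp k (velCorr N D p) with hu
  have hmem : u ∈ velSpace N k := sub_mem (condProj_mem k _) (velLp_mem_velSpace k _)
  have horth : ∀ g ∈ Set.range (velLp k), inner ℝ g u = 0 := by
    rintro _ ⟨g, rfl⟩
    rw [hu, inner_sub_right, ← inner_condProj_left, condProj_of_mem (velLp_mem_velSpace k g),
      inner_velLp_of_ne hN hkl g hp, inner_velLp_same (by omega), sub_self]
  have hcl : u ∈ {g : L2 N | inner ℝ g u = 0} :=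
    closure_minimal horth (isClosed_eq (by fun_prop) continuous_const)
      (mem_closure_range_velLp (by omega) hmem)
  exact sub_eq_zero.mp (inner_self_eq_zero.mp hcl)

/-- The cubic polynomial `|x|² x₀` of the extremal function. -/
def cubicPoly : Poly := normSqPoly * X 0

lemma isHomogeneous_cubicPoly : cubicPoly.IsHomogeneous 3 :=
  isHomogeneous_normSqPoly.mul (isHomogeneous_X ℝ 0)

lemma lap_cubicPoly : lap cubicPoly = (10 : ℝ) • (X 0 : Poly) := by
  rw [cubicPoly, lap_normSqPoly_mul (isHomogeneous_X ℝ 0),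
    lap_eq_zero (isHomogeneous_X ℝ 0) (by norm_num)]
  norm_num

/-- Only the terms `j = 0, 1` survive: `t³ |x|² x₀ + w (1 - |x|²) 10 t x₀`. Its cubic coefficient
`t³ - 10 t w` is `topCorr (N - 1)`. -/
lemma exists_velCorr_cubicPoly (hN : 3 ≤ N) : ∃ b : ℝ, velCorr N 3 cubicPoly =
    topCorr ((N : ℝ) - 1) • cubicPoly + b • (X 0 : Poly) := by
  have hN3 : (3 : ℝ) ≤ N := by exact_mod_cast hN
  have h1 : (N : ℝ) - 1 ≠ 0 := by linarith
  have h2 : (N : ℝ) - 2 ≠ 0 := by linarith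
  set t : ℝ := -(1 / ((N : ℝ) - 1)) with ht
  set w := corrWeight (3 * (N : ℝ) - 6) (1 - t ^ 2) 1 with hw
  refine ⟨10 * t * w, ?_⟩
  have hX : lap (X 0 : Poly) = 0 := lap_eq_zero (isHomogeneous_X ℝ 0) (by norm_num)
  have l2 : (lap ^ 2) cubicPoly = 0 := by
    rw [pow_two, Module.End.mul_apply, lap_cubicPoly, map_smul, hX, smul_zero]
  have l3 : (lap ^ 3) cubicPoly = 0 := by
    rw [pow_succ', Module.End.mul_apply, l2, map_zero]
  have hk : topCorr ((N : ℝ) - 1) = t ^ 3 - 10 * t * w := by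
    rw [hw, corrWeight, topCorr, ht]
    simp only [Finset.prod_range_succ, Finset.prod_range_zero]
    rw [show 3 * (N : ℝ) - 6 = 3 * (N - 2) by ring]
    push_cast
    field_simp
    ring
  have w0 : corrWeight (3 * (N : ℝ) - 6) (1 - t ^ 2) 0 = 1 := by simp [corrWeight]
  clear_value t w
  rw [velCorr, ← ht, corrOp_apply, Finset.sum_range_succ, Finset.sum_range_succ, Finset.sum_range_succ,
    Finset.sum_range_one, l2, l3, pow_zero, pow_zero, pow_one, pow_one, Module.End.one_apply,
    lap_cubicPoly, w0, hk, ← hw, dil_of_isHomogeneous isHomogeneous_cubicPoly, map_smul,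
    dil_of_isHomogeneous (isHomogeneous_X ℝ 0)]
  simp only [cubicPoly, smul_eq_C_mul, map_one, map_zero, mul_zero, add_zero, map_sub, map_mul, map_pow]
  ring

lemma sum_velLp_X (i : Fin 3) : ∑ k : Fin N, velLp k (X i) = 0 := by
  have h : ∑ k : Fin N, velLp k (X i) = ContinuousMap.toLp 2 (sigma N) ℝ
      (∑ k : Fin N, ⟨velPoly k (X i), continuous_velPoly k (X i)⟩) := by
    rw [map_sum]
    rfl
  rw [h, show (∑ k : Fin N, (⟨velPoly k (X i), continuous_velPoly k (X i)⟩ : C(stateSpace N, ℝ))) = 0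
    from ?_, map_zero]
  ext v
  rw [ContinuousMap.sum_apply]
  simp only [ContinuousMap.coe_mk, velPoly, eval_X, ← Finset.sum_div]
  have hv : ∑ k, v.1 k i = 0 := by
    have h2 := v.2.2
    have hN : (1 / (N : ℝ)) ≠ 0 := by
      intro h0
      have := v.2.1
      rw [h0] at this
      simp at this
    have h3 := congrArg (fun w : EuclideanSpace ℝ (Fin 3) => w i)
      ((smul_eq_zero.mp h2).resolve_left hN)
    simpa using h3
  change (∑ k, v.1 k i) / _ = _
  rw [hv, zero_div]
  rfl

/-- For `h = ∑ |v_k|² v_k` (first component), each `P_l h` is a combination of the cubic and of `x₀`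
in `v_l`. Summed over `l`, the linear parts cancel because the total momentum is zero. -/
lemma exists_eigenvector_conjP0 (hN : 3 ≤ N) :
    ∃ h : L2 N, h ≠ 0 ∧ conjP0 N h = secondEig N • h := by
  obtain ⟨b, hb⟩ := exists_velCorr_cubicPoly hN
  have hN3 : (3 : ℝ) ≤ N := by exact_mod_cast hN
  set h : L2 N := ∑ k, velLp k cubicPoly with hh
  set r : Poly := ((N : ℝ) * secondEig N) • cubicPoly + (((N : ℝ) - 1) * b) • (X 0 : Poly) with hr
  have hproj : ∀ l, condProj N l h = velLp l r := by
    intro l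
    have h1 : condProj N l h = ∑ _k : Fin N, velLp l (velCorr N 3 cubicPoly) +
        (velLp l cubicPoly - velLp l (velCorr N 3 cubicPoly)) := by
      classical
      have h2 : ∀ k, condProj N l (velLp k cubicPoly) = velLp l (velCorr N 3 cubicPoly) +
          if k = l then velLp l cubicPoly - velLp l (velCorr N 3 cubicPoly) else 0 := by
        intro k
        split_ifs with hkl
        · subst hkl
          rw [condProj_of_mem (velLp_mem_velSpace k _)]
          abel
        · rw [condProj_velLp hN (Ne.symm hkl) isHomogeneous_cubicPoly.totalDegree_le, add_zero]
      rw [hh, map_sum]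
      simp only [h2, Finset.sum_add_distrib, Finset.sum_ite_eq', Finset.mem_univ, if_true]
    rw [h1, hr, ← one_add_mul_topCorr hN, hb, Finset.sum_const, Finset.card_univ, Fintype.card_fin,
      ← Nat.cast_smul_eq_nsmul ℝ]
    simp only [map_add, map_smul]
    module
  refine ⟨h, fun h0 => ?_, ?_⟩
  · have l : Fin N := ⟨0, by omega⟩
    have hz : velLp l r = 0 := by rw [← hproj, h0, map_zero]
    have hm : velMoment N l (r * r) = 0 := by
      rw [← inner_velLp_same (by omega), hz, inner_zero_left]
    have := nontrivial_zeroMomentum hN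
    have hr0 : r = 0 := eq_zero_of_moment_mul_self (lebesgueZeroMomentum N) (three_lt_finrank hN)
      (orthonormal_partVec (by omega) l)
      ((mul_eq_zero.mp (velMoment_apply l (r * r) ▸ hm)).resolve_left (sphereConst_pos hN).ne')
    -- If `h = 0`, then `r` is the zero polynomial; its values at `s = 1` and `s = 2` force the
    -- cubic coefficient, which is positive, to vanish.
    have hev : ∀ s : ℝ, (N : ℝ) * secondEig N * (s ^ 2 * s) + ((N : ℝ) - 1) * b * s = 0 := by
      intro s
      have := congrArg (eval ![s, 0, 0]) hr0
      simpa [hr, cubicPoly, normSqPoly, Fin.sum_univ_three, smul_eval] using this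
    have e1 := hev 1
    have e2 := hev 2
    have : 0 < (N : ℝ) * secondEig N := mul_pos (by linarith) (secondEig_pos hN)
    linarith
  · rw [conjP0, smul_apply, sum_apply]
    simp only [hproj, hr, map_add, map_smul, Finset.sum_add_distrib, ← Finset.smul_sum, sum_velLp_X]
    rw [smul_zero, add_zero, ← hh, smul_smul]
    congr 1
    field_simp

end Eigenvector

/-! ### Eigenvalues of `P⁽⁰⁾` and the spectral gap -/

section Gap

variable {N : ℕ}

lemma inner_oneLp_eq_zero_of_eigenvector (hN : 3 ≤ N) {f : L2 N} {κ : ℝ} (hκ : κ ≠ 1)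
    (hf : conjP0 N f = κ • f) : inner ℝ (oneLp N) f = 0 := by
  have h : inner ℝ (oneLp N) f = κ * inner ℝ (oneLp N) f := by
    conv_lhs => rw [← conjP0_oneLp hN, inner_conjP0_left, hf, inner_smul_right]
  by_contra h0
  exact hκ (mul_right_cancel₀ h0 ((one_mul _).trans h)).symm

lemma eigenvalue_le_secondEig (hN : 3 ≤ N) {f : L2 N} {κ : ℝ} (h0 : f ≠ 0)
    (hf : conjP0 N f = κ • f) (h1 : inner ℝ (oneLp N) f = 0) : κ ≤ secondEig N := by
  have h := inner_conjP0_le hN h1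
  rw [hf, inner_smul_right, real_inner_self_eq_norm_sq] at h
  exact le_of_mul_le_mul_right h (pow_pos (norm_pos_iff.mpr h0) 2)

lemma oneLp_ne_zero (hN : 3 ≤ N) : oneLp N ≠ 0 := by
  rw [← norm_ne_zero_iff, norm_oneLp hN]
  exact one_ne_zero

/-- Simplicity of the eigenvalue `1`: the part of `f` orthogonal to the constants would be an
eigenvector with eigenvalue `1 > secondEig N`. -/
lemma eq_smul_oneLp (hN : 3 ≤ N) {f : L2 N} (hf : conjP0 N f = f) :
    (inner ℝ (oneLp N) f : ℝ) • oneLp N = f := by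
  set g := f - (inner ℝ (oneLp N) f : ℝ) • oneLp N with hg
  have hg1 : inner ℝ (oneLp N) g = 0 := by
    rw [hg, inner_sub_right, inner_smul_right, real_inner_self_eq_norm_sq, norm_oneLp hN]
    ring
  have hgP : conjP0 N g = (1 : ℝ) • g := by
    rw [hg, map_sub, map_smul, conjP0_oneLp hN, hf, one_smul]
  have hg0 : g = 0 := by
    by_contra h
    exact absurd (eigenvalue_le_secondEig hN h hgP hg1) (not_le.mpr (secondEig_lt_one hN))
  exact (sub_eq_zero.mp hg0).symm

theorem isSecondLargestEigenvalue_conjP0 (hN : 3 ≤ N) :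
    IsSecondLargestEigenvalue (conjP0 N : L2 N →ₗ[ℝ] L2 N) (secondEig N) := by
  have hbound : ∀ κ, Module.End.HasEigenvalue (conjP0 N : L2 N →ₗ[ℝ] L2 N) κ → κ ≠ 1 →
      κ ≤ secondEig N := by
    intro κ hκ h1
    obtain ⟨f, hf, hf0⟩ := hκ.exists_hasEigenvector
    have hf' : conjP0 N f = κ • f := Module.End.mem_eigenspace_iff.mp hf
    exact eigenvalue_le_secondEig hN hf0 hf' (inner_oneLp_eq_zero_of_eigenvector hN h1 hf')
  have hone : oneLp N ∈ Module.End.eigenspace (conjP0 N : L2 N →ₗ[ℝ] L2 N) 1 :=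
    Module.End.mem_eigenspace_iff.mpr ((conjP0_oneLp hN).trans (one_smul ℝ _).symm)
  refine ⟨1, ⟨?_, fun κ hκ => ?_⟩, ?_, ⟨?_, (secondEig_lt_one hN).ne⟩, fun κ hκ => hbound κ hκ.1 hκ.2⟩
  · exact Module.End.hasEigenvalue_of_hasEigenvector ⟨hone, oneLp_ne_zero hN⟩
  · by_cases h1 : κ = 1
    · exact h1.le
    · exact (hbound κ hκ h1).trans (secondEig_lt_one hN).le
  · refine finrank_eq_one (⟨oneLp N, hone⟩ : Module.End.eigenspace (conjP0 N : L2 N →ₗ[ℝ] L2 N) 1)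
      (fun h => oneLp_ne_zero hN (congrArg Subtype.val h)) fun w => ⟨inner ℝ (oneLp N) w.1, ?_⟩
    have hw : conjP0 N w.1 = (1 : ℝ) • w.1 := Module.End.mem_eigenspace_iff.mp w.2
    exact Subtype.ext (eq_smul_oneLp hN (hw.trans (one_smul ℝ _)))
  · obtain ⟨h, h0, hh⟩ := exists_eigenvector_conjP0 hN
    exact Module.End.hasEigenvalue_of_hasEigenvector
      ⟨Module.End.mem_eigenspace_iff.mpr hh, h0⟩

lemma conjDirichlet_zero (hN : 3 ≤ N) (f : L2 N) :
    conjDirichlet N 0 f = ‖f‖ ^ 2 - inner ℝ f (conjP0 N f) := by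
  have hN0 : (N : ℝ) ≠ 0 := by
    have : 0 < N := by omega
    positivity
  have hint : ∀ k, Integrable (fun v => f v * (f v - condProj N k f v)) (sigma N) := by
    intro k
    refine (L2.integrable_inner (𝕜 := ℝ) f (f - condProj N k f)).congr ?_
    filter_upwards [Lp.coeFn_sub f (condProj N k f)] with v hv
    rw [hv]
    simp [mul_comm]
  have hval : ∀ k, ∫ v, f v * (f v - condProj N k f v) ∂sigma N =
      ‖f‖ ^ 2 - inner ℝ f (condProj N k f) := by
    intro k
    rw [← real_inner_self_eq_norm_sq, ← inner_sub_right, L2.inner_def]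
    refine integral_congr_ae ?_
    filter_upwards [Lp.coeFn_sub f (condProj N k f)] with v hv
    rw [hv]
    simp [mul_comm]
  have hpt : ∀ v, f v * conjGenerator N 0 f v =
      -(1 / (N : ℝ)) * ∑ k, f v * (f v - condProj N k f v) := by
    intro v
    simp only [conjGenerator, zero_div, Real.rpow_zero, one_mul, ← Finset.mul_sum]
    ring
  rw [conjDirichlet]
  simp only [hpt]
  rw [integral_const_mul, integral_finsetSum _ fun k _ => hint k]
  simp only [hval, Finset.sum_sub_distrib, Finset.sum_const, Finset.card_univ, Fintype.card_fin,
    nsmul_eq_mul]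
  rw [inner_conjP0]
  field_simp

/-- The infimum is attained, at the normalized extremal function. -/
theorem conjGap_zero (hN : 3 ≤ N) : conjGap N 0 = 1 - secondEig N := by
  refine IsLeast.csInf_eq ⟨?_, ?_⟩
  · obtain ⟨h, h0, hh⟩ := exists_eigenvector_conjP0 hN
    have hn : ‖h‖ ≠ 0 := norm_ne_zero_iff.mpr h0
    have h1 := inner_oneLp_eq_zero_of_eigenvector hN (secondEig_lt_one hN).ne hh
    have hnorm : ‖(‖h‖⁻¹ : ℝ) • h‖ ^ 2 = 1 := by
      rw [norm_smul, norm_inv, norm_norm, inv_mul_cancel₀ hn, one_pow]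
    refine ⟨(‖h‖⁻¹ : ℝ) • h, ?_, hnorm, ?_⟩
    · rw [← inner_oneLp, inner_smul_right, h1, mul_zero]
    · rw [conjDirichlet_zero hN, map_smul, hh, smul_comm, inner_smul_right,
        real_inner_self_eq_norm_sq, hnorm, mul_one]
  · rintro d ⟨f, hf, hf1, rfl⟩
    rw [← inner_oneLp] at hf
    have := inner_conjP0_le hN hf
    rw [conjDirichlet_zero hN, hf1]
    rw [hf1, mul_one] at this
    linarith

end Gap

end KacModel

end

theorem mainTheorem5 :
    (∀ N : ℕ, 3 ≤ N →
      KacModel.conjGap N 0 = 1 - (3 * (N : ℝ) - 1) / (3 * ((N : ℝ) - 1) ^ 2) ∧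
      KacModel.IsSecondLargestEigenvalue (KacModel.conjP0 N : KacModel.L2 N →ₗ[ℝ] KacModel.L2 N)
        ((3 * (N : ℝ) - 1) / (3 * ((N : ℝ) - 1) ^ 2))) ∧
    Asymptotics.IsBigO Filter.atTop
      (fun N : ℕ => KacModel.conjGap N 0 - (1 - 1 / (N : ℝ)))
      (fun N : ℕ => 1 / (N : ℝ) ^ 2) := by
  refine ⟨fun N hN => ⟨KacModel.conjGap_zero hN, KacModel.isSecondLargestEigenvalue_conjP0 hN⟩, ?_⟩
  -- The difference is exactly `-(5N - 3) / (3 (N - 1)² N)`, and `N (5N - 3) ≤ 15 (N - 1)²` for `N ≥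
  -- 3`.
  refine Asymptotics.IsBigO.of_bound 5 ?_
  filter_upwards [Filter.eventually_ge_atTop 3] with N hN
  have hN3 : (3 : ℝ) ≤ N := by exact_mod_cast hN
  have h1 : (0 : ℝ) < N - 1 := by linarith
  have e : KacModel.conjGap N 0 - (1 - 1 / (N : ℝ)) =
      -((5 * (N : ℝ) - 3) / (3 * (N - 1) ^ 2 * N)) := by
    rw [KacModel.conjGap_zero hN, KacModel.secondEig]
    field_simp
    ring
  have hpos : 0 ≤ (5 * (N : ℝ) - 3) / (3 * (N - 1) ^ 2 * N) :=
    div_nonneg (by linarith) (by positivity)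
  rw [e, norm_neg, Real.norm_of_nonneg hpos, Real.norm_of_nonneg (by positivity), mul_one_div,
    div_le_div_iff₀ (by positivity) (by positivity)]
  nlinarith [mul_nonneg (sub_nonneg.mpr hN3) (sub_nonneg.mpr hN3),
    mul_nonneg (mul_nonneg (sub_nonneg.mpr hN3) (sub_nonneg.mpr hN3)) (sub_nonneg.mpr hN3)]
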